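/- **Theorem 1.3.** Let $S$ be a (connected) Riemann surface and let $n\ge 1$. A *unitary curve* $f:S\to\mathbb P^m$ is a nondegenerate multi-valued holomorphic map (i.e. a holomorphic map on the universal covering of $S$) whose monodromy lies in $\mathrm{PSU}(m+1)\subset\mathrm{PSL}(m+1,\mathbb C)$; it is *totally unramified* if $F\wedge F'\wedge\dots\wedge F^{(m)}$ vanishes nowhere for the local holomorphic lifts $F$ of its branches to $\mathbb C^{m+1}\setminus\{0\}$. Let $v:S\to\mathbb P^1$ be a totally unramified unitary curve (equivalently, a developing map of a spherical metric on $S$), let $G_v\subset\mathrm{PSU}(2)$ be its monodromy group and $\overline{G_v}$ the closure of $G_v$ in $\mathrm{PSU}(2)$. Let $$r_n:\mathbb P^1\to\mathbb P^n,\qquad [z_0,z_1]\mapsto\Big[\tfrac{1}{\sqrt{n!}}z_0^n,\ \dots,\ \tfrac{1}{\sqrt{(n-i)!\,i!}}z_0^{n-i}z_1^i,\ \dots,\ \tfrac{1}{\sqrt{n!}}z_1^n\Big],$$ $$M_v=\{\varphi\in\mathrm{PSL}(n+1,\mathbb C)\mid \varphi\circ r_n\circ v:S\to\mathbb P^n\text{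 is a unitary curve}\},$$ and let $\Delta_{n+1}\subset\mathrm{SL}(n+1,\mathbb C)$ be the group of upper triangular matrices with positive diagonal entries. Then there is exactly one subset $\Delta_v\subset\Delta_{n+1}$ with $M_v=\mathrm{PSU}(n+1)\,\Delta_v$, and it is determined by $\overline{G_v}$: two such curves $v,v'$ (possibly on different Riemann surfaces) with $\overline{G_v}=\overline{G_{v'}}$ have $\Delta_v=\Delta_{v'}$. Let $p:\mathrm{SU}(2)\to\mathrm{PSU}(2)$ be the quotient map and consider the following subgroups of $\mathrm{SU}(2)$, where $i=\sqrt{-1}$ in matrix entries, $k\in\mathbb Z_{>0}$ and $c\in\mathbb C$ with $|c|=1$: $$\mathrm U(1)=\{\mathrm{diag}(z,\bar z): |z|=1\},\quad \mathrm O(2)=\Big\langle \mathrm U(1),\begin{pmatrix}0&-1\\1&0\end{pmatrix}\Big\rangle,\quad C_k=\langle\mathrm{diag}(e^{2\pi i/k},e^{-2\pi i/k})\rangle,\quad D_k^{c}=\Big\langle C_{2k},\begin{pmatrix}0&-\bar c\\ c&0\end{pmatrix}\Big\rangle,$$ $$E_6=\Big\langle \tfrac12\begin{pmatrix}1+i&1+i\\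 i-1&1-i\end{pmatrix},\begin{pmatrix}0&-i\\-i&0\end{pmatrix}\Big\rangle,\quad E_7=\Big\langle \tfrac12\begin{pmatrix}1+i&1+i\\ i-1&1-i\end{pmatrix},\tfrac{\sqrt2}{2}\begin{pmatrix}0&1+i\\ i-1&0\end{pmatrix}\Big\rangle,$$ $$E_8=\Big\langle \begin{pmatrix}\frac12&-\frac{\sqrt5-1}{4}+\frac{\sqrt5+1}{4}i\\ \frac{\sqrt5-1}{4}+\frac{\sqrt5+1}{4}i&\frac12\end{pmatrix},\begin{pmatrix}0&-i\\-i&0\end{pmatrix}\Big\rangle.$$ Put $\mathrm{PU}(1)=p(\mathrm U(1))$ and $\mathrm{PO}(2)=p(\mathrm O(2))$. Matrix indices run over $0,\dots,n$, and $\dim_{\mathbb R}$ is the dimension as an embedded smooth submanifold of the real vector space of complex $(n+1)\times(n+1)$ matrices; where a dimension is given, $\Delta_v$ is such a submanifold. 1. If $\overline{G_v}=\mathrm{PSU}(2)$, then $\Delta_v=\{I_{n+1}\}$. 2. If $\overline{G_v}=\mathrm{PU}(1)$, then $\Delta_v$ is the set of diagonal matrices in $\Delta_{n+1}$, and $\dim_{\mathbb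 R}\Delta_v=n$. 3. If $\overline{G_v}=\mathrm{PO}(2)$, then $\Delta_v=\{\mathrm{diag}(a_0,\dots,a_n)\in\Delta_{n+1}\mid a_i=a_{n-i}\}$, and $\dim_{\mathbb R}\Delta_v=\lfloor n/2\rfloor$. 4. If $\overline{G_v}=p(C_k)$, then $\Delta_v=\{(a_{ij})\in\Delta_{n+1}\mid a_{ij}=0\text{ if }\tfrac{k}{\gcd(k,2)}\nmid i-j\}$, and $$\dim_{\mathbb R}\Delta_v=-\tfrac{k}{\gcd(k,2)}\Big\lfloor\tfrac{n\gcd(k,2)}{k}\Big\rfloor^2+\Big(2n+2-\tfrac{k}{\gcd(k,2)}\Big)\Big\lfloor\tfrac{n\gcd(k,2)}{k}\Big\rfloor+n.$$ 5. If $\overline{G_v}=p(D_k^{c})$, then $\Delta_v$ is the set of $(a_{ij})\in\Delta_{n+1}$ such that, for all $i,j$, $$\sum_{l}\bar a_{li}a_{lj}=0\ \text{ if } k\nmid i-j,\qquad \sum_{l}\bar a_{li}a_{lj}=(-c^2)^{\,i-j}\sum_l\bar a_{l,n-i}a_{l,n-j},$$ and $\dim_{\mathbb R}\Delta_v=-\tfrac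 k2\lfloor\tfrac nk\rfloor^2+(n+1-\tfrac k2)\lfloor\tfrac nk\rfloor+\lfloor\tfrac n2\rfloor$. 6. If $\overline{G_v}=p(E_6)$, then $\dim_{\mathbb R}\Delta_v=\tfrac{n^2}{12}+\tfrac{2c_1^2}{3}+\tfrac n6-\epsilon$ with $\epsilon=\tfrac{11}{12}$ for $n$ odd and $\epsilon=\tfrac23$ for $n$ even. 7. If $\overline{G_v}=p(E_7)$, then $\dim_{\mathbb R}\Delta_v=\tfrac{n^2}{24}+\tfrac n{12}+\tfrac{c_1^2}{3}+\tfrac{b^2}{4}-\epsilon$ with $\epsilon=\tfrac{23}{24}$ for $n$ odd and $\epsilon=\tfrac7{12}$ for $n$ even, where $b=\cos\tfrac{n\pi}4+\sin\tfrac{n\pi}4$. 8. If $\overline{G_v}=p(E_8)$, then $\dim_{\mathbb R}\Delta_v=\tfrac{n^2}{60}+\tfrac n{30}+\tfrac{c_1^2}{3}+\tfrac{c_2^2}{5}+\tfrac{c_3^2}{5}-\epsilon$ with $\epsilon=\tfrac{59}{60}$ for $n$ odd and $\epsilon=\tfrac{11}{15}$ for $n$ even, where $c_2=\sqrt{1+\tfrac2{\sqrt5}}\,\sin\tfrac{n\pi}5+\cos\tfrac{n\pi}5$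 and $c_3=\sqrt{1-\tfrac2{\sqrt5}}\,\sin\tfrac{2n\pi}5+\cos\tfrac{2n\pi}5$. In 6, 7 and 8, $c_1=\cos\tfrac{n\pi}3+\tfrac{\sqrt3}{3}\sin\tfrac{n\pi}3$. -/

import Mathlib

open Matrix Filter Topology
open scoped ContDiff Manifold LinearAlgebra.Projectivization ComplexConjugate

noncomputable section

namespace TodaCurve

/-! ## The groups `SU(N)`, `PSL(N, ℂ)`, `PSU(N)` and the action on projective space -/

/-- The special unitary group `SU(N)`. -/
abbrev SU (N : ℕ) := Matrix.specialUnitaryGroup (Fin N) ℂ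

/-- The special linear group `SL(N, ℂ)`. -/
abbrev SLC (N : ℕ) := Matrix.SpecialLinearGroup (Fin N) ℂ

/-- `PSL(N, ℂ) = SL(N, ℂ) / center`, with the quotient topology. -/
abbrev PSLC (N : ℕ) := Matrix.ProjectiveSpecialLinearGroup (Fin N) ℂ

/-- Complex projective space of dimension `N - 1`, as the set of lines in `ℂ^N`. -/
abbrev CP (N : ℕ) := ℙ ℂ (Fin N → ℂ)

/-- The quotient map `SL(N, ℂ) → PSL(N, ℂ)`. -/
abbrev toPSL (N : ℕ) : SLC N →* PSLC N := QuotientGroup.mk' _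

/-- The inclusion `SU(N) → SL(N, ℂ)`. -/
def suToSL (N : ℕ) : SU N →* SLC N where
  toFun A := ⟨A.1, (Matrix.mem_specialUnitaryGroup_iff.1 A.2).2⟩
  map_one' := rfl
  map_mul' _ _ := rfl

/-- `PSU(N)`, the image of `SU(N)` in `PSL(N, ℂ)`. -/
def PSU (N : ℕ) : Subgroup (PSLC N) := ((toPSL N).comp (suToSL N)).range

/-- The quotient map `p : SU(N) → PSU(N)`. -/
def suToPSU (N : ℕ) : SU N →* PSU N := ((toPSL N).comp (suToSL N)).rangeRestrict

/-- `PSL(N, ℂ)` acting on projective space: the class of a matrix `A` sends `[x]` to `[A x]`. -/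
def pslPerm (N : ℕ) : PSLC N →* Equiv.Perm (CP N) :=
  QuotientGroup.lift _ (MulAction.toPermHom (SLC N) (CP N))
    (Projectivization.SL_mulAction_ker (K := ℂ) (ι := Fin N)).ge

/-! ## Multivalued holomorphic curves

A multivalued map on `S` is a map on the universal covering `pr : E → S`; its branches are
obtained by composing it with the local sections of `pr`. -/

section Curves

variable {S E : Type*} [TopologicalSpace S] [ChartedSpace ℂ S] [TopologicalSpace E]

/-- `F`, a map from `S` to `ℂ^N`, is near `pr e` a nowhere vanishing holomorphic lift of the
branch at `e` of the multivalued map `f`. -/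
def IsLocalLift {N : ℕ} (pr : E → S) (f : E → CP N) (e : E) (F : S → (Fin N → ℂ)) : Prop :=
  (∀ᶠ y in 𝓝 (pr e), MDifferentiableAt 𝓘(ℂ, ℂ) 𝓘(ℂ, Fin N → ℂ) F y) ∧
    ∀ᶠ x in 𝓝 e, ∃ h : F (pr x) ≠ 0, f x = Projectivization.mk ℂ (F (pr x)) h

/-- All branches of `f` are holomorphic. -/
def IsHolomorphicCurve {N : ℕ} (pr : E → S) (f : E → CP N) : Prop :=
  ∀ e, ∃ F, IsLocalLift pr f e F

/-- All branches of `f` are totally unramified: for a holomorphic lift `F` and a local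
coordinate, `F ∧ F' ∧ ⋯ ∧ F^(N-1)` vanishes nowhere. -/
def IsTotallyUnramified {N : ℕ} (pr : E → S) (f : E → CP N) : Prop :=
  ∀ e, ∃ F, IsLocalLift pr f e F ∧
    LinearIndependent ℂ (fun k : Fin N =>
      iteratedDeriv (k : ℕ) (F ∘ (chartAt ℂ (pr e)).symm) (chartAt ℂ (pr e) (pr e)))

/-- The image of `f` lies in no hyperplane. -/
def IsNondegenerate {N : ℕ} (f : E → CP N) : Prop :=
  ∀ l : (Fin N → ℂ) →ₗ[ℂ] ℂ, l ≠ 0 → ∃ e, l (f e).rep ≠ 0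

/-- `d` is a deck transformation of `pr`. The deck transformations of the universal covering form
a copy of the fundamental group of `S`. -/
def IsDeck (pr : E → S) (d : E ≃ₜ E) : Prop := ∀ e, pr (d e) = pr e

/-- A unitary curve: a (nondegenerate) multivalued holomorphic map from `S` to projective space
such that continuation along any loop changes it by an element of `PSU(N)`. -/
structure IsUnitaryCurve {N : ℕ} (pr : E → S) (f : E → CP N) : Prop where
  holomorphic : IsHolomorphicCurve pr f
  nondegenerate : IsNondegenerate f
  monodromy : ∀ d : E ≃ₜ E, IsDeck pr d → ∃ g ∈ PSU N, ∀ e, f (d e) = pslPerm N g (f e)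

/-- The monodromy group of a unitary curve, as a subgroup of `PSU(N)`. -/
def monodromyGroup {N : ℕ} (pr : E → S) (f : E → CP N) : Subgroup (PSU N) where
  carrier := {g | ∃ d : E ≃ₜ E, IsDeck pr d ∧ ∀ e, f (d e) = pslPerm N g (f e)}
  one_mem' := ⟨Homeomorph.refl E, fun _ => rfl, fun e => by simp⟩
  mul_mem' := by
    rintro a b ⟨d, hd, hda⟩ ⟨d', hd', hdb⟩
    refine ⟨d'.trans d, fun e => ?_, fun e => ?_⟩
    · simp [hd (d' e), hd' e]
    · simp [hda, hdb]
  inv_mem' := by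
    rintro a ⟨d, hd, hda⟩
    refine ⟨d.symm, fun e => ?_, fun e => ?_⟩
    · simpa using (hd (d.symm e)).symm
    · have h := hda (d.symm e)
      rw [Homeomorph.apply_symm_apply] at h
      simp [h]

end Curves

/-! ## The rational normal map -/

/-- The vector `(z₀^(n-i) z₁^i / √((n-i)! i!))`, `0 ≤ i ≤ n`. -/
def rationalNormalVec (n : ℕ) (z : Fin 2 → ℂ) : Fin (n + 1) → ℂ := fun i =>
  ((Real.sqrt (1 / ((n - (i : ℕ)).factorial * (i : ℕ).factorial : ℝ)) : ℝ) : ℂ) *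
    z 0 ^ (n - (i : ℕ)) * z 1 ^ (i : ℕ)

theorem sqrt_coeff_ne_zero (n i : ℕ) :
    ((Real.sqrt (1 / ((n - i).factorial * i.factorial : ℝ)) : ℝ) : ℂ) ≠ 0 := by
  rw [Complex.ofReal_ne_zero]
  exact (Real.sqrt_pos.2 (by positivity)).ne'

theorem rationalNormalVec_ne_zero (n : ℕ) {z : Fin 2 → ℂ} (hz : z ≠ 0) :
    rationalNormalVec n z ≠ 0 := by
  intro h
  by_cases h0 : z 0 = 0
  · have h1 : z 1 ≠ 0 := fun h1 => hz (by ext i; fin_cases i <;> simp [h0, h1])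
    have := congrFun h (Fin.last n)
    simp only [rationalNormalVec, Pi.zero_apply, mul_eq_zero, sqrt_coeff_ne_zero] at this
    simp [h1] at this
  · have := congrFun h 0
    simp only [rationalNormalVec, Pi.zero_apply, mul_eq_zero, sqrt_coeff_ne_zero] at this
    simp [h0] at this

theorem rationalNormalVec_smul (n : ℕ) (t : ℂ) (z : Fin 2 → ℂ) :
    rationalNormalVec n (t • z) = t ^ n • rationalNormalVec n z := by
  ext i
  have hi : (i : ℕ) ≤ n := Nat.lt_succ_iff.1 i.2
  have ht : t ^ n = t ^ (n - (i : ℕ)) * t ^ (i : ℕ) := by rw [← pow_add, Nat.sub_add_cancel hi]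
  simp only [rationalNormalVec, Pi.smul_apply, smul_eq_mul, mul_pow, ht]
  ring

/-- The rational normal map `r_n` from the projective line to projective `n`-space. -/
def rationalNormalMap (n : ℕ) : CP 2 → CP (n + 1) :=
  Projectivization.lift
    (fun z => Projectivization.mk ℂ (rationalNormalVec n z.1) (rationalNormalVec_ne_zero n z.2))
    (by
      rintro ⟨a, ha⟩ ⟨b, hb⟩ t (rfl : a = t • b)
      refine (Projectivization.mk_eq_mk_iff' _ _ _ _ _).2 ⟨t ^ n, ?_⟩
      exact (rationalNormalVec_smul n t b).symm)

/-! ## The sets `M_v`, `Δ_{n+1}` and `Δ_v` -/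

/-- `Δ_{n+1}`: upper triangular matrices of determinant one with positive diagonal entries. -/
def upperPos (n : ℕ) : Set (SLC (n + 1)) :=
  {A | (∀ i j, j < i → A.1 i j = 0) ∧ ∀ i, ∃ r : ℝ, 0 < r ∧ A.1 i i = r}

section Family

variable {S E : Type*} [TopologicalSpace S] [ChartedSpace ℂ S] [TopologicalSpace E]

/-- `M_v`: the `φ` in `PSL(n+1, ℂ)` for which `φ ∘ r_n ∘ v` is a unitary curve. -/
def unitarySet (n : ℕ) (pr : E → S) (v : E → CP 2) : Set (PSLC (n + 1)) :=
  {φ | IsUnitaryCurve pr (fun e => pslPerm (n + 1) φ (rationalNormalMap n (v e)))}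

/-- `Δ_v`: the elements of `Δ_{n+1}` whose class lies in `M_v`. -/
def deltaSet (n : ℕ) (pr : E → S) (v : E → CP 2) : Set (SLC (n + 1)) :=
  {δ | δ ∈ upperPos n ∧ toPSL (n + 1) δ ∈ unitarySet n pr v}

end Family

/-- The product `PSU(n+1) D` in `PSL(n+1, ℂ)` for a set `D` of matrices. -/
def psuMul (n : ℕ) (D : Set (SLC (n + 1))) : Set (PSLC (n + 1)) :=
  {φ | ∃ U ∈ PSU (n + 1), ∃ δ ∈ D, φ = U * toPSL (n + 1) δ}

/-! ## Real dimension -/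

/-- `X` is a nonempty embedded smooth submanifold, of dimension `d`, of the real normed space `V`:
near each of its points, `X` is parametrized by an open subset of `ℝ^d` through a smooth map `φ`
whose inverse is the restriction of a smooth map `ψ` on an open subset of `V`. -/
def IsSubmanifoldOfDim {V : Type*} [NormedAddCommGroup V] [NormedSpace ℝ V] (X : Set V)
    (d : ℕ) : Prop :=
  X.Nonempty ∧ ∀ x ∈ X, ∃ (U : Set V) (W : Set (EuclideanSpace ℝ (Fin d)))
    (φ : EuclideanSpace ℝ (Fin d) → V) (ψ : V → EuclideanSpace ℝ (Fin d)),
    IsOpen U ∧ x ∈ U ∧ IsOpen W ∧ ContDiffOn ℝ ∞ φ W ∧ ContDiffOn ℝ ∞ ψ U ∧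
    Set.MapsTo φ W (X ∩ U) ∧ Set.MapsTo ψ (X ∩ U) W ∧
    Set.LeftInvOn ψ φ W ∧ Set.LeftInvOn φ ψ (X ∩ U)

/-- The real dimension of a set of matrices is `r`: it is a smooth submanifold, of that dimension,
of the real vector space of all complex matrices. The number `r` is real so that it can be given
by a closed formula. -/
def HasRealDim {N : ℕ} (X : Set (SLC N)) (r : ℝ) : Prop :=
  ∃ d : ℕ, (d : ℝ) = r ∧
    IsSubmanifoldOfDim {a : Fin N → Fin N → ℂ | ∃ A ∈ X, ∀ i j, a i j = A.1 i j} d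

/-! ## Closed subgroups of `SU(2)` -/

theorem mem_SU_two {A : Matrix (Fin 2) (Fin 2) ℂ} (h10 : A 1 0 = -conj (A 0 1))
    (h11 : A 1 1 = conj (A 0 0)) (h : A 0 0 * conj (A 0 0) + A 0 1 * conj (A 0 1) = 1) :
    A ∈ Matrix.specialUnitaryGroup (Fin 2) ℂ := by
  rw [Matrix.mem_specialUnitaryGroup_iff, Matrix.mem_unitaryGroup_iff]
  constructor
  · ext i j
    fin_cases i <;> fin_cases j <;>
      simp [Matrix.mul_apply, Fin.sum_univ_two, Matrix.star_apply, h10, h11]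
    · exact h
    · ring
    · ring
    · linear_combination h
  · rw [Matrix.det_fin_two, h10, h11]
    linear_combination h

theorem Circle_mul_conj (z : Circle) : (z : ℂ) * conj (z : ℂ) = 1 := by
  rw [Complex.mul_conj, Circle.normSq_coe, Complex.ofReal_one]

/-- `diag(z, z⁻¹)` for `|z| = 1`. -/
def diagSU : Circle →* SU 2 where
  toFun z := ⟨!![(z : ℂ), 0; 0, conj (z : ℂ)],
    mem_SU_two (by simp) (by simp) (by simp [Circle_mul_conj])⟩
  map_one' := by
    apply Subtype.ext
    ext i j
    fin_cases i <;> fin_cases j <;> simp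
  map_mul' z w := by
    apply Subtype.ext
    ext i j
    fin_cases i <;> fin_cases j <;> simp

/-- The matrix with rows `(0, -c⁻¹)` and `(c, 0)`, for `|c| = 1`. -/
def antidiagSU (c : Circle) : SU 2 :=
  ⟨!![0, -conj (c : ℂ); (c : ℂ), 0],
    mem_SU_two (by simp) (by simp) (by simp [mul_comm, Circle_mul_conj])⟩

/-- `U(1)`, embedded diagonally in `SU(2)`. -/
def U1 : Subgroup (SU 2) := diagSU.range

/-- `O(2)`, generated by `U(1)` and the matrix with rows `(0, -1)` and `(1, 0)`. -/
def O2 : Subgroup (SU 2) := Subgroup.closure ((U1 : Set (SU 2)) ∪ {antidiagSU 1})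

/-- `C_k`, generated by `diag(exp(2πi/k), exp(-2πi/k))`. -/
def cyclicC (k : ℕ) : Subgroup (SU 2) :=
  Subgroup.zpowers (diagSU (Circle.exp (2 * Real.pi / k)))

/-- The binary dihedral group `D_k`, generated by `C_{2k}` and by a matrix with rows `(0, -c⁻¹)`
and `(c, 0)`; for `c = -i` these rows are `(0, -i)` and `(-i, 0)`. -/
def dihedralD (k : ℕ) (c : Circle) : Subgroup (SU 2) :=
  Subgroup.closure ((cyclicC (2 * k) : Set (SU 2)) ∪ {antidiagSU c})

/-- The matrix with rows `(0, -i)` and `(-i, 0)`, a generator of `E_6` and of `E_8`. -/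
def genI : SU 2 :=
  ⟨!![0, -Complex.I; -Complex.I, 0], mem_SU_two (by simp) (by simp) (by simp)⟩

/-- A generator, of order six, of `E_6` and of `E_7`. -/
def genT : SU 2 :=
  ⟨!![(1 + Complex.I) / 2, (1 + Complex.I) / 2; (Complex.I - 1) / 2, (1 - Complex.I) / 2],
    mem_SU_two (by simp [map_ofNat]; ring) (by simp [map_ofNat]; ring) (by
      simp [map_ofNat]
      linear_combination (-1 / 2 : ℂ) * Complex.I_sq)⟩

/-- The second generator of `E_7`. -/
def genO : SU 2 :=
  ⟨!![0, (Real.sqrt 2 : ℂ) * (1 + Complex.I) / 2; (Real.sqrt 2 : ℂ) * (Complex.I - 1) / 2, 0],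
    mem_SU_two (by simp [map_ofNat]; ring) (by simp) (by
      have h : (Real.sqrt 2 : ℂ) ^ 2 = 2 := by
        rw [← Complex.ofReal_pow, Real.sq_sqrt (by norm_num)]; norm_num
      simp [map_ofNat]
      linear_combination (1 - Complex.I ^ 2) / 4 * h - (1 / 2 : ℂ) * Complex.I_sq)⟩

/-- The second generator of `E_8`. -/
def genE : SU 2 :=
  ⟨!![1 / 2,
      -(((Real.sqrt 5 : ℂ) - 1) / 4) + ((Real.sqrt 5 : ℂ) + 1) / 4 * Complex.I;
      ((Real.sqrt 5 : ℂ) - 1) / 4 + ((Real.sqrt 5 : ℂ) + 1) / 4 * Complex.I, 1 / 2],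
    mem_SU_two (by simp [map_ofNat]; ring) (by simp [map_ofNat]) (by
      have h : (Real.sqrt 5 : ℂ) ^ 2 = 5 := by
        rw [← Complex.ofReal_pow, Real.sq_sqrt (by norm_num)]; norm_num
      simp [map_ofNat]
      linear_combination (1 / 8 : ℂ) * h - (((Real.sqrt 5 : ℂ) + 1) / 4) ^ 2 * Complex.I_sq)⟩

/-- The binary tetrahedral group. -/
def groupE6 : Subgroup (SU 2) := Subgroup.closure {genT, genI}

/-- The binary octahedral group. -/
def groupE7 : Subgroup (SU 2) := Subgroup.closure {genT, genO}

/-- The binary icosahedral group. -/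
def groupE8 : Subgroup (SU 2) := Subgroup.closure {genE, genI}

/-- The image `p(H)` in `PSU(2)` of a subgroup `H` of `SU(2)`, as a set. -/
def psuImage (H : Subgroup (SU 2)) : Set (PSU 2) := (H.map (suToPSU 2) : Set (PSU 2))

/-- The closure in `PSU(2)` of the monodromy group of `v`. -/
def closedMonodromy {S E : Type*} [TopologicalSpace S] [ChartedSpace ℂ S] [TopologicalSpace E]
    (pr : E → S) (v : E → CP 2) : Set (PSU 2) :=
  closure (monodromyGroup pr v : Set (PSU 2))

end TodaCurve

end

noncomputable section

namespace TodaCurve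

/-! ## The Cholesky decomposition -/

/-! The whole statement reduces to one linear condition on a Gram matrix. Because of the weights
1/√((n-i)! i!), the rational normal vectors satisfy ⟨r_n(u), r_n(z)⟩ = ⟨u, z⟩^n / n!. Hence γ in
SU(2) acts on the rational normal curve through a unitary matrix ρ(γ), its n-th symmetric power
(`symPow`). An unramified v takes infinitely many values, and any n+1 distinct points of the
rational normal curve are independent, so a matrix fixing the curve at all these points is scalar.
Therefore the curve A ∘ r_n ∘ v changes by a unitary matrix along a loop with monodromy γ exactly
when A ρ(γ) A⁻¹ is unitary up to a scalar, that is, when Aᴴ A commutes with ρ(γ)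
(`monodromy_iff_commute`). This is a closed condition on γ, so only the closure of the monodromy
group matters (`mem_unitarySet_iff_closedMonodromy`). Existence and uniqueness of the Cholesky
factor of Aᴴ A then give the decomposition of M_v and the uniqueness of Δ_v.

Thus Δ_v consists of the Cholesky factors of the positive definite matrices of determinant one in
the commutant of ρ(G). Normalizing the trace instead of the determinant turns these matrices into an
open subset of a real affine space. The Hermitian part of the commutant has the real dimension that
the commutant has over ℂ, so dim Δ_v is the complex dimension of the commutant minus one
(`hasRealDim_of_gram`, `finrank_hermPart`, `hasRealDim_deltaSet`).

It remains to find the commutants. For the subgroups of O(2) they are given by a pattern of zeros,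
with a symmetry under index reversal if an antidiagonal element is present, and the dimension is a
count of congruent pairs. For subgroups of U(1), uniqueness of the Cholesky factor moves the pattern
from Aᴴ A to A itself (`gram_mem_commutant_iff`). For SU(2) the commutant is scalar by
irreducibility. For the polyhedral groups the dimension is the mean square of the character
(`finrank_commutant_of_representatives`), evaluated from explicit tables of integral quaternions and
the formula sin((n+1)x) / sin x. -/

/-- Upper triangular matrices with positive diagonal entries. -/
def IsUpperPos {N : ℕ} (A : Matrix (Fin N) (Fin N) ℂ) : Prop :=
  (∀ i j, j < i → A i j = 0) ∧ ∀ i, ∃ r : ℝ, 0 < r ∧ A i i = r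

theorem IsUpperPos.diag_re_pos {N : ℕ} {A : Matrix (Fin N) (Fin N) ℂ} (h : IsUpperPos A)
    (i : Fin N) : 0 < (A i i).re := by
  obtain ⟨r, hr, e⟩ := h.2 i
  simpa [e] using hr

theorem IsUpperPos.diag_eq {N : ℕ} {A : Matrix (Fin N) (Fin N) ℂ} (h : IsUpperPos A)
    (i : Fin N) : A i i = (A i i).re := by
  obtain ⟨r, hr, e⟩ := h.2 i
  simp [e]

theorem IsUpperPos.det_eq {N : ℕ} {A : Matrix (Fin N) (Fin N) ℂ} (h : IsUpperPos A) :
    A.det = ((∏ i, (A i i).re : ℝ) : ℂ) := by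
  rw [Matrix.det_of_isUpperTriangular (fun i j hij => h.1 i j hij)]
  push_cast
  exact Finset.prod_congr rfl fun i _ => h.diag_eq i

theorem IsUpperPos.gram_apply {N : ℕ} {A : Matrix (Fin N) (Fin N) ℂ} (h : IsUpperPos A)
    (i j : Fin N) : (Aᴴ * A) i j =
      ∑ l ∈ Finset.Iio i, conj (A l i) * A l j + (A i i).re * A i j := by
  rw [Matrix.mul_apply, ← Finset.sum_subset (Finset.subset_univ (Finset.Iic i))]
  · rw [← Finset.Iio_insert, Finset.sum_insert (by simp), add_comm]
    congr 1
    · rw [Matrix.conjTranspose_apply, h.diag_eq i]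
      simp
  · intro l _ hl
    rw [Matrix.conjTranspose_apply, h.1 l i (by simpa using hl)]
    simp

/-- This is the Cholesky recursion: row i is expressed through the Gram matrix, the earlier rows and
the pivot. With `IsUpperPos.diag_re_eq` for the pivot, it yields both uniqueness and smoothness of
the factor. -/
theorem IsUpperPos.row_eq {N : ℕ} {A : Matrix (Fin N) (Fin N) ℂ} (h : IsUpperPos A)
    (i j : Fin N) : A i j =
      ((Aᴴ * A) i j - ∑ l ∈ Finset.Iio i, conj (A l i) * A l j) / (A i i).re := by
  rw [h.gram_apply, add_sub_cancel_left, mul_div_cancel_left₀]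
  exact_mod_cast (h.diag_re_pos i).ne'

theorem IsUpperPos.diag_re_eq {N : ℕ} {A : Matrix (Fin N) (Fin N) ℂ} (h : IsUpperPos A)
    (i : Fin N) : (A i i).re =
      Real.sqrt (((Aᴴ * A) i i - ∑ l ∈ Finset.Iio i, conj (A l i) * A l i).re) := by
  rw [h.gram_apply, add_sub_cancel_left]
  nth_rw 3 [h.diag_eq i]
  rw [← Complex.ofReal_mul, Complex.ofReal_re, Real.sqrt_mul_self (h.diag_re_pos i).le]

theorem IsUpperPos.radicand_pos {N : ℕ} {A : Matrix (Fin N) (Fin N) ℂ} (h : IsUpperPos A)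
    (i : Fin N) :
    0 < ((Aᴴ * A) i i - ∑ l ∈ Finset.Iio i, conj (A l i) * A l i).re := by
  have := h.diag_re_pos i
  rw [h.diag_re_eq] at this
  exact Real.sqrt_pos.1 this

theorem IsUpperPos.eq_of_gram_eq {N : ℕ} {A B : Matrix (Fin N) (Fin N) ℂ} (hA : IsUpperPos A)
    (hB : IsUpperPos B) (h : Aᴴ * A = Bᴴ * B) : A = B := by
  have key : ∀ i j, A i j = B i j := by
    intro i
    induction i using WellFoundedLT.induction with
    | _ i ih => 
    have hs : ∀ j, ∑ l ∈ Finset.Iio i, conj (A l i) * A l j =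
        ∑ l ∈ Finset.Iio i, conj (B l i) * B l j := fun j =>
      Finset.sum_congr rfl fun l hl => by
        rw [ih l (Finset.mem_Iio.1 hl) i, ih l (Finset.mem_Iio.1 hl) j]
    intro j
    rw [hA.row_eq, hB.row_eq, hA.diag_re_eq, hB.diag_re_eq, h, hs, hs]
  exact Matrix.ext key

/-- Row by row, the Cholesky recursion uses only sums, products, division by a positive pivot and
the square root of a positive number, so the factor is as smooth as the Gram matrix. -/
theorem contDiffOn_of_gram {V : Type*} [NormedAddCommGroup V] [NormedSpace ℝ V] {N : ℕ}
    {W : Set V} {f : V → Matrix (Fin N) (Fin N) ℂ} (hf : ∀ x ∈ W, IsUpperPos (f x))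
    (hg : ∀ i j, ContDiffOn ℝ ∞ (fun x => ((f x)ᴴ * f x) i j) W) (i j : Fin N) :
    ContDiffOn ℝ ∞ (fun x => f x i j) W := by
  revert j
  induction i using WellFoundedLT.induction with
  | _ i ih =>
  have hs : ∀ j, ContDiffOn ℝ ∞ (fun x =>
      ((f x)ᴴ * f x) i j - ∑ l ∈ Finset.Iio i, conj (f x l i) * f x l j) W := by
    intro j
    refine (hg i j).sub (ContDiffOn.sum fun l hl => ?_)
    refine ContDiffOn.mul ?_ (ih l (Finset.mem_Iio.1 hl) j)
    exact (Complex.conjCLE.contDiff.comp_contDiffOn (ih l (Finset.mem_Iio.1 hl) i))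
  have hd : ContDiffOn ℝ ∞ (fun x => (f x i i).re) W := by
    refine ContDiffOn.congr (ContDiffOn.sqrt (Complex.reCLM.contDiff.comp_contDiffOn (hs i))
      fun x hx => ((hf x hx).radicand_pos i).ne') fun x hx => (hf x hx).diag_re_eq i
  intro j
  refine ContDiffOn.congr ((hd.inv fun x hx => ((hf x hx).diag_re_pos i).ne').smul (hs j))
    fun x hx => ?_
  have hr : ∀ (r : ℝ) (z : ℂ), z / r = r⁻¹ • z := fun r z => by
    rw [Complex.real_smul, Complex.ofReal_inv, inv_mul_eq_div]
  exact ((hf x hx).row_eq i j).trans (hr _ _)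

open scoped ComplexOrder in
-- The LDL decomposition is rewritten as a Cholesky decomposition by absorbing the square root of
-- the positive diagonal part.
theorem exists_isUpperPos_gram {N : ℕ} {M : Matrix (Fin N) (Fin N) ℂ} (hM : M.PosDef) :
    ∃ A : Matrix (Fin N) (Fin N) ℂ, IsUpperPos A ∧ Aᴴ * A = M := by
  set L := LDL.lower hM with hL
  have hLM : L * LDL.diag hM * Lᴴ = M := LDL.lower_conj_diag hM
  have hLinv : IsUnit (LDL.lowerInv hM) := isUnit_of_invertible _
  have hLt : L.BlockTriangular OrderDual.toDual := by
    have : (LDL.lowerInv hM).BlockTriangular OrderDual.toDual := fun i j hij =>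
      LDL.lowerInv_triangular hM hij
    exact Matrix.blockTriangular_inv_of_blockTriangular this
  have hLdet : L.det ≠ 0 := by
    rw [hL, LDL.lower, Matrix.det_nonsing_inv]
    exact (((Matrix.isUnit_iff_isUnit_det _).1 hLinv).ringInverse).ne_zero
  have hLd : ∀ i, L i i ≠ 0 := by
    rw [Matrix.det_of_isLowerTriangular L hLt] at hLdet
    exact fun i => Finset.prod_ne_zero_iff.1 hLdet i (Finset.mem_univ i)
  have hD : (LDL.diag hM).PosDef := by
    rw [LDL.diag_eq_lowerInv_conj]
    exact (Matrix.IsUnit.posDef_star_right_conjugate_iff hLinv).2 hM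
  set d := LDL.diagEntries hM
  have hd : ∀ i, 0 < d i := by
    intro i
    have := hD.diag_pos (i := i)
    simpa [LDL.diag] using this
  -- The phase L i i / ‖L i i‖ cancels that of the conjugate diagonal entry of Lᴴ and makes the new
  -- diagonal positive; having modulus one, it disappears from the Gram matrix.
  set e : Fin N → ℂ := fun i => (Real.sqrt (d i).re : ℂ) * (L i i / ‖L i i‖) with he
  refine ⟨Matrix.diagonal e * Lᴴ, ⟨fun i j hij => ?_, fun i => ?_⟩, ?_⟩
  · have : L j i = 0 := hLt hij
    simp [Matrix.diagonal_mul, this]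
  · refine ⟨Real.sqrt (d i).re * ‖L i i‖, mul_pos (Real.sqrt_pos.2 ?_) (norm_pos_iff.2 (hLd i)), ?_⟩
    · exact (Complex.pos_iff.1 (hd i)).1
    · have hn : (‖L i i‖ : ℂ) ≠ 0 := by exact_mod_cast norm_ne_zero_iff.2 (hLd i)
      have := Complex.mul_conj' (L i i)
      simp only [Matrix.diagonal_mul, Matrix.conjTranspose_apply, he]
      push_cast
      field_simp
      rw [mul_assoc, Complex.star_def, this]
  · rw [Matrix.conjTranspose_mul, Matrix.conjTranspose_conjTranspose, Matrix.mul_assoc,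
      ← Matrix.mul_assoc _ _ Lᴴ, Matrix.diagonal_conjTranspose, Matrix.diagonal_mul_diagonal,
      ← Matrix.mul_assoc]
    rw [← hLM]
    congr 2
    rw [LDL.diag]
    congr 1
    ext i
    have hn : (‖L i i‖ : ℂ) ≠ 0 := by exact_mod_cast norm_ne_zero_iff.2 (hLd i)
    have h1 := Complex.conj_mul' (L i i)
    have h2 : (Real.sqrt (d i).re : ℂ) * Real.sqrt (d i).re = d i := by
      rw [← Complex.ofReal_mul, Real.mul_self_sqrt (Complex.pos_iff.1 (hd i)).1.le]
      exact (Complex.eq_re_of_ofReal_le (hd i).le).symm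
    simp only [he, Pi.star_apply, Complex.star_def, map_mul, map_div₀, Complex.conj_ofReal]
    field_simp
    change _ = _ * d i
    linear_combination (Real.sqrt (d i).re : ℂ) ^ 2 * h1 + (‖L i i‖ : ℂ) ^ 2 * h2

/-! ## Submanifolds of triangular matrices cut out by a linear condition on the Gram matrix -/

open scoped ComplexOrder in
-- Positivity of the quadratic form needs testing only on the unit sphere, and compactness of the
-- sphere makes this an open condition on the parameter.
theorem isOpen_posDef {V : Type*} [TopologicalSpace V] {N : ℕ} {f : V → Matrix (Fin N) (Fin N) ℂ}
    (hf : Continuous f) (hherm : ∀ x, (f x).IsHermitian) : IsOpen {x | (f x).PosDef} := by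
  rw [isOpen_iff_mem_nhds]
  intro x₀ hx₀
  have hK : IsCompact (Metric.sphere (0 : Fin N → ℂ) 1) := isCompact_sphere _ _
  have hq : Continuous fun z : V × (Fin N → ℂ) => (star z.2 ⬝ᵥ (f z.1 *ᵥ z.2)).re := by
    refine Complex.continuous_re.comp (Continuous.dotProduct continuous_snd.star ?_)
    exact (hf.comp continuous_fst).matrix_mulVec continuous_snd
  have := hK.eventually_forall_of_forall_eventually (x₀ := x₀)
    (P := fun x y => 0 < (star y ⬝ᵥ (f x *ᵥ y)).re) fun y hy => by
      refine hq.continuousAt.eventually_const_lt ?_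
      have hy0 : y ≠ 0 := by
        rintro rfl
        simp at hy
      exact (Complex.pos_iff.1 ((Matrix.posDef_iff_dotProduct_mulVec.1 hx₀).2 hy0)).1
  filter_upwards [this] with x hx
  refine Matrix.posDef_iff_dotProduct_mulVec.2 ⟨hherm x, fun y hy => ?_⟩
  have him : (star y ⬝ᵥ (f x *ᵥ y)).im = 0 := (hherm x).im_star_dotProduct_mulVec_self y
  refine Complex.pos_iff.2 ⟨?_, him.symm⟩
  have hn : 0 < ‖y‖ := norm_pos_iff.2 hy
  have h1 := hx (((‖y‖⁻¹ : ℝ) : ℂ) • y) (by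
    rw [mem_sphere_zero_iff_norm, norm_smul, Complex.norm_real, norm_inv, norm_norm,
      inv_mul_cancel₀ hn.ne'])
  rw [star_smul, smul_dotProduct, Matrix.mulVec_smul, dotProduct_smul, Complex.star_def,
    Complex.conj_ofReal, smul_eq_mul, smul_eq_mul, Complex.re_ofReal_mul,
    Complex.re_ofReal_mul] at h1
  exact pos_of_mul_pos_right (pos_of_mul_pos_right h1 (by positivity)) (by positivity)

open scoped ComplexOrder in
theorem posDef_gram {N : ℕ} (A : SLC N) : (A.1ᴴ * A.1).PosDef := by
  refine Matrix.PosDef.conjTranspose_mul_self _ ?_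
  refine Matrix.mulVec_injective_iff_isUnit.2 ?_
  rw [Matrix.isUnit_iff_isUnit_det, A.2]
  exact isUnit_one

theorem det_eq_one_of_gram {N : ℕ} {A : Matrix (Fin N) (Fin N) ℂ} (hA : IsUpperPos A)
    (h : (Aᴴ * A).det = 1) : A.det = 1 := by
  rw [Matrix.det_mul, Matrix.det_conjTranspose, hA.det_eq, Complex.star_def, Complex.conj_ofReal,
    ← Complex.ofReal_mul] at h
  rw [hA.det_eq]
  have h' : (∏ i, (A i i).re) * (∏ i, (A i i).re) = 1 := by exact_mod_cast h
  have hp : 0 < ∏ i, (A i i).re := Finset.prod_pos fun i _ => hA.diag_re_pos i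
  have : (∏ i, (A i i).re) = 1 := by nlinarith
  rw [this, Complex.ofReal_one]

/-- Comparing determinants gives r ^ N = 1, so the positive factor r is 1 and uniqueness of the
Cholesky factor applies. -/
theorem eq_of_gram_eq_smul {N : ℕ} (hN : N ≠ 0) {A B : SLC N} (hA : IsUpperPos A.1)
    (hB : IsUpperPos B.1) {r : ℝ} (hr : 0 < r) (h : A.1ᴴ * A.1 = (r : ℂ) • (B.1ᴴ * B.1)) :
    A = B := by
  have hd := congrArg Matrix.det h
  rw [Matrix.det_smul, Matrix.det_mul, Matrix.det_mul, Matrix.det_conjTranspose,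
    Matrix.det_conjTranspose, A.2, B.2, Fintype.card_fin] at hd
  have h1 : r ^ N = 1 := by
    have : (r : ℂ) ^ N = 1 := by simpa using hd.symm
    exact_mod_cast this
  have h2 : r = 1 := (pow_eq_one_iff_of_nonneg hr.le hN).1 h1
  rw [h2, Complex.ofReal_one, one_smul] at h
  exact Subtype.ext (hA.eq_of_gram_eq hB h)

/-- The factor that normalizes the determinant: for positive definite `M`, the matrix
`normDet M • M` has determinant one. -/
def normDet {N : ℕ} (M : Matrix (Fin N) (Fin N) ℂ) : ℝ := M.det.re ^ (-(1 / N : ℝ))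

open scoped ComplexOrder in
theorem normDet_pos {N : ℕ} {M : Matrix (Fin N) (Fin N) ℂ} (hM : M.PosDef) : 0 < normDet M :=
  Real.rpow_pos_of_pos (Complex.pos_iff.1 hM.det_pos).1 _

open scoped ComplexOrder in
theorem det_normDet_smul {N : ℕ} (hN : N ≠ 0) {M : Matrix (Fin N) (Fin N) ℂ} (hM : M.PosDef) :
    ((normDet M : ℂ) • M).det = 1 := by
  have hp := Complex.pos_iff.1 hM.det_pos
  have hN' : (N : ℝ) ≠ 0 := by exact_mod_cast hN
  rw [Matrix.det_smul, Fintype.card_fin, normDet, ← Complex.ofReal_pow, ← Real.rpow_natCast,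
    ← Real.rpow_mul hp.1.le, neg_mul, one_div, inv_mul_cancel₀ hN', Real.rpow_neg_one]
  have : M.det = (M.det.re : ℂ) := Complex.ext rfl (by simpa using hp.2.symm)
  rw [this, Complex.ofReal_re, ← Complex.ofReal_mul, inv_mul_cancel₀ hp.1.ne', Complex.ofReal_one]

open scoped ComplexOrder in
theorem exists_isUpperPos_normDet {N : ℕ} (hN : N ≠ 0) {M : Matrix (Fin N) (Fin N) ℂ}
    (hM : M.PosDef) : ∃ A : SLC N, IsUpperPos A.1 ∧ A.1ᴴ * A.1 = (normDet M : ℂ) • M := by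
  have hpos : ((normDet M : ℂ) • M).PosDef :=
    hM.smul (a := (normDet M : ℂ)) (Complex.zero_lt_real.2 (normDet_pos hM))
  obtain ⟨A, hA, hAM⟩ := exists_isUpperPos_gram hpos
  exact ⟨⟨A, det_eq_one_of_gram hA (by rw [hAM, det_normDet_smul hN hM])⟩, hA, hAM⟩

open scoped ComplexOrder in
-- The Cholesky factorization identifies X with the rays of positive definite matrices in V. Each
-- ray has one point of determinant one, which gives the element of X, and one point of trace N,
-- which gives a coordinate in 1 + K, where K is the traceless part of V. The latter points form an
-- open subset of an affine space of dimension d, so a single chart covers X.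
theorem hasRealDim_of_gram {N d : ℕ} (hN : N ≠ 0) {X : Set (SLC N)}
    (V : Submodule ℝ (Matrix (Fin N) (Fin N) ℂ)) (hV : ∀ H ∈ V, H.IsHermitian)
    (h1 : (1 : Matrix (Fin N) (Fin N) ℂ) ∈ V) (hd : Module.finrank ℝ V = d + 1)
    (hX : ∀ A : SLC N, A ∈ X ↔ IsUpperPos A.1 ∧ A.1ᴴ * A.1 ∈ V) : HasRealDim X d := by
  classical
  have hN' : (0 : ℝ) < N := by exact_mod_cast Nat.pos_of_ne_zero hN
  -- the traceless part of `V`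
  let τ₀ : Matrix (Fin N) (Fin N) ℂ →ₗ[ℝ] ℝ :=
    Complex.reLm ∘ₗ (Matrix.traceLinearMap (Fin N) ℝ ℂ)
  have hτ₀ : ∀ H, τ₀ H = H.trace.re := fun _ => rfl
  let τ : V →ₗ[ℝ] ℝ := τ₀ ∘ₗ V.subtype
  have hτsurj : LinearMap.range τ = ⊤ := by
    refine LinearMap.range_eq_top.2 (LinearMap.surjective ?_)
    intro h0
    have := LinearMap.congr_fun h0 ⟨1, h1⟩
    simp [τ, hτ₀, hN] at this
  have hker : Module.finrank ℝ (EuclideanSpace ℝ (Fin d)) = Module.finrank ℝ (LinearMap.ker τ) := by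
    have := LinearMap.finrank_range_add_finrank_ker τ
    rw [hτsurj, finrank_top, Module.finrank_self, hd] at this
    rw [finrank_euclideanSpace_fin]
    omega
  let K := (LinearMap.ker τ).map V.subtype
  have hKV : ∀ Y ∈ K, Y ∈ V ∧ Y.trace.re = 0 := by
    rintro _ ⟨Y, hY, rfl⟩
    exact ⟨Y.2, hY⟩
  let eq := LinearEquiv.ofFinrankEq (EuclideanSpace ℝ (Fin d)) K
    (hker.trans (Submodule.finrank_map_subtype_eq V (LinearMap.ker τ)).symm)
  let e₀ : EuclideanSpace ℝ (Fin d) →ₗ[ℝ] (Fin N → Fin N → ℂ) := K.subtype ∘ₗ eq.toLinearMap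
  have he₀ : LinearMap.ker e₀ = ⊥ := by
    refine LinearMap.ker_eq_bot.2 ?_
    exact Subtype.val_injective.comp eq.injective
  obtain ⟨p₀, hp₀⟩ := e₀.exists_leftInverse_of_injective he₀
  let e := LinearMap.toContinuousLinearMap e₀
  let p := LinearMap.toContinuousLinearMap p₀
  have hpe : ∀ y, p (e y) = y := fun y => LinearMap.congr_fun hp₀ y
  have hep : ∀ Y : Fin N → Fin N → ℂ, (Matrix.of Y) ∈ V → (Matrix.of Y).trace.re = 0 →
      e (p Y) = Y := by
    intro Y hY hY0
    have : e (eq.symm ⟨Matrix.of Y, ⟨⟨Matrix.of Y, hY⟩, hY0, rfl⟩⟩) = Y := by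
      change (eq (eq.symm _)).1 = _
      rw [LinearEquiv.apply_symm_apply]
      rfl
    rw [← this, hpe]
  let M : EuclideanSpace ℝ (Fin d) → Matrix (Fin N) (Fin N) ℂ := fun y => 1 + Matrix.of (e y)
  have heV : ∀ y, Matrix.of (e y) ∈ V := fun y => (hKV _ (eq y).2).1
  have he0 : ∀ y, (Matrix.of (e y)).trace.re = 0 := fun y => (hKV _ (eq y).2).2
  have hMV : ∀ y, M y ∈ V := fun y => V.add_mem h1 (heV y)
  have hMij : ∀ i j, ContDiff ℝ ∞ fun y => M y i j := by
    intro i j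
    have h2 : ContDiff ℝ ∞ fun y => e y i j :=
      (contDiff_pi.1 ((contDiff_pi.1 e.contDiff) i) j)
    exact contDiff_const.add h2
  have hMtr : ∀ y, (M y).trace.re = N := by
    intro y
    rw [Matrix.trace_add, Complex.add_re, he0]
    simp
  let W : Set (EuclideanSpace ℝ (Fin d)) := {y | (M y).PosDef}
  have hWo : IsOpen W :=
    isOpen_posDef (continuous_matrix fun i j => (hMij i j).continuous) fun y => hV _ (hMV y)
  -- the parametrization
  have hex : ∀ y, ∃ A : SLC N, y ∈ W →
      IsUpperPos A.1 ∧ A.1ᴴ * A.1 = (normDet (M y) : ℂ) • M y := by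
    intro y
    by_cases hy : y ∈ W
    · obtain ⟨A, hA⟩ := exists_isUpperPos_normDet hN hy
      exact ⟨A, fun _ => hA⟩
    · exact ⟨1, fun h => absurd h hy⟩
  choose φ hφ using hex
  have hdet : ContDiff ℝ ∞ fun y => (M y).det.re := by
    refine Complex.reCLM.contDiff.comp ?_
    simp only [Matrix.det_apply]
    refine ContDiff.sum fun σ _ => ?_
    exact (contDiff_prod fun i _ => hMij (σ i) i).const_smul (Equiv.Perm.sign σ)
  have hnd : ContDiffOn ℝ ∞ (fun y => normDet (M y)) W :=
    hdet.contDiffOn.rpow_const_of_ne fun y hy => ((Complex.pos_iff.1 hy.det_pos).1).ne'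
  have hφs : ∀ i j, ContDiffOn ℝ ∞ (fun y => (φ y).1 i j) W := by
    refine contDiffOn_of_gram (fun y hy => (hφ y hy).1) fun i j => ?_
    refine ContDiffOn.congr (hnd.smul (hMij i j).contDiffOn) fun y hy => ?_
    rw [(hφ y hy).2]
    rfl
  -- its inverse
  let t : (Fin N → Fin N → ℂ) → ℝ := fun a => ((Matrix.of a)ᴴ * Matrix.of a).trace.re
  -- The Gram matrix rescaled to trace N, relative to the base point 1. Changing the scale of the
  -- Gram matrix does not affect it, which is why it undoes the normalization of the determinant.
  let G : (Fin N → Fin N → ℂ) → (Fin N → Fin N → ℂ) := fun a i j =>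
    (N / t a) • ((Matrix.of a)ᴴ * Matrix.of a) i j - (1 : Matrix (Fin N) (Fin N) ℂ) i j
  have hgram : ∀ i j, ContDiff ℝ ∞ fun a : Fin N → Fin N → ℂ =>
      ((Matrix.of a)ᴴ * Matrix.of a) i j := by
    intro i j
    simp only [Matrix.mul_apply, Matrix.conjTranspose_apply, Matrix.of_apply]
    have hc : ∀ i j, ContDiff ℝ ∞ fun a : Fin N → Fin N → ℂ => a i j := fun i j =>
      contDiff_apply_apply ℝ ℂ i j
    exact ContDiff.sum fun l _ => ((Complex.conjCLE.contDiff.comp (hc l i)).mul (hc l j))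
  have ht : ContDiff ℝ ∞ t :=
    Complex.reCLM.contDiff.comp (ContDiff.sum fun i _ => hgram i i)
  let U : Set (Fin N → Fin N → ℂ) := {a | 0 < t a}
  have hUo : IsOpen U := isOpen_lt continuous_const ht.continuous
  have hG : ContDiffOn ℝ ∞ G U := by
    refine contDiffOn_pi.2 fun i => contDiffOn_pi.2 fun j => ContDiffOn.sub ?_ contDiffOn_const
    refine ContDiffOn.smul (f := fun a => N / t a) ?_ (hgram i j).contDiffOn
    exact contDiffOn_const.div ht.contDiffOn fun a ha => ne_of_gt ha
  have hGof : ∀ a, Matrix.of (G a) = (N / t a) • ((Matrix.of a)ᴴ * Matrix.of a) - 1 :=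
    fun a => rfl
  let u : SLC N → (Fin N → Fin N → ℂ) := fun A i j => A.1 i j
  have htpos : ∀ A : SLC N, 0 < t (u A) := by
    intro A
    have : Nonempty (Fin N) := ⟨⟨0, Nat.pos_of_ne_zero hN⟩⟩
    exact (Complex.pos_iff.1 (posDef_gram A).trace_pos).1
  have hMψ : ∀ A ∈ X, M (p (G (u A))) = ((N / t (u A) : ℝ) : ℂ) • (A.1ᴴ * A.1) := by
    intro A hA
    have h2 := ((hX A).1 hA).2
    have : e (p (G (u A))) = G (u A) := by
      refine hep _ ?_ ?_
      · rw [hGof]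
        exact V.sub_mem (V.smul_mem _ h2) h1
      · rw [hGof, Matrix.trace_sub, Matrix.trace_smul, Complex.sub_re, Complex.smul_re]
        change _ • t (u A) - _ = _
        rw [smul_eq_mul, div_mul_cancel₀ _ (htpos A).ne']
        simp
    change 1 + Matrix.of (e (p (G (u A)))) = _
    rw [this, hGof, add_sub_cancel]
    ext i j
    exact Complex.real_smul
  have hWψ : ∀ A ∈ X, p (G (u A)) ∈ W := by
    intro A hA
    change (M _).PosDef
    rw [hMψ A hA]
    exact (posDef_gram A).smul (a := ((N / t (u A) : ℝ) : ℂ))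
      (Complex.zero_lt_real.2 (div_pos hN' (htpos A)))
  refine ⟨d, rfl, ⟨u 1, 1, (hX 1).2 ⟨⟨fun i j hij => ?_, fun i => ⟨1, one_pos, ?_⟩⟩, ?_⟩,
    fun i j => rfl⟩, ?_⟩
  · simp [Matrix.one_apply_ne hij.ne']
  · simp
  · simpa using h1
  rintro a ⟨A, hA, haA⟩
  have hsub : ∀ a : Fin N → Fin N → ℂ, ∀ A : SLC N, (∀ i j, a i j = A.1 i j) → a = u A :=
    fun a A h => funext fun i => funext fun j => h i j
  refine ⟨U, W, fun y => u (φ y), fun a => p (G a), hUo, ?_, hWo, ?_, ?_, ?_, ?_, ?_, ?_⟩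
  · rw [hsub a A haA]
    exact htpos A
  · exact contDiffOn_pi.2 fun i => contDiffOn_pi.2 fun j => hφs i j
  · exact p.contDiff.comp_contDiffOn hG
  · intro y hy
    refine ⟨⟨φ y, (hX _).2 ⟨(hφ y hy).1, ?_⟩, fun _ _ => rfl⟩, htpos _⟩
    rw [(hφ y hy).2]
    exact V.smul_mem (normDet (M y)) (hMV y)
  · rintro a ⟨⟨A, hA, haA⟩, -⟩
    rw [hsub a A haA]
    exact hWψ A hA
  · intro y hy
    have hc := normDet_pos hy
    have hgr : (Matrix.of (u (φ y)))ᴴ * Matrix.of (u (φ y)) = normDet (M y) • M y := (hφ y hy).2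
    have htc : t (u (φ y)) = normDet (M y) * N := by
      change (((φ y).1)ᴴ * (φ y).1).trace.re = _
      rw [show (((φ y).1)ᴴ * (φ y).1) = normDet (M y) • M y from hgr, Matrix.trace_smul,
        Complex.smul_re, hMtr, smul_eq_mul]
    have : G (u (φ y)) = e y := by
      change Matrix.of (G (u (φ y))) = Matrix.of (e y)
      rw [hGof, htc, hgr, smul_smul, div_mul_eq_mul_div, mul_comm (N : ℝ),
        div_self (mul_pos hc hN').ne', one_smul]
      exact add_sub_cancel_left _ _
    change p (G _) = y
    rw [this, hpe]
  · rintro a ⟨⟨A, hA, haA⟩, -⟩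
    rw [hsub a A haA]
    have h2 := hφ _ (hWψ A hA)
    have h3 : φ (p (G (u A))) = A := by
      -- The two Gram matrices are only known to be proportional, through the two normalizations;
      -- determinant one removes the factor.
      refine eq_of_gram_eq_smul hN h2.1 ((hX A).1 hA).1 (r := normDet (M (p (G (u A)))) *
        (N / t (u A))) (mul_pos (normDet_pos (hWψ A hA)) (div_pos hN' (htpos A))) ?_
      rw [h2.2, hMψ A hA, smul_smul, Complex.ofReal_mul]
    change u (φ (p (G (u A)))) = u A
    rw [h3]

/-! ## The symmetric power representation -/

/-- The coefficient `1 / √((n-i)! i!)` of the rational normal map. -/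
def rnCoeff (n i : ℕ) : ℂ := ((Real.sqrt (1 / ((n - i).factorial * i.factorial : ℝ)) : ℝ) : ℂ)

theorem rnCoeff_ne_zero (n i : ℕ) : rnCoeff n i ≠ 0 := sqrt_coeff_ne_zero n i

theorem rnCoeff_sub {n i : ℕ} (hi : i ≤ n) : rnCoeff n (n - i) = rnCoeff n i := by
  rw [rnCoeff, rnCoeff, Nat.sub_sub_self hi, mul_comm]

theorem conj_rnCoeff (n i : ℕ) : conj (rnCoeff n i) = rnCoeff n i := Complex.conj_ofReal _

theorem rnCoeff_mul_self {n i : ℕ} (hi : i ≤ n) :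
    rnCoeff n i * rnCoeff n i = (n.choose i : ℂ) / n.factorial := by
  rw [rnCoeff, ← Complex.ofReal_mul, Real.mul_self_sqrt (by positivity),
    Nat.cast_choose ℂ hi]
  have : (n.factorial : ℂ) ≠ 0 := by exact_mod_cast n.factorial_ne_zero
  push_cast
  field_simp

theorem rationalNormalVec_apply (n : ℕ) (z : Fin 2 → ℂ) (i : Fin (n + 1)) :
    rationalNormalVec n z i = rnCoeff n i * z 0 ^ (n - (i : ℕ)) * z 1 ^ (i : ℕ) := rfl

theorem continuous_rationalNormalVec (n : ℕ) : Continuous (rationalNormalVec n) :=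
  continuous_pi fun i => by
    simp only [rationalNormalVec_apply]
    fun_prop

/-- The squares of the weights are the binomial coefficients over n!, so this is the binomial
theorem. It is the reason for the weights: they make the symmetric power of a unitary matrix
unitary. -/
theorem rationalNormalVec_gram (n : ℕ) (z u : Fin 2 → ℂ) :
    star (rationalNormalVec n u) ⬝ᵥ rationalNormalVec n z =
      (star u ⬝ᵥ z) ^ n / n.factorial := by
  have h2 : star u ⬝ᵥ z = conj (u 1) * z 1 + conj (u 0) * z 0 := by
    simp [dotProduct, Fin.sum_univ_two, add_comm]
  rw [h2, add_pow, Finset.sum_div, ← Fin.sum_univ_eq_sum_range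
    (fun i => (conj (u 1) * z 1) ^ i * (conj (u 0) * z 0) ^ (n - i) * (n.choose i : ℂ) /
      n.factorial), dotProduct]
  refine Finset.sum_congr rfl fun i _ => ?_
  have hi : (i : ℕ) ≤ n := Nat.lt_succ_iff.1 i.2
  rw [Pi.star_apply, rationalNormalVec_apply, rationalNormalVec_apply, mul_div_assoc,
    ← rnCoeff_mul_self hi, Complex.star_def, map_mul, map_mul, map_pow, map_pow, conj_rnCoeff]
  ring

/-- Distinct points of the rational normal curve are in general position. -/
theorem det_rationalNormalVec_ne_zero {n : ℕ} (z : Fin (n + 1) → Fin 2 → ℂ)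
    (hz : ∀ i j, i ≠ j → z i 0 * z j 1 - z i 1 * z j 0 ≠ 0) :
    (Matrix.of fun i k => rationalNormalVec n (z k) i).det ≠ 0 := by
  have : (Matrix.of fun i k => rationalNormalVec n (z k) i) =
      (Matrix.projVandermonde (fun k => z k 1) (fun k => z k 0) *
        Matrix.diagonal fun i : Fin (n + 1) => rnCoeff n i)ᵀ := by
    ext i k
    rw [Matrix.transpose_apply, Matrix.mul_diagonal, Matrix.projVandermonde_apply,
      Matrix.of_apply, rationalNormalVec_apply, Fin.val_rev, Nat.add_sub_add_right]
    ring
  rw [this, Matrix.det_transpose, Matrix.det_mul, Matrix.det_projVandermonde, Matrix.det_diagonal]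
  refine mul_ne_zero (Finset.prod_ne_zero_iff.2 fun i _ => Finset.prod_ne_zero_iff.2 fun j hj => ?_)
    (Finset.prod_ne_zero_iff.2 fun i _ => rnCoeff_ne_zero n i)
  have := hz i j (Finset.mem_Ioi.1 hj).ne
  contrapose! this
  linear_combination this

/-- The points [1, 0], …, [1, n] provide a fixed basis of points of the curve, against which
matrices are compared. -/
theorem det_rationalNormalVec_affine_ne_zero (n : ℕ) :
    (Matrix.of fun (i k : Fin (n + 1)) => rationalNormalVec n ![1, (k : ℂ)] i).det ≠ 0 := by
  refine det_rationalNormalVec_ne_zero _ fun i j hij => ?_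
  simp only [Matrix.cons_val_zero, Matrix.cons_val_one, one_mul, mul_one]
  rw [sub_ne_zero]
  intro h
  exact hij (Fin.ext (by exact_mod_cast h.symm))

theorem mul_of_rationalNormalVec {n : ℕ} {ι : Type*} (A : Matrix (Fin (n + 1)) (Fin (n + 1)) ℂ)
    (z : ι → Fin 2 → ℂ) :
    A * (Matrix.of fun i k => rationalNormalVec n (z k) i) =
      Matrix.of fun i k => (A *ᵥ rationalNormalVec n (z k)) i := by
  ext i k
  simp [Matrix.mul_apply, Matrix.mulVec, dotProduct]

theorem matrix_ext_rationalNormalVec {n : ℕ} {A B : Matrix (Fin (n + 1)) (Fin (n + 1)) ℂ}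
    (h : ∀ z, A *ᵥ rationalNormalVec n z = B *ᵥ rationalNormalVec n z) : A = B := by
  have hd := (Matrix.isUnit_iff_isUnit_det _).2
    (isUnit_iff_ne_zero.2 (det_rationalNormalVec_affine_ne_zero n))
  refine hd.mul_left_injective ?_
  change A * _ = B * _
  rw [mul_of_rationalNormalVec, mul_of_rationalNormalVec]
  simp only [h]

open Polynomial in
/-- The polynomial whose coefficients give the `i`-th row of the symmetric power of `g`. -/
def symPowPoly (n : ℕ) (g : Matrix (Fin 2) (Fin 2) ℂ) (i : ℕ) : ℂ[X] :=
  (C (g 0 0) + C (g 0 1) * X) ^ (n - i) * (C (g 1 0) + C (g 1 1) * X) ^ i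

open Polynomial in
theorem natDegree_linear_le (a b : ℂ) : (C a + C b * X : ℂ[X]).natDegree ≤ 1 := by
  rw [add_comm]
  exact Polynomial.natDegree_linear_le

open Polynomial in
theorem natDegree_symPowPoly_le {n i : ℕ} (hi : i ≤ n) (g : Matrix (Fin 2) (Fin 2) ℂ) :
    (symPowPoly n g i).natDegree ≤ n := by
  refine natDegree_mul_le.trans ?_
  have h1 := natDegree_pow_le_of_le (n - i) (natDegree_linear_le (g 0 0) (g 0 1))
  have h2 := natDegree_pow_le_of_le i (natDegree_linear_le (g 1 0) (g 1 1))
  omega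

open Polynomial in
theorem sum_coeff_symPowPoly {n i : ℕ} (hi : i ≤ n) (g : Matrix (Fin 2) (Fin 2) ℂ)
    (z : Fin 2 → ℂ) :
    ∑ j ∈ Finset.range (n + 1), (symPowPoly n g i).coeff j * z 0 ^ (n - j) * z 1 ^ j =
      (g *ᵥ z) 0 ^ (n - i) * (g *ᵥ z) 1 ^ i := by
  have hv : ∀ k, (g *ᵥ z) k = g k 0 * z 0 + g k 1 * z 1 := fun k => by
    simp [Matrix.mulVec, dotProduct, Fin.sum_univ_two]
  rw [hv, hv]
  -- Away from z 0 = 0 both sides are dehomogenized to the value of the polynomial at z 1 / z 0. On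
  -- z 0 = 0 only the coefficient of degree n survives.
  by_cases h0 : z 0 = 0
  · rw [Finset.sum_eq_single n]
    · have h1 := natDegree_pow_le_of_le (n - i) (natDegree_linear_le (g 0 0) (g 0 1))
      have h2 := natDegree_pow_le_of_le i (natDegree_linear_le (g 1 0) (g 1 1))
      rw [mul_one] at h1 h2
      have hc : (symPowPoly n g i).coeff n = g 0 1 ^ (n - i) * g 1 1 ^ i := by
        have h3 := coeff_mul_add_eq_of_natDegree_le h1 h2
        rw [Nat.sub_add_cancel hi] at h3
        have h4 := coeff_pow_of_natDegree_le (m := n - i) (natDegree_linear_le (g 0 0) (g 0 1))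
        have h5 := coeff_pow_of_natDegree_le (m := i) (natDegree_linear_le (g 1 0) (g 1 1))
        rw [mul_one] at h4 h5
        rw [symPowPoly, h3, h4, h5]
        simp [coeff_C]
      rw [hc, h0, Nat.sub_self, pow_zero, mul_zero, zero_add, mul_zero, zero_add, mul_pow, mul_pow]
      have : z 1 ^ n = z 1 ^ (n - i) * z 1 ^ i := by rw [← pow_add, Nat.sub_add_cancel hi]
      rw [this]
      ring
    · intro j hj hjn
      have : n - j ≠ 0 := by
        have := Finset.mem_range.1 hj
        omega
      rw [h0, zero_pow this, mul_zero, zero_mul]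
    · intro h
      simp at h
  · have he : (symPowPoly n g i).eval (z 1 / z 0) =
        ∑ j ∈ Finset.range (n + 1), (symPowPoly n g i).coeff j * (z 1 / z 0) ^ j :=
      eval_eq_sum_range' (Nat.lt_succ_of_le (natDegree_symPowPoly_le hi g)) _
    have hs : ∑ j ∈ Finset.range (n + 1), (symPowPoly n g i).coeff j * z 0 ^ (n - j) * z 1 ^ j =
        z 0 ^ n * (symPowPoly n g i).eval (z 1 / z 0) := by
      rw [he, Finset.mul_sum]
      refine Finset.sum_congr rfl fun j hj => ?_
      have hj' : j ≤ n := Nat.lt_succ_iff.1 (Finset.mem_range.1 hj)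
      have : z 0 ^ n = z 0 ^ (n - j) * z 0 ^ j := by rw [← pow_add, Nat.sub_add_cancel hj']
      rw [this, div_pow]
      field_simp
    have h2 : z 0 ^ n = z 0 ^ (n - i) * z 0 ^ i := by rw [← pow_add, Nat.sub_add_cancel hi]
    rw [hs, h2, symPowPoly]
    simp only [eval_mul, eval_pow, eval_add, eval_C, eval_X]
    have h3 : ∀ k, g k 0 * z 0 + g k 1 * z 1 = z 0 * (g k 0 + g k 1 * (z 1 / z 0)) := fun k => by
      field_simp
    rw [h3, h3, mul_pow, mul_pow]
    ring

/-- The matrix through which `g` acts on the rational normal curve: the `n`-th symmetric power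
of `g` in the basis of normalized monomials. -/
def symPow (n : ℕ) (g : Matrix (Fin 2) (Fin 2) ℂ) : Matrix (Fin (n + 1)) (Fin (n + 1)) ℂ :=
  Matrix.of fun i j => rnCoeff n i / rnCoeff n j * (symPowPoly n g i).coeff j

/-- This equivariance characterizes `symPow`, because the rational normal vectors span; the
algebraic rules below are all derived from it. -/
theorem symPow_mulVec (n : ℕ) (g : Matrix (Fin 2) (Fin 2) ℂ) (z : Fin 2 → ℂ) :
    symPow n g *ᵥ rationalNormalVec n z = rationalNormalVec n (g *ᵥ z) := by
  ext i
  rw [rationalNormalVec_apply, mul_assoc, ← sum_coeff_symPowPoly (Nat.lt_succ_iff.1 i.2),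
    ← Fin.sum_univ_eq_sum_range
      (fun j => (symPowPoly n g i).coeff j * z 0 ^ (n - j) * z 1 ^ j), Finset.mul_sum]
  change ∑ j, symPow n g i j * rationalNormalVec n z j = _
  refine Finset.sum_congr rfl fun j _ => ?_
  have := rnCoeff_ne_zero n j
  rw [symPow, Matrix.of_apply, rationalNormalVec_apply]
  field_simp

theorem symPow_eq_of_mulVec {n : ℕ} {g : Matrix (Fin 2) (Fin 2) ℂ}
    {A : Matrix (Fin (n + 1)) (Fin (n + 1)) ℂ}
    (h : ∀ z, A *ᵥ rationalNormalVec n z = rationalNormalVec n (g *ᵥ z)) : symPow n g = A :=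
  matrix_ext_rationalNormalVec fun z => by rw [symPow_mulVec, h]

theorem symPow_one (n : ℕ) : symPow n 1 = 1 :=
  symPow_eq_of_mulVec fun z => by rw [Matrix.one_mulVec, Matrix.one_mulVec]

theorem symPow_mul (n : ℕ) (g h : Matrix (Fin 2) (Fin 2) ℂ) :
    symPow n (g * h) = symPow n g * symPow n h :=
  symPow_eq_of_mulVec fun z => by
    rw [← Matrix.mulVec_mulVec, symPow_mulVec, symPow_mulVec, Matrix.mulVec_mulVec]

theorem symPow_smul (n : ℕ) (c : ℂ) (g : Matrix (Fin 2) (Fin 2) ℂ) :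
    symPow n (c • g) = c ^ n • symPow n g :=
  symPow_eq_of_mulVec fun z => by
    rw [Matrix.smul_mulVec, Matrix.smul_mulVec, symPow_mulVec, rationalNormalVec_smul]

/-- The inner products of rational normal vectors are powers of inner products in ℂ², which g
preserves. Checking them on a basis of points of the curve suffices. -/
theorem symPow_conjTranspose_mul_self (n : ℕ) {g : Matrix (Fin 2) (Fin 2) ℂ} (hg : gᴴ * g = 1) :
    (symPow n g)ᴴ * symPow n g = 1 := by
  have hd := (Matrix.isUnit_iff_isUnit_det _).2
    (isUnit_iff_ne_zero.2 (det_rationalNormalVec_affine_ne_zero n))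
  refine hd.mul_left_injective (hd.star.mul_right_injective ?_)
  change _ᴴ * (_ * _) = _ᴴ * (1 * _)
  rw [one_mul, Matrix.mul_assoc, ← Matrix.mul_assoc, ← Matrix.conjTranspose_mul,
    mul_of_rationalNormalVec]
  ext k l
  change star (symPow n g *ᵥ rationalNormalVec n _) ⬝ᵥ (symPow n g *ᵥ rationalNormalVec n _) =
    star (rationalNormalVec n _) ⬝ᵥ (rationalNormalVec n _)
  rw [symPow_mulVec, symPow_mulVec, rationalNormalVec_gram, rationalNormalVec_gram,
    Matrix.star_mulVec, ← Matrix.dotProduct_mulVec, Matrix.mulVec_mulVec, hg, Matrix.one_mulVec]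

/-- The matrix is recovered from the images of n+1 fixed independent points of the curve, and these
images depend continuously on g. -/
theorem continuous_symPow (n : ℕ) : Continuous (symPow n) := by
  have hd := isUnit_iff_ne_zero.2 (det_rationalNormalVec_affine_ne_zero n)
  have : symPow n = fun g =>
      (Matrix.of fun (i k : Fin (n + 1)) => rationalNormalVec n (g *ᵥ ![1, (k : ℂ)]) i) *
        (Matrix.of fun (i k : Fin (n + 1)) => rationalNormalVec n ![1, (k : ℂ)] i)⁻¹ := by
    ext1 g
    have h := mul_of_rationalNormalVec (symPow n g) fun k : Fin (n + 1) => ![1, (k : ℂ)]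
    simp only [symPow_mulVec] at h
    rw [← h, Matrix.mul_assoc, Matrix.mul_nonsing_inv _ hd, Matrix.mul_one]
  rw [this]
  refine Continuous.matrix_mul (continuous_matrix fun i k => ?_) continuous_const
  refine (continuous_apply i).comp ((continuous_rationalNormalVec n).comp ?_)
  exact continuous_id.matrix_mulVec continuous_const

theorem symPow_diag (n : ℕ) (a d : ℂ) :
    symPow n !![a, 0; 0, d] =
      Matrix.diagonal fun i : Fin (n + 1) => a ^ (n - (i : ℕ)) * d ^ (i : ℕ) := by
  refine symPow_eq_of_mulVec fun z => ?_
  ext i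
  rw [Matrix.mulVec_diagonal, rationalNormalVec_apply, rationalNormalVec_apply]
  simp [Matrix.mulVec, dotProduct, Fin.sum_univ_two, mul_pow]
  ring

theorem symPow_antidiag (n : ℕ) (b c : ℂ) :
    symPow n !![0, b; c, 0] =
      Matrix.of fun i j : Fin (n + 1) =>
        if j = i.rev then b ^ (n - (i : ℕ)) * c ^ (i : ℕ) else 0 := by
  refine symPow_eq_of_mulVec fun z => ?_
  ext i
  have hi : (i : ℕ) ≤ n := Nat.lt_succ_iff.1 i.2
  simp only [Matrix.mulVec, dotProduct, Matrix.of_apply, ite_mul, zero_mul, Finset.sum_ite_eq',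
    Finset.mem_univ, if_true]
  rw [rationalNormalVec_apply, rationalNormalVec_apply, Fin.val_rev, Nat.add_sub_add_right,
    rnCoeff_sub hi, Nat.sub_sub_self hi]
  have h0 : (!![0, b; c, 0] *ᵥ z) 0 = b * z 1 := by
    simp [Matrix.mulVec, dotProduct, Fin.sum_univ_two]
  have h1 : (!![0, b; c, 0] *ᵥ z) 1 = c * z 0 := by
    simp [Matrix.mulVec, dotProduct, Fin.sum_univ_two]
  change _ = rnCoeff n i * (!![0, b; c, 0] *ᵥ z) 0 ^ (n - (i : ℕ)) *
    (!![0, b; c, 0] *ᵥ z) 1 ^ (i : ℕ)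
  rw [h0, h1, mul_pow, mul_pow]
  ring

open Polynomial in
theorem symPow_zero_apply (n : ℕ) (g : Matrix (Fin 2) (Fin 2) ℂ) (j : Fin (n + 1)) :
    symPow n g 0 j = rnCoeff n 0 / rnCoeff n j *
      (g 0 0 ^ (n - (j : ℕ)) * g 0 1 ^ (j : ℕ) * n.choose j) := by
  rw [symPow, Matrix.of_apply, symPowPoly]
  congr 1
  simp only [Fin.val_zero, Nat.sub_zero, pow_zero, mul_one]
  rw [add_comm, add_pow, finsetSum_coeff, Finset.sum_eq_single (j : ℕ)]
  · rw [mul_pow, ← C_pow, ← C_pow, mul_comm, ← C_eq_natCast, mul_comm _ (C (g 0 0 ^ _)),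
      ← mul_assoc, ← mul_assoc, coeff_mul_X_pow', if_pos le_rfl, Nat.sub_self, ← C_mul, ← C_mul,
      coeff_C_zero]
    ring
  · intro k _ hk
    rw [mul_pow, ← C_pow, ← C_pow, mul_comm, ← C_eq_natCast, mul_comm _ (C (g 0 0 ^ _)),
      ← mul_assoc, ← mul_assoc, ← C_mul, ← C_mul, coeff_C_mul_X_pow, if_neg hk.symm]
  · intro h
    exact absurd (Finset.mem_range.2 j.2) h

open Polynomial in
theorem trace_symPow_of_upper (n : ℕ) {u : Matrix (Fin 2) (Fin 2) ℂ} (hu : u 1 0 = 0) :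
    (symPow n u).trace = ∑ i : Fin (n + 1), u 0 0 ^ (n - (i : ℕ)) * u 1 1 ^ (i : ℕ) := by
  refine Finset.sum_congr rfl fun i _ => ?_
  rw [Matrix.diag_apply, symPow, Matrix.of_apply, div_self (rnCoeff_ne_zero n i), one_mul,
    symPowPoly, hu, C_0, zero_add, mul_pow, ← mul_assoc, coeff_mul_X_pow', if_pos le_rfl,
    Nat.sub_self, ← C_pow, coeff_mul_C, coeff_zero_eq_eval_zero]
  simp

/-- An eigenvector for a, completed to a basis, conjugates g to an upper triangular matrix with
diagonal (a, d). Diagonalizability is not needed, so a repeated eigenvalue is allowed. -/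
theorem trace_symPow (n : ℕ) (g : Matrix (Fin 2) (Fin 2) ℂ) (a d : ℂ) (htr : g.trace = a + d)
    (hdet : g.det = a * d) :
    (symPow n g).trace = ∑ i : Fin (n + 1), a ^ (n - (i : ℕ)) * d ^ (i : ℕ) := by
  have h0 : (g - a • (1 : Matrix (Fin 2) (Fin 2) ℂ)).det = 0 := by
    rw [Matrix.trace_fin_two] at htr
    rw [Matrix.det_fin_two] at hdet
    simp [Matrix.det_fin_two]
    linear_combination hdet - a * htr
  obtain ⟨w, hw, hgw⟩ := Matrix.exists_mulVec_eq_zero_iff.2 h0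
  rw [Matrix.sub_mulVec, Matrix.smul_mulVec, Matrix.one_mulVec, sub_eq_zero] at hgw
  obtain ⟨x, hx⟩ : ∃ x : Fin 2 → ℂ, w 0 * x 1 - x 0 * w 1 ≠ 0 := by
    by_cases h : w 0 = 0
    · refine ⟨![1, 0], ?_⟩
      have : w 1 ≠ 0 := fun h1 => hw (by ext i; fin_cases i <;> simp [h, h1])
      simpa using this
    · exact ⟨![0, 1], by simpa using h⟩
  set h : Matrix (Fin 2) (Fin 2) ℂ := !![w 0, x 0; w 1, x 1] with hh
  have hu : IsUnit h.det := by
    rw [isUnit_iff_ne_zero, hh, Matrix.det_fin_two_of]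
    exact hx
  set u := h⁻¹ * g * h with hudef
  have hcol : u *ᵥ ![1, 0] = ![a, 0] := by
    have h1 : h *ᵥ ![1, 0] = w := by
      ext i
      fin_cases i <;> simp [hh]
    have h2 : h *ᵥ ![a, 0] = a • w := by
      rw [← h1, ← Matrix.mulVec_smul]
      simp
    rw [hudef, ← Matrix.mulVec_mulVec, h1, ← Matrix.mulVec_mulVec, hgw, ← h2,
      Matrix.mulVec_mulVec, Matrix.nonsing_inv_mul _ hu, Matrix.one_mulVec]
  have hu00 : u 0 0 = a := by simpa [Matrix.mulVec, dotProduct] using congrFun hcol 0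
  have hu10 : u 1 0 = 0 := by simpa [Matrix.mulVec, dotProduct] using congrFun hcol 1
  have hutr : u.trace = g.trace := by
    rw [hudef, Matrix.trace_mul_comm, ← Matrix.mul_assoc, Matrix.mul_nonsing_inv _ hu,
      Matrix.one_mul]
  have hu11 : u 1 1 = d := by
    rw [Matrix.trace_fin_two, hu00, htr] at hutr
    exact add_left_cancel hutr
  have hstr : (symPow n u).trace = (symPow n g).trace := by
    rw [hudef, symPow_mul, Matrix.trace_mul_comm, symPow_mul, ← Matrix.mul_assoc, ← symPow_mul,
      Matrix.mul_nonsing_inv _ hu, symPow_one, Matrix.one_mul]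
  rw [← hstr, trace_symPow_of_upper n hu10, hu00, hu11]

/-! ## Projective actions -/

theorem pslPerm_mk {N : ℕ} (A : SLC N) {x : Fin N → ℂ} (hx : x ≠ 0) (hAx : A.1 *ᵥ x ≠ 0) :
    pslPerm N (toPSL N A) (Projectivization.mk ℂ x hx) = Projectivization.mk ℂ (A.1 *ᵥ x) hAx :=
  rfl

theorem SLC_mulVec_ne_zero {N : ℕ} (A : SLC N) {x : Fin N → ℂ} (hx : x ≠ 0) : A.1 *ᵥ x ≠ 0 := by
  intro h
  refine hx ?_
  have hA : IsUnit A.1.det := by rw [A.2]; exact isUnit_one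
  have := congrArg (fun y => A.1⁻¹ *ᵥ y) h
  simpa [Matrix.mulVec_mulVec, Matrix.nonsing_inv_mul _ hA] using this

theorem rationalNormalMap_eq (n : ℕ) (p : CP 2) :
    rationalNormalMap n p = Projectivization.mk ℂ (rationalNormalVec n p.rep)
      (rationalNormalVec_ne_zero n p.rep_nonzero) := by
  conv_lhs => rw [← p.mk_rep]
  rfl

theorem rationalNormalMap_mk (n : ℕ) {z : Fin 2 → ℂ} (hz : z ≠ 0) :
    rationalNormalMap n (Projectivization.mk ℂ z hz) = Projectivization.mk ℂ (rationalNormalVec n z)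
      (rationalNormalVec_ne_zero n hz) :=
  rfl

/-- The center of SL(N) consists of the scalar matrices given by N-th roots of unity. -/
theorem toPSL_eq_iff {N : ℕ} {A B : SLC N} :
    toPSL N A = toPSL N B ↔ ∃ c : ℂ, c ^ N = 1 ∧ B.1 = c • A.1 := by
  have h : toPSL N A = toPSL N B ↔ A⁻¹ * B ∈ Subgroup.center (SLC N) := QuotientGroup.eq
  rw [h, Matrix.SpecialLinearGroup.mem_center_iff, Fintype.card_fin]
  refine exists_congr fun c => and_congr_right fun _ => ?_
  have hB : B.1 = A.1 * (A⁻¹ * B : SLC N).1 := by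
    change B.1 = (A * (A⁻¹ * B) : SLC N).1
    rw [mul_inv_cancel_left]
  constructor
  · intro h
    rw [hB, ← h]
    ext i j
    simp [mul_comm]
  · intro h
    have : (A⁻¹ * B : SLC N).1 = (A⁻¹ : SLC N).1 * B.1 := rfl
    rw [this, h, Matrix.mul_smul]
    change _ = c • (A⁻¹ * A : SLC N).1
    rw [inv_mul_cancel]
    ext i j
    simp [Matrix.diagonal_apply, Matrix.one_apply]

theorem norm_eq_one_of_pow {c : ℂ} {N : ℕ} (hN : N ≠ 0) (h : c ^ N = 1) : conj c * c = 1 := by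
  rw [Complex.conj_mul', Complex.norm_eq_one_of_pow_eq_one h hN]
  simp

theorem SU_conjTranspose_mul_self {N : ℕ} (U : SU N) : U.1ᴴ * U.1 = 1 :=
  Matrix.mem_unitaryGroup_iff'.1 (Matrix.mem_specialUnitaryGroup_iff.1 U.2).1

theorem symPow_SU_conjTranspose_mul_self (n : ℕ) (γ : SU 2) :
    (symPow n γ.1)ᴴ * symPow n γ.1 = 1 :=
  symPow_conjTranspose_mul_self n (SU_conjTranspose_mul_self γ)

theorem SU_ext_iff_toPSL {N : ℕ} {γ γ' : SU N} :
    suToPSU N γ = suToPSU N γ' ↔ toPSL N (suToSL N γ) = toPSL N (suToSL N γ') :=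
  Subtype.ext_iff

theorem conj_unitary_iff_commute {N : ℕ} {ρ H : Matrix (Fin N) (Fin N) ℂ} (hρ : ρᴴ * ρ = 1) :
    ρᴴ * H * ρ = H ↔ Commute H ρ := by
  have hρ' : ρ * ρᴴ = 1 := mul_eq_one_comm.1 hρ
  constructor
  · intro h
    change H * ρ = ρ * H
    nth_rw 2 [← h]
    rw [← Matrix.mul_assoc, ← Matrix.mul_assoc, hρ', Matrix.one_mul]
  · intro h
    rw [Matrix.mul_assoc, show H * ρ = ρ * H from h, ← Matrix.mul_assoc, hρ, Matrix.one_mul]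

/-! ## Infinitely many points of the projective line -/

theorem rep_cross_ne_zero {p q : CP 2} (hpq : p ≠ q) :
    p.rep 0 * q.rep 1 - p.rep 1 * q.rep 0 ≠ 0 := by
  intro h
  refine hpq ?_
  rw [← p.mk_rep, ← q.mk_rep, Projectivization.mk_eq_mk_iff']
  have hq := q.rep_nonzero
  by_cases h0 : q.rep 0 = 0
  · have h1 : q.rep 1 ≠ 0 := fun h1 => hq (by ext i; fin_cases i <;> simp [h0, h1])
    refine ⟨p.rep 1 / q.rep 1, ?_⟩
    ext i
    fin_cases i
    · simp only [Pi.smul_apply, smul_eq_mul, Fin.zero_eta]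
      field_simp
      linear_combination -h
    · simp [div_mul_cancel₀ _ h1]
  · refine ⟨p.rep 0 / q.rep 0, ?_⟩
    ext i
    fin_cases i
    · simp [div_mul_cancel₀ _ h0]
    · simp only [Pi.smul_apply, smul_eq_mul, Fin.mk_one]
      field_simp
      linear_combination h

theorem isUnit_of_injective_points {n : ℕ} {p : Fin (n + 1) → CP 2} (hp : Function.Injective p) :
    IsUnit (Matrix.of fun (i k : Fin (n + 1)) => rationalNormalVec n (p k).rep i) :=
  (Matrix.isUnit_iff_isUnit_det _).2 (isUnit_iff_ne_zero.2
    (det_rationalNormalVec_ne_zero _ fun _ _ hij => rep_cross_ne_zero (hp.ne hij)))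

theorem matrix_ext_of_infinite {n : ℕ} {T : Set (CP 2)} (hT : T.Infinite)
    {A B : Matrix (Fin (n + 1)) (Fin (n + 1)) ℂ}
    (h : ∀ p ∈ T, A *ᵥ rationalNormalVec n p.rep = B *ᵥ rationalNormalVec n p.rep) : A = B := by
  have : Infinite T := hT.to_subtype
  let f : Fin (n + 1) → T := fun k => Infinite.natEmbedding T k
  have hf : Function.Injective f := (Infinite.natEmbedding T).injective.comp Fin.val_injective
  refine (isUnit_of_injective_points (Subtype.val_injective.comp hf)).mul_left_injective ?_
  change A * _ = B * _
  rw [mul_of_rationalNormalVec, mul_of_rationalNormalVec]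
  ext i k
  exact congrFun (h _ (f k).2) i

/-- A matrix fixing infinitely many points of the rational normal curve is scalar. -/
theorem exists_scalar_of_infinite {n : ℕ} {T : Set (CP 2)} (hT : T.Infinite)
    {B : Matrix (Fin (n + 1)) (Fin (n + 1)) ℂ}
    (h : ∀ p ∈ T, ∃ c : ℂ, B *ᵥ rationalNormalVec n p.rep = c • rationalNormalVec n p.rep) :
    ∃ c : ℂ, B = c • 1 := by
  have : Infinite T := hT.to_subtype
  have hfin : Finite {μ | Module.End.HasEigenvalue (Matrix.toLin' B) μ} :=
    Module.End.finite_hasEigenvalue (Matrix.toLin' B)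
  choose c hc using fun p : T => h p.1 p.2
  have hev : ∀ p : T, Module.End.HasEigenvalue (Matrix.toLin' B) (c p) := fun p =>
    Module.End.hasEigenvalue_of_hasEigenvector (x := rationalNormalVec n p.1.rep)
      ⟨Module.End.mem_eigenspace_iff.2 (by rw [Matrix.toLin'_apply, hc]),
        rationalNormalVec_ne_zero n p.1.rep_nonzero⟩
  -- There are finitely many eigenvalues and infinitely many points, so one eigenvalue serves
  -- infinitely many points; any n+1 of these already span.
  obtain ⟨μ, hμ⟩ := Finite.exists_infinite_fiber
    (fun p : T => (⟨c p, hev p⟩ : {μ | Module.End.HasEigenvalue (Matrix.toLin' B) μ}))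
  refine ⟨μ.1, matrix_ext_of_infinite (T := Subtype.val '' ((fun p : T =>
    (⟨c p, hev p⟩ : {μ | Module.End.HasEigenvalue (Matrix.toLin' B) μ})) ⁻¹' {μ})) ?_ ?_⟩
  · exact (Set.infinite_coe_iff.1 hμ).image Subtype.val_injective.injOn
  · rintro _ ⟨p, hp, rfl⟩
    have : c p = μ.1 := congrArg Subtype.val (Set.mem_singleton_iff.1 hp)
    rw [hc, this, Matrix.smul_mulVec, Matrix.one_mulVec]

/-! ## Unitary curves obtained from the rational normal map -/

section Curves

variable {S E : Type*} [TopologicalSpace S] [ChartedSpace ℂ S] [TopologicalSpace E]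

/-- An unramified curve in the projective line is not constant, hence takes infinitely many
values. -/
theorem IsTotallyUnramified.infinite_range [Nonempty E] {pr : E → S} (hpr : IsCoveringMap pr)
    {v : E → CP 2} (hv : IsTotallyUnramified pr v) : (Set.range v).Infinite := by
  intro hfin
  obtain ⟨e⟩ := ‹Nonempty E›
  obtain ⟨F, ⟨-, hF⟩, hli⟩ := hv e
  set ψ := (chartAt ℂ (pr e)).symm
  set x₀ := chartAt ℂ (pr e) (pr e)
  set G := F ∘ ψ
  -- the branch, in a local coordinate
  have hG : ∀ᶠ ζ in 𝓝 x₀, ∃ x, ∃ h : G ζ ≠ 0, v x = Projectivization.mk ℂ (G ζ) h := by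
    have h1 : ∀ᶠ y in 𝓝 (pr e), ∃ x, ∃ h : F y ≠ 0, v x = Projectivization.mk ℂ (F y) h := by
      rw [← hpr.isLocalHomeomorph.map_nhds_eq e, Filter.eventually_map]
      filter_upwards [hF] with x hx
      exact ⟨x, hx⟩
    have h2 : Tendsto ψ (𝓝 x₀) (𝓝 (pr e)) := by
      have := (chartAt ℂ (pr e)).continuousAt_symm
        ((chartAt ℂ (pr e)).map_source (mem_chart_source ℂ (pr e)))
      rw [ContinuousAt, (chartAt ℂ (pr e)).left_inv (mem_chart_source ℂ (pr e))] at this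
      exact this
    exact h2.eventually h1
  have hd1 : deriv G x₀ ≠ 0 := by
    have := hli.ne_zero 1
    simpa [iteratedDeriv_one] using this
  -- `deriv` takes the default value zero where G is not differentiable, so its nonvanishing yields
  -- differentiability.
  have hdiff : DifferentiableAt ℂ G x₀ := by
    by_contra h
    exact hd1 (deriv_zero_of_not_differentiableAt h)
  have hcross : ∀ w : Fin 2 → ℂ,
      HasDerivAt (fun ζ => w 0 * G ζ 1 - w 1 * G ζ 0)
        (w 0 * deriv G x₀ 1 - w 1 * deriv G x₀ 0) x₀ := by
    intro w
    have h := hasDerivAt_pi.1 hdiff.hasDerivAt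
    exact ((h 1).const_mul _).sub ((h 0).const_mul _)
  -- This is the Wronskian of the lift at x₀, nonzero since G and its derivative are independent
  -- there.
  have hne : G x₀ 0 * deriv G x₀ 1 - G x₀ 1 * deriv G x₀ 0 ≠ 0 := by
    intro h
    have h3 : ∀ a b : ℂ, a • G x₀ + b • deriv G x₀ = 0 → a = 0 ∧ b = 0 := by
      have := LinearIndependent.pair_iff.1 (show LinearIndependent ℂ ![G x₀, deriv G x₀] by
        convert! hli using 1
        ext k
        fin_cases k <;> simp [iteratedDeriv_one])
      exact this
    have h0 : deriv G x₀ 0 = 0 := (h3 (deriv G x₀ 0) (-(G x₀ 0)) (by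
      ext l
      fin_cases l
      · simp
        ring
      · simp
        linear_combination -h)).1
    have h1 : deriv G x₀ 1 = 0 := (h3 (deriv G x₀ 1) (-(G x₀ 1)) (by
      ext l
      fin_cases l
      · simp
        linear_combination h
      · simp
        ring)).1
    exact hd1 (by ext k; fin_cases k <;> simp [h0, h1])
  -- The function vanishes at x₀ with nonzero derivative, so nearby G ζ represents a point different
  -- from that of G x₀.
  have hnear : ∀ᶠ ζ in 𝓝[≠] x₀, G x₀ 0 * G ζ 1 - G x₀ 1 * G ζ 0 ≠ 0 :=
    (hcross (G x₀)).eventually_ne (c := 0) hne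
  obtain ⟨x₁, hx₁, hv₁⟩ := hG.self_of_nhds
  -- If the range were finite, each of its other points would also be avoided near x₀ by continuity;
  -- then G ζ would represent no value of v at all.
  have hfar : ∀ᶠ ζ in 𝓝 x₀, ∀ p ∈ Set.range v \ {v x₁}, p.rep 0 * G ζ 1 - p.rep 1 * G ζ 0 ≠ 0 := by
    refine (Filter.eventually_all_finite (hfin.subset Set.sdiff_subset)).2 fun p hp => ?_
    refine (hcross p.rep).continuousAt.eventually_ne ?_
    have h := rep_cross_ne_zero (p := p) (q := v x₁) fun h => hp.2 h
    obtain ⟨a, ha⟩ := Projectivization.exists_smul_eq_mk_rep ℂ (G x₀) hx₁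
    rw [hv₁, ← ha] at h
    contrapose! h
    simp only [Pi.smul_apply, Units.smul_def, smul_eq_mul]
    linear_combination (a : ℂ) * h
  obtain ⟨ζ, ⟨h1, h2⟩, x, hx, hvx⟩ :=
    ((hnear.and (hfar.filter_mono nhdsWithin_le_nhds)).and
      (hG.filter_mono nhdsWithin_le_nhds)).exists
  by_cases hxx : v x = v x₁
  · rw [hvx, hv₁, Projectivization.mk_eq_mk_iff'] at hxx
    obtain ⟨a, ha⟩ := hxx
    refine h1 ?_
    rw [← ha]
    simp only [Pi.smul_apply, smul_eq_mul]
    ring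
  · refine h2 (v x) ⟨⟨x, rfl⟩, hxx⟩ ?_
    obtain ⟨a, ha⟩ := Projectivization.exists_smul_eq_mk_rep ℂ (G ζ) hx
    rw [hvx, ← ha]
    simp only [Pi.smul_apply, Units.smul_def, smul_eq_mul]
    ring

theorem pslPerm_rationalNormalMap {n : ℕ} (A : SLC (n + 1)) (p : CP 2) :
    pslPerm (n + 1) (toPSL (n + 1) A) (rationalNormalMap n p) =
      Projectivization.mk ℂ (A.1 *ᵥ rationalNormalVec n p.rep)
        (SLC_mulVec_ne_zero A (rationalNormalVec_ne_zero n p.rep_nonzero)) := by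
  rw [rationalNormalMap_eq, pslPerm_mk]

theorem IsHolomorphicCurve.pslPerm_rationalNormalMap {pr : E → S} {v : E → CP 2}
    (hv : IsHolomorphicCurve pr v) {n : ℕ} (A : SLC (n + 1)) :
    IsHolomorphicCurve pr fun e =>
      pslPerm (n + 1) (toPSL (n + 1) A) (rationalNormalMap n (v e)) := by
  intro e
  obtain ⟨F, hF, hvF⟩ := hv e
  refine ⟨fun y => A.1 *ᵥ rationalNormalVec n (F y), ?_, ?_⟩
  · have hg : Differentiable ℂ fun z : Fin 2 → ℂ => A.1 *ᵥ rationalNormalVec n z := by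
      refine differentiable_pi.2 fun i => ?_
      simp only [Matrix.mulVec, dotProduct, rationalNormalVec_apply]
      fun_prop
    filter_upwards [hF] with y hy
    exact hg.comp_mdifferentiableAt hy
  · filter_upwards [hvF] with x hx
    obtain ⟨h, hx⟩ := hx
    refine ⟨SLC_mulVec_ne_zero A (rationalNormalVec_ne_zero n h), ?_⟩
    rw [hx, rationalNormalMap_mk, pslPerm_mk]

theorem isNondegenerate_pslPerm_rationalNormalMap {E : Type*} {v : E → CP 2} (hv : (Set.range v).Infinite)
    {n : ℕ} (A : SLC (n + 1)) :
    IsNondegenerate fun e => pslPerm (n + 1) (toPSL (n + 1) A) (rationalNormalMap n (v e)) := by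
  intro l hl
  by_contra! h
  have h1 : ∀ p ∈ Set.range v, l (A.1 *ᵥ rationalNormalVec n p.rep) = 0 := by
    rintro _ ⟨e, rfl⟩
    have h2 := h e
    simp only [TodaCurve.pslPerm_rationalNormalMap] at h2
    obtain ⟨a, ha⟩ := Projectivization.exists_smul_eq_mk_rep ℂ
      (A.1 *ᵥ rationalNormalVec n (v e).rep)
      (SLC_mulVec_ne_zero A (rationalNormalVec_ne_zero n (v e).rep_nonzero))
    rw [← ha, Units.smul_def, map_smul, smul_eq_mul] at h2
    exact (mul_eq_zero.1 h2).resolve_left a.ne_zero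
  -- The functional is encoded as a square matrix with all rows equal to l, so that the criterion
  -- for equality of matrices applies.
  let B : Matrix (Fin (n + 1)) (Fin (n + 1)) ℂ := LinearMap.toMatrix' (LinearMap.pi fun _ => l)
  have hB : ∀ x, B *ᵥ x = fun _ => l x := fun x => by
    rw [← Matrix.toLin'_apply, Matrix.toLin'_toMatrix']
    rfl
  have h0 : B * A.1 = 0 := by
    refine matrix_ext_of_infinite hv fun p hp => ?_
    rw [← Matrix.mulVec_mulVec, hB, h1 p hp, Matrix.zero_mulVec]
    rfl
  have hA : IsUnit A.1.det := by rw [A.2]; exact isUnit_one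
  have hB0 : B = 0 := by
    rw [← Matrix.mul_one B, ← Matrix.mul_nonsing_inv _ hA, ← Matrix.mul_assoc, h0, Matrix.zero_mul]
  refine hl (LinearMap.ext fun x => ?_)
  have := congrFun (hB x) 0
  rw [hB0, Matrix.zero_mulVec] at this
  exact this.symm

/-- Dividing by an N-th root of the determinant, which has modulus one, makes a unitary matrix
special without changing its projective action. -/
theorem exists_SU_of_unitary {N : ℕ} (hN : N ≠ 0) {W : Matrix (Fin N) (Fin N) ℂ}
    (hW : Wᴴ * W = 1) : ∃ (U : SU N) (c : ℂ), c ≠ 0 ∧ W = c • U.1 := by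
  obtain ⟨c, hc⟩ := IsAlgClosed.exists_pow_nat_eq W.det (Nat.pos_of_ne_zero hN)
  have hdet : conj W.det * W.det = 1 := by
    have := congrArg Matrix.det hW
    rwa [Matrix.det_mul, Matrix.det_conjTranspose, Matrix.det_one] at this
  have hn : ‖c‖ = 1 := by
    rw [Complex.conj_mul', ← hc, norm_pow] at hdet
    have : (‖c‖ ^ N) ^ 2 = 1 := by exact_mod_cast hdet
    rw [← pow_mul] at this
    exact (pow_eq_one_iff_of_nonneg (norm_nonneg c) (by positivity)).1 this
  have hc0 : c ≠ 0 := by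
    rintro rfl
    simp at hn
  have hcc : conj c * c = 1 := by
    rw [Complex.conj_mul', hn]
    simp
  refine ⟨⟨c⁻¹ • W, Matrix.mem_specialUnitaryGroup_iff.2
    ⟨Matrix.mem_unitaryGroup_iff'.2 ?_, ?_⟩⟩, c, hc0, ?_⟩
  · change (c⁻¹ • W)ᴴ * (c⁻¹ • W) = 1
    rw [Matrix.conjTranspose_smul, Matrix.smul_mul, Matrix.mul_smul, hW, smul_smul,
      Complex.star_def, map_inv₀, ← mul_inv, hcc, inv_one, one_smul]
  · rw [Matrix.det_smul, Fintype.card_fin, ← hc, inv_pow, inv_mul_cancel₀ (pow_ne_zero _ hc0)]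
  · rw [smul_smul, mul_inv_cancel₀ hc0, one_smul]

/-- Continuation along a loop with monodromy `γ` changes the composite curve by a unitary matrix
exactly when `Aᴴ * A` commutes with the symmetric power of `γ`. -/
theorem monodromy_iff_commute {E : Type*} {v : E → CP 2} (hv : (Set.range v).Infinite) {n : ℕ}
    (A : SLC (n + 1)) {d : E → E} {γ : SU 2} (hd : ∀ e, v (d e) = pslPerm 2 (suToPSU 2 γ) (v e)) :
    (∃ g ∈ PSU (n + 1), ∀ e, pslPerm (n + 1) (toPSL (n + 1) A) (rationalNormalMap n (v (d e))) =
      pslPerm (n + 1) g (pslPerm (n + 1) (toPSL (n + 1) A) (rationalNormalMap n (v e)))) ↔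
    Commute (A.1ᴴ * A.1) (symPow n γ.1) := by
  have hρ := symPow_SU_conjTranspose_mul_self n γ
  have hA : IsUnit A.1.det := by rw [A.2]; exact isUnit_one
  have hne : ∀ z : Fin 2 → ℂ, z ≠ 0 → γ.1 *ᵥ z ≠ 0 := fun z hz =>
    SLC_mulVec_ne_zero (suToSL 2 γ) hz
  have hleft : ∀ e, pslPerm (n + 1) (toPSL (n + 1) A) (rationalNormalMap n (v (d e))) =
      Projectivization.mk ℂ (A.1 *ᵥ symPow n γ.1 *ᵥ rationalNormalVec n (v e).rep)
        (SLC_mulVec_ne_zero A (by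
          rw [symPow_mulVec]
          exact rationalNormalVec_ne_zero n (hne _ (v e).rep_nonzero))) := by
    intro e
    have h1 : v (d e) = Projectivization.mk ℂ (γ.1 *ᵥ (v e).rep) (hne _ (v e).rep_nonzero) := by
      rw [hd]
      conv_lhs => rw [← (v e).mk_rep]
      rfl
    simp only [h1, symPow_mulVec]
    rfl
  have hright : ∀ (U : SU (n + 1)) e, pslPerm (n + 1) (toPSL (n + 1) (suToSL (n + 1) U))
      (pslPerm (n + 1) (toPSL (n + 1) A) (rationalNormalMap n (v e))) =
      Projectivization.mk ℂ (U.1 *ᵥ A.1 *ᵥ rationalNormalVec n (v e).rep)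
        (SLC_mulVec_ne_zero (suToSL (n + 1) U) (SLC_mulVec_ne_zero A
          (rationalNormalVec_ne_zero n (v e).rep_nonzero))) := by
    intro U e
    rw [pslPerm_rationalNormalMap, pslPerm_mk]
    rfl
  rw [← conj_unitary_iff_commute hρ]
  constructor
  · rintro ⟨_, ⟨U, rfl⟩, hU⟩
    have hUA : IsUnit (U.1 * A.1).det := by
      rw [Matrix.det_mul, A.2, (Matrix.mem_specialUnitaryGroup_iff.1 U.2).2, one_mul]
      exact isUnit_one
    -- The projective identity says that this matrix fixes r_n(v e) for every e, so it is scalar.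
    obtain ⟨c, hc⟩ := exists_scalar_of_infinite hv (n := n)
      (B := (U.1 * A.1)⁻¹ * (A.1 * symPow n γ.1)) (by
        rintro _ ⟨e, rfl⟩
        have h1 := hU e
        rw [hleft] at h1
        have h2 := h1.trans (hright U e)
        obtain ⟨a, ha⟩ := (Projectivization.mk_eq_mk_iff' _ _ _ _ _).1 h2
        refine ⟨a, ?_⟩
        rw [← Matrix.mulVec_mulVec, ← Matrix.mulVec_mulVec, ← ha, Matrix.mulVec_smul,
          Matrix.mulVec_mulVec, Matrix.mulVec_mulVec, Matrix.mul_assoc,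
          Matrix.nonsing_inv_mul _ hUA, Matrix.one_mulVec])
    have hAρ : A.1 * symPow n γ.1 = c • (U.1 * A.1) := by
      have : U.1 * A.1 * ((U.1 * A.1)⁻¹ * (A.1 * symPow n γ.1)) = U.1 * A.1 * (c • 1) :=
        congrArg (fun X => U.1 * A.1 * X) hc
      rw [← Matrix.mul_assoc, Matrix.mul_nonsing_inv _ hUA, Matrix.one_mul, Matrix.mul_smul,
        Matrix.mul_one] at this
      exact this
    have hH : (symPow n γ.1)ᴴ * (A.1ᴴ * A.1) * symPow n γ.1 = (conj c * c) • (A.1ᴴ * A.1) := by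
      calc (symPow n γ.1)ᴴ * (A.1ᴴ * A.1) * symPow n γ.1
          = (A.1 * symPow n γ.1)ᴴ * (A.1 * symPow n γ.1) := by
            rw [Matrix.conjTranspose_mul]
            simp only [Matrix.mul_assoc]
        _ = (conj c * c) • (A.1ᴴ * (U.1ᴴ * U.1) * A.1) := by
            rw [hAρ, Matrix.conjTranspose_smul, Matrix.conjTranspose_mul, Matrix.smul_mul,
              Matrix.mul_smul, smul_smul]
            simp only [Matrix.mul_assoc]
            rfl
        _ = (conj c * c) • (A.1ᴴ * A.1) := by
            rw [SU_conjTranspose_mul_self, Matrix.mul_one]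
    -- The factor conj c * c is positive, and the determinants on both sides are 1, so it equals 1.
    have hdet := congrArg Matrix.det hH
    have hρd : (symPow n γ.1)ᴴ.det * (symPow n γ.1).det = 1 := by
      rw [← Matrix.det_mul, hρ, Matrix.det_one]
    rw [Matrix.det_smul, Matrix.det_mul, Matrix.det_mul, mul_right_comm, hρd, one_mul,
      Matrix.det_mul, Matrix.det_conjTranspose, A.2, star_one, one_mul, mul_one, Fintype.card_fin,
      Complex.conj_mul'] at hdet
    have h1 : (‖c‖ ^ 2) ^ (n + 1) = 1 := by exact_mod_cast hdet.symm
    have h2 : ‖c‖ ^ 2 = 1 := (pow_eq_one_iff_of_nonneg (by positivity) (Nat.succ_ne_zero n)).1 h1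
    rw [hH, Complex.conj_mul']
    have : ((‖c‖ : ℂ)) ^ 2 = 1 := by exact_mod_cast h2
    rw [this, one_smul]
  · intro h
    -- The required monodromy is the conjugate of the symmetric power by A; it is unitary because
    -- the Gram matrix is invariant.
    have hW : (A.1 * symPow n γ.1 * A.1⁻¹)ᴴ * (A.1 * symPow n γ.1 * A.1⁻¹) = 1 := by
      have hA' : IsUnit (A.1ᴴ).det := by
        rw [Matrix.det_conjTranspose, A.2, star_one]
        exact isUnit_one
      calc (A.1 * symPow n γ.1 * A.1⁻¹)ᴴ * (A.1 * symPow n γ.1 * A.1⁻¹)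
          = (A.1⁻¹)ᴴ * ((symPow n γ.1)ᴴ * (A.1ᴴ * A.1) * symPow n γ.1) * A.1⁻¹ := by
            rw [Matrix.conjTranspose_mul, Matrix.conjTranspose_mul]
            simp only [Matrix.mul_assoc]
        _ = 1 := by
            rw [h, Matrix.conjTranspose_nonsing_inv, ← Matrix.mul_assoc,
              Matrix.nonsing_inv_mul _ hA', Matrix.one_mul, Matrix.mul_nonsing_inv _ hA]
    obtain ⟨U, c, hc, hU⟩ := exists_SU_of_unitary (Nat.succ_ne_zero n) hW
    refine ⟨_, ⟨U, rfl⟩, fun e => ?_⟩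
    rw [hleft]
    refine Eq.trans ?_ (hright U e).symm
    refine (Projectivization.mk_eq_mk_iff' _ _ _ _ _).2 ⟨c, ?_⟩
    rw [← Matrix.smul_mulVec, ← hU, Matrix.mulVec_mulVec, Matrix.mulVec_mulVec, Matrix.mul_assoc,
      Matrix.nonsing_inv_mul _ hA, Matrix.mul_one]

theorem mem_unitarySet_iff {pr : E → S} {v : E → CP 2} (hv : IsUnitaryCurve pr v)
    (hinf : (Set.range v).Infinite) {n : ℕ} (A : SLC (n + 1)) :
    toPSL (n + 1) A ∈ unitarySet n pr v ↔ ∀ γ : SU 2, suToPSU 2 γ ∈ monodromyGroup pr v →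
      Commute (A.1ᴴ * A.1) (symPow n γ.1) := by
  constructor
  · rintro h γ ⟨d, hd, hdγ⟩
    exact (monodromy_iff_commute hinf A hdγ).1 (h.monodromy d hd)
  · intro h
    refine ⟨hv.holomorphic.pslPerm_rationalNormalMap A,
      isNondegenerate_pslPerm_rationalNormalMap hinf A, fun d hd => ?_⟩
    obtain ⟨_, ⟨γ, rfl⟩, hdγ⟩ := hv.monodromy d hd
    exact (monodromy_iff_commute (γ := γ) hinf A hdγ).2 (h γ ⟨d, hd, hdγ⟩)

/-- Rescaling γ by a scalar rescales its symmetric power, so commuting with H is a condition on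
classes. It is closed upstairs by continuity of `symPow`, hence closed in the quotient. This allows
the monodromy group to be replaced by its closure. -/
theorem isClosed_commute_symPow (n : ℕ) (H : Matrix (Fin (n + 1)) (Fin (n + 1)) ℂ) :
    IsClosed {x : PSU 2 | ∀ γ : SU 2, suToPSU 2 γ = x → Commute H (symPow n γ.1)} := by
  have hsc : ∀ B B' : SLC 2, toPSL 2 B = toPSL 2 B' → Commute H (symPow n B.1) →
      Commute H (symPow n B'.1) := by
    intro B B' h hB
    obtain ⟨c, -, hc⟩ := toPSL_eq_iff.1 h
    rw [hc, symPow_smul]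
    exact hB.smul_right _
  have hK : IsClosed {y : PSLC 2 | ∀ B : SLC 2, toPSL 2 B = y → Commute H (symPow n B.1)} := by
    rw [← (QuotientGroup.isQuotientMap_mk (Subgroup.center (SLC 2))).isClosed_preimage]
    have : (QuotientGroup.mk : SLC 2 → PSLC 2) ⁻¹'
        {y : PSLC 2 | ∀ B : SLC 2, toPSL 2 B = y → Commute H (symPow n B.1)} =
        {B | H * symPow n B.1 = symPow n B.1 * H} := by
      ext B
      exact ⟨fun h => h B rfl, fun h B' hB' => hsc B B' hB'.symm h⟩
    rw [this]
    have hc : Continuous fun B : SLC 2 => symPow n B.1 :=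
      (continuous_symPow n).comp continuous_subtype_val
    exact isClosed_eq (continuous_const.matrix_mul hc) (hc.matrix_mul continuous_const)
  convert! hK.preimage continuous_subtype_val using 1
  ext x
  constructor
  · intro h B hB
    obtain ⟨γ, hγ⟩ := (suToPSU 2).mem_range.1
      (show x ∈ (suToPSU 2).range from (MonoidHom.rangeRestrict_surjective _) x)
    exact hsc (suToSL 2 γ) B ((congrArg Subtype.val hγ).trans hB.symm) (h γ hγ)
  · intro h γ hγ
    exact h (suToSL 2 γ) (congrArg Subtype.val hγ)

theorem mem_unitarySet_iff_closedMonodromy {pr : E → S} {v : E → CP 2} (hv : IsUnitaryCurve pr v)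
    (hinf : (Set.range v).Infinite) {n : ℕ} (A : SLC (n + 1)) :
    toPSL (n + 1) A ∈ unitarySet n pr v ↔ ∀ γ : SU 2, suToPSU 2 γ ∈ closedMonodromy pr v →
      Commute (A.1ᴴ * A.1) (symPow n γ.1) := by
  rw [mem_unitarySet_iff hv hinf]
  refine ⟨fun h γ hγ => ?_, fun h γ hγ => h γ (subset_closure hγ)⟩
  exact closure_minimal (t := {x : PSU 2 | ∀ γ : SU 2, suToPSU 2 γ = x →
    Commute (A.1ᴴ * A.1) (symPow n γ.1)}) (fun x hx γ hγ => h γ (hγ ▸ hx))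
    (isClosed_commute_symPow n _) hγ γ rfl

theorem mem_deltaSet_iff {pr : E → S} {v : E → CP 2} (hv : IsUnitaryCurve pr v)
    (hinf : (Set.range v).Infinite) {n : ℕ} (A : SLC (n + 1)) :
    A ∈ deltaSet n pr v ↔ A ∈ upperPos n ∧ ∀ γ : SU 2, suToPSU 2 γ ∈ closedMonodromy pr v →
      Commute (A.1ᴴ * A.1) (symPow n γ.1) :=
  and_congr_right fun _ => mem_unitarySet_iff_closedMonodromy hv hinf A

end Curves

/-! ## The decomposition of `M_v` -/

section Decomposition

variable {S E : Type*} [TopologicalSpace S] [ChartedSpace ℂ S] [TopologicalSpace E]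

theorem gram_SU_mul {N : ℕ} (U : SU N) (B : Matrix (Fin N) (Fin N) ℂ) (c : ℂ)
    (hc : conj c * c = 1) : (c • (U.1 * B))ᴴ * (c • (U.1 * B)) = Bᴴ * B := by
  rw [Matrix.conjTranspose_smul, Matrix.smul_mul, Matrix.mul_smul, smul_smul, Complex.star_def, hc,
    one_smul, Matrix.conjTranspose_mul, Matrix.mul_assoc, ← Matrix.mul_assoc U.1ᴴ,
    SU_conjTranspose_mul_self, Matrix.one_mul]

/-- Every unimodular matrix is the product of a special unitary matrix and of an upper triangular
matrix with positive diagonal entries. -/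
theorem exists_SU_mul_upperPos {n : ℕ} (A : SLC (n + 1)) :
    ∃ (U : SU (n + 1)) (B : SLC (n + 1)), B ∈ upperPos n ∧ A = suToSL (n + 1) U * B := by
  obtain ⟨R, hR, hRA⟩ := exists_isUpperPos_gram (posDef_gram A)
  have hdet : R.det = 1 := det_eq_one_of_gram hR (by
    rw [hRA, Matrix.det_mul, Matrix.det_conjTranspose, A.2, star_one, one_mul])
  have hRu : IsUnit R.det := by rw [hdet]; exact isUnit_one
  have hRu' : IsUnit (Rᴴ).det := by
    rw [Matrix.det_conjTranspose, hdet, star_one]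
    exact isUnit_one
  have hU : (A.1 * R⁻¹)ᴴ * (A.1 * R⁻¹) = 1 := by
    rw [Matrix.conjTranspose_mul, Matrix.mul_assoc, ← Matrix.mul_assoc _ A.1, ← hRA,
      Matrix.mul_assoc, Matrix.mul_nonsing_inv _ hRu, Matrix.mul_one,
      Matrix.conjTranspose_nonsing_inv, Matrix.nonsing_inv_mul _ hRu']
  refine ⟨⟨A.1 * R⁻¹, Matrix.mem_specialUnitaryGroup_iff.2
    ⟨Matrix.mem_unitaryGroup_iff'.2 hU, ?_⟩⟩, ⟨R, hdet⟩, hR, Subtype.ext ?_⟩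
  · rw [Matrix.det_mul, A.2, Matrix.det_nonsing_inv, hdet, Ring.inverse_one, one_mul]
  · change A.1 = A.1 * R⁻¹ * R
    rw [Matrix.mul_assoc, Matrix.nonsing_inv_mul _ hRu, Matrix.mul_one]

/-- Neither a unitary left factor nor a central scalar, which is a root of unity, changes the Gram
matrix; the Cholesky factor is therefore determined by the projective class. -/
theorem eq_of_toPSL_eq {n : ℕ} {A B : SLC (n + 1)} (hA : A ∈ upperPos n) (hB : B ∈ upperPos n)
    (U : SU (n + 1)) (h : toPSL (n + 1) A = toPSL (n + 1) (suToSL (n + 1) U * B)) : A = B := by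
  obtain ⟨c, hc, hcA⟩ := toPSL_eq_iff.1 h.symm
  refine Subtype.ext (IsUpperPos.eq_of_gram_eq hA hB ?_)
  rw [hcA]
  exact gram_SU_mul U B.1 c (norm_eq_one_of_pow (Nat.succ_ne_zero n) hc)

theorem gram_eq_of_eq_SU_mul {N : ℕ} {A B : SLC N} {U : SU N} (h : A = suToSL N U * B) :
    A.1ᴴ * A.1 = B.1ᴴ * B.1 := by
  have := gram_SU_mul U B.1 1 (by simp)
  rw [one_smul] at this
  rw [h]
  exact this

/-- Membership depends on A only through Aᴴ A, so A may be replaced by the triangular factor of its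
unitary–triangular decomposition. -/
theorem unitarySet_eq_psuMul {pr : E → S} {v : E → CP 2} (hv : IsUnitaryCurve pr v)
    (hinf : (Set.range v).Infinite) (n : ℕ) :
    unitarySet n pr v = psuMul n (deltaSet n pr v) := by
  ext φ
  obtain ⟨A, rfl⟩ := QuotientGroup.mk_surjective φ
  change toPSL (n + 1) A ∈ _ ↔ _
  constructor
  · intro h
    obtain ⟨U, B, hB, hAB⟩ := exists_SU_mul_upperPos A
    refine ⟨_, ⟨U, rfl⟩, B, ⟨hB, ?_⟩, ?_⟩
    · rw [mem_unitarySet_iff hv hinf] at h ⊢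
      rwa [← gram_eq_of_eq_SU_mul hAB]
    · change toPSL (n + 1) A = _
      rw [hAB, map_mul]
      rfl
  · rintro ⟨_, ⟨U, rfl⟩, B, hB, hAB⟩
    have h : (QuotientGroup.mk A : PSLC (n + 1)) = toPSL (n + 1) (suToSL (n + 1) U * B) := by
      rw [hAB, map_mul]
      rfl
    rw [show toPSL (n + 1) A = toPSL (n + 1) (suToSL (n + 1) U * B) from h]
    have hB2 := hB.2
    rw [mem_unitarySet_iff hv hinf] at hB2 ⊢
    rwa [gram_eq_of_eq_SU_mul (U := U) rfl]

theorem eq_of_psuMul_eq {n : ℕ} {D D' : Set (SLC (n + 1))} (hD : D ⊆ upperPos n)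
    (hD' : D' ⊆ upperPos n) (h : psuMul n D ⊆ psuMul n D') : D ⊆ D' := by
  intro A hA
  obtain ⟨_, ⟨U, rfl⟩, B, hB, hAB⟩ := h ⟨1, one_mem _, A, hA, (one_mul _).symm⟩
  have : A = B := eq_of_toPSL_eq (hD hA) (hD' hB) U (by
    rw [hAB, map_mul]
    rfl)
  rwa [this]

end Decomposition

/-! ## Commutants of symmetric powers -/

/-- The matrices commuting with the symmetric powers of the elements of `s`. -/
def commutant (n : ℕ) (s : Set (SU 2)) : Submodule ℂ (Matrix (Fin (n + 1)) (Fin (n + 1)) ℂ) where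
  carrier := {H | ∀ γ ∈ s, Commute H (symPow n γ.1)}
  add_mem' ha hb γ hγ := (ha γ hγ).add_left (hb γ hγ)
  zero_mem' _ _ := Commute.zero_left _
  smul_mem' c _ ha γ hγ := (ha γ hγ).smul_left c

theorem mem_commutant {n : ℕ} {s : Set (SU 2)} {H : Matrix (Fin (n + 1)) (Fin (n + 1)) ℂ} :
    H ∈ commutant n s ↔ ∀ γ ∈ s, Commute H (symPow n γ.1) := Iff.rfl

theorem one_mem_commutant (n : ℕ) (s : Set (SU 2)) : 1 ∈ commutant n s :=
  fun _ _ => Commute.one_left _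

/-- Commuting with a unitary matrix means invariance under conjugation by it, and taking adjoints
respects this. -/
theorem conjTranspose_mem_commutant {n : ℕ} {s : Set (SU 2)}
    {H : Matrix (Fin (n + 1)) (Fin (n + 1)) ℂ} (hH : H ∈ commutant n s) : Hᴴ ∈ commutant n s := by
  intro γ hγ
  have hρ := symPow_SU_conjTranspose_mul_self n γ
  have h := (conj_unitary_iff_commute hρ).2 (hH γ hγ)
  rw [← conj_unitary_iff_commute hρ]
  have h' := congrArg Matrix.conjTranspose h
  rwa [Matrix.conjTranspose_mul, Matrix.conjTranspose_mul, Matrix.conjTranspose_conjTranspose,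
    ← Matrix.mul_assoc] at h'

/-- The elements of `SU(2)` whose symmetric powers commute with a given matrix. -/
def symPowCentralizer (n : ℕ) (H : Matrix (Fin (n + 1)) (Fin (n + 1)) ℂ) : Subgroup (SU 2) where
  carrier := {γ | Commute H (symPow n γ.1)}
  one_mem' := by
    change Commute H (symPow n 1)
    rw [symPow_one]
    exact Commute.one_right _
  mul_mem' {a b} ha hb := by
    change Commute H (symPow n (a.1 * b.1))
    rw [symPow_mul]
    exact ha.mul_right hb
  inv_mem' {a} ha := by
    have h1 : symPow n (a⁻¹).1 * symPow n a.1 = 1 := by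
      rw [← symPow_mul, show (a⁻¹).1 * a.1 = 1 from congrArg Subtype.val (inv_mul_cancel a),
        symPow_one]
    have h2 : symPow n a.1 * symPow n (a⁻¹).1 = 1 := mul_eq_one_comm.1 h1
    have h3 : H * symPow n a.1 = symPow n a.1 * H := ha
    change H * symPow n (a⁻¹).1 = symPow n (a⁻¹).1 * H
    calc H * symPow n (a⁻¹).1 = symPow n (a⁻¹).1 * (symPow n a.1 * H) * symPow n (a⁻¹).1 := by
          rw [← Matrix.mul_assoc, h1, Matrix.one_mul]
      _ = symPow n (a⁻¹).1 * H := by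
          rw [← h3, Matrix.mul_assoc, Matrix.mul_assoc H, h2, Matrix.mul_one]

/-- For a fixed H, the γ whose symmetric power commutes with H form a subgroup, so it is enough to
test generators. -/
theorem commutant_closure (n : ℕ) (s : Set (SU 2)) :
    commutant n (Subgroup.closure s : Set (SU 2)) = commutant n s := by
  ext H
  exact ⟨fun h γ hγ => h γ (Subgroup.subset_closure hγ),
    fun h γ hγ => ((Subgroup.closure_le (symPowCentralizer n H)).2 h) hγ⟩

theorem commute_symPow_of_suToPSU_eq {n : ℕ} {H : Matrix (Fin (n + 1)) (Fin (n + 1)) ℂ}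
    {γ γ' : SU 2} (h : suToPSU 2 γ = suToPSU 2 γ') (hγ : Commute H (symPow n γ.1)) :
    Commute H (symPow n γ'.1) := by
  obtain ⟨c, -, hc⟩ := toPSL_eq_iff.1 (SU_ext_iff_toPSL.1 h)
  have hc' : γ'.1 = c • γ.1 := hc
  rw [hc', symPow_smul]
  exact hγ.smul_right _

section Delta

variable {S E : Type*} [TopologicalSpace S] [ChartedSpace ℂ S] [TopologicalSpace E]

theorem mem_deltaSet_iff_commutant {pr : E → S} {v : E → CP 2} (hv : IsUnitaryCurve pr v)
    (hinf : (Set.range v).Infinite) {n : ℕ} {G : Subgroup (SU 2)}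
    (hG : closedMonodromy pr v = psuImage G) (A : SLC (n + 1)) :
    A ∈ deltaSet n pr v ↔ A ∈ upperPos n ∧ A.1ᴴ * A.1 ∈ commutant n (G : Set (SU 2)) := by
  rw [mem_deltaSet_iff hv hinf, hG]
  refine and_congr_right fun _ => ⟨fun h γ hγ => h γ ⟨γ, hγ, rfl⟩, ?_⟩
  rintro h γ ⟨γ', hγ', he⟩
  exact commute_symPow_of_suToPSU_eq he (h γ' hγ')

/-- The hermitian matrices in a complex subspace. -/
def hermPart {N : ℕ} (W : Submodule ℂ (Matrix (Fin N) (Fin N) ℂ)) :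
    Submodule ℝ (Matrix (Fin N) (Fin N) ℂ) where
  carrier := {H | H.IsHermitian ∧ H ∈ W}
  add_mem' ha hb := ⟨ha.1.add hb.1, W.add_mem ha.2 hb.2⟩
  zero_mem' := ⟨Matrix.isHermitian_zero, W.zero_mem⟩
  smul_mem' c H hH := by
    refine ⟨?_, W.smul_mem (c : ℂ) hH.2⟩
    change (c • H)ᴴ = c • H
    rw [Matrix.conjTranspose_smul, hH.1, star_trivial]

/-- A complex subspace stable under adjoints is the direct sum of its Hermitian part and i times
that part, which halves the real dimension. -/
theorem finrank_hermPart {N : ℕ} {W : Submodule ℂ (Matrix (Fin N) (Fin N) ℂ)}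
    (hW : ∀ H ∈ W, Hᴴ ∈ W) : Module.finrank ℝ (hermPart W) = Module.finrank ℂ W := by
  have hI : ∀ a b : Matrix (Fin N) (Fin N) ℂ, a.IsHermitian → b.IsHermitian →
      (a + Complex.I • b)ᴴ = a - Complex.I • b := by
    intro a b ha hb
    rw [Matrix.conjTranspose_add, Matrix.conjTranspose_smul, ha, hb, Complex.star_def,
      Complex.conj_I, neg_smul, sub_eq_add_neg]
  let f : (hermPart W × hermPart W) →ₗ[ℝ] W.restrictScalars ℝ :=
    { toFun := fun x => ⟨x.1.1 + Complex.I • x.2.1,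
        W.add_mem x.1.2.2 (W.smul_mem _ x.2.2.2)⟩
      map_add' := fun x y => Subtype.ext (by
        change (x.1.1 + y.1.1) + Complex.I • (x.2.1 + y.2.1) =
          (x.1.1 + Complex.I • x.2.1) + (y.1.1 + Complex.I • y.2.1)
        rw [smul_add]
        abel)
      map_smul' := fun c x => Subtype.ext (by
        change c • x.1.1 + Complex.I • c • x.2.1 = c • (x.1.1 + Complex.I • x.2.1)
        rw [smul_add, smul_comm]) }
  have hf : Function.Bijective f := by
    constructor
    · rw [injective_iff_map_eq_zero]
      rintro ⟨⟨a, ha⟩, ⟨b, hb⟩⟩ h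
      have h1 : a + Complex.I • b = 0 := congrArg Subtype.val h
      have h2 : a - Complex.I • b = 0 := by
        rw [← hI a b ha.1 hb.1, h1, Matrix.conjTranspose_zero]
      have ha0 : (2 : ℂ) • a = 0 := by
        have : (2 : ℂ) • a = (a + Complex.I • b) + (a - Complex.I • b) := by
          rw [two_smul]
          abel
        rw [this, h1, h2, add_zero]
      have ha0 : a = 0 := (smul_eq_zero.1 ha0).resolve_left two_ne_zero
      have hb0 : b = 0 := by
        rw [ha0, zero_add] at h1
        exact (smul_eq_zero.1 h1).resolve_left Complex.I_ne_zero
      subst ha0 hb0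
      rfl
    · rintro ⟨X, hX⟩
      have hX' : X ∈ W := hX
      have h1 : ((1 / 2 : ℂ) • (X + Xᴴ)) ∈ hermPart W := by
        refine ⟨?_, W.smul_mem _ (W.add_mem hX' (hW X hX'))⟩
        change _ᴴ = _
        rw [Matrix.conjTranspose_smul, Matrix.conjTranspose_add,
          Matrix.conjTranspose_conjTranspose, add_comm]
        simp
      have h2 : ((-Complex.I / 2 : ℂ) • (X - Xᴴ)) ∈ hermPart W := by
        refine ⟨?_, W.smul_mem _ (W.sub_mem hX' (hW X hX'))⟩
        change _ᴴ = _
        rw [Matrix.conjTranspose_smul, Matrix.conjTranspose_sub,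
          Matrix.conjTranspose_conjTranspose, ← neg_sub, smul_neg, ← neg_smul]
        congr 1
        simp [neg_div]
      refine ⟨(⟨_, h1⟩, ⟨_, h2⟩), Subtype.ext ?_⟩
      change (1 / 2 : ℂ) • (X + Xᴴ) + Complex.I • (-Complex.I / 2 : ℂ) • (X - Xᴴ) = X
      rw [smul_smul]
      have : Complex.I * (-Complex.I / 2) = 1 / 2 := by
        linear_combination (-1 / 2 : ℂ) * Complex.I_sq
      rw [this, ← smul_add, add_add_sub_cancel, ← two_smul ℂ, smul_smul]
      norm_num
  have h1 := (LinearEquiv.ofBijective f hf).finrank_eq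
  have h2 : Module.finrank ℝ (W.restrictScalars ℝ) = 2 * Module.finrank ℂ W :=
    finrank_real_of_complex W
  rw [Module.finrank_prod, h2] at h1
  omega

/-- The loss of one dimension comes from determinant one, which removes scaling of the Gram matrix.
All dimension formulas thereby become formulas for commutants. -/
theorem hasRealDim_deltaSet {pr : E → S} {v : E → CP 2} (hv : IsUnitaryCurve pr v)
    (hinf : (Set.range v).Infinite) {n : ℕ} {G : Subgroup (SU 2)}
    (hG : closedMonodromy pr v = psuImage G) {r : ℝ}
    (hr : (Module.finrank ℂ (commutant n (G : Set (SU 2))) : ℝ) = r + 1) :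
    HasRealDim (deltaSet n pr v) r := by
  have hpos : 0 < Module.finrank ℂ (commutant n (G : Set (SU 2))) := by
    refine Module.finrank_pos_iff_exists_ne_zero.2 ⟨⟨1, one_mem_commutant n _⟩, fun h => ?_⟩
    exact one_ne_zero (congrArg Subtype.val h)
  obtain ⟨d, hd⟩ := Nat.exists_eq_succ_of_ne_zero hpos.ne'
  have hdr : (d : ℝ) = r := by
    rw [hd] at hr
    push_cast at hr
    linarith
  rw [← hdr]
  refine hasRealDim_of_gram (Nat.succ_ne_zero n) (hermPart (commutant n (G : Set (SU 2))))
    (fun H hH => hH.1) ⟨Matrix.isHermitian_one, one_mem_commutant n _⟩ ?_ fun A => ?_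
  · rw [finrank_hermPart fun H => conjTranspose_mem_commutant, hd]
  · rw [mem_deltaSet_iff_commutant hv hinf hG]
    exact and_congr_right fun _ =>
      ⟨fun h => ⟨Matrix.isHermitian_conjTranspose_mul_self _, h⟩, fun h => h.2⟩

end Delta

/-! ## Dimensions as traces of projections -/

theorem trace_matrix_end {N : ℕ}
    (P : Matrix (Fin N) (Fin N) ℂ →ₗ[ℂ] Matrix (Fin N) (Fin N) ℂ) :
    LinearMap.trace ℂ _ P = ∑ i, ∑ j, P (Matrix.single i j 1) i j := by
  rw [LinearMap.trace_eq_matrix_trace ℂ (Matrix.stdBasis ℂ (Fin N) (Fin N)), Matrix.trace,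
    Fintype.sum_prod_type]
  refine Finset.sum_congr rfl fun i _ => Finset.sum_congr rfl fun j _ => ?_
  rw [Matrix.diag_apply, LinearMap.toMatrix_apply, Matrix.stdBasis_eq_single]
  rfl

/-- The dimension is the trace of a projection onto the subspace, computed on matrix units. -/
theorem finrank_eq_of_isProj {N : ℕ} {W : Submodule ℂ (Matrix (Fin N) (Fin N) ℂ)}
    {P : Matrix (Fin N) (Fin N) ℂ →ₗ[ℂ] Matrix (Fin N) (Fin N) ℂ}
    (hP : LinearMap.IsProj W P) :
    (Module.finrank ℂ W : ℂ) = ∑ i, ∑ j, P (Matrix.single i j 1) i j := by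
  rw [← trace_matrix_end, hP.trace]

theorem finrank_pattern {N : ℕ} {W : Submodule ℂ (Matrix (Fin N) (Fin N) ℂ)}
    (s : Fin N → Fin N → Prop) [∀ i j, Decidable (s i j)]
    (hW : ∀ H, H ∈ W ↔ ∀ i j, ¬ s i j → H i j = 0) :
    (Module.finrank ℂ W : ℂ) = ∑ i, ∑ j, if s i j then (1 : ℂ) else 0 := by
  let P : Matrix (Fin N) (Fin N) ℂ →ₗ[ℂ] Matrix (Fin N) (Fin N) ℂ :=
    { toFun := fun H => Matrix.of fun i j => if s i j then H i j else 0
      map_add' := fun H K => by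
        ext i j
        by_cases h : s i j <;> simp [h]
      map_smul' := fun c H => by
        ext i j
        by_cases h : s i j <;> simp [h] }
  have hP : LinearMap.IsProj W P := by
    refine ⟨fun H => (hW _).2 fun i j h => if_neg h, fun H hH => ?_⟩
    ext i j
    by_cases h : s i j
    · exact if_pos h
    · exact (if_neg h).trans ((hW H).1 hH i j h).symm
  rw [finrank_eq_of_isProj hP]
  refine Finset.sum_congr rfl fun i _ => Finset.sum_congr rfl fun j _ => ?_
  change (if s i j then Matrix.single i j (1 : ℂ) i j else 0) = _
  rw [Matrix.single_apply_same]

theorem sum_rev_fixed (n : ℕ) (a : Fin (n + 1) → Fin (n + 1) → ℂ) (ha : ∀ i, a i i = 1) :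
    ∑ i, ∑ j, (if i.rev = i ∧ j.rev = j then a i j else 0) = if Even n then 1 else 0 := by
  by_cases hn : Even n
  · obtain ⟨m, hm⟩ := hn
    rw [if_pos ⟨m, hm⟩]
    let c : Fin (n + 1) := ⟨m, by omega⟩
    have hc : ∀ i : Fin (n + 1), i.rev = i ↔ i = c := by
      intro i
      rw [Fin.ext_iff, Fin.ext_iff, Fin.val_rev]
      have := i.2
      change _ ↔ (i : ℕ) = m
      omega
    simp only [hc]
    rw [Finset.sum_eq_single c, Finset.sum_eq_single c]
    · simp [ha]
    · intro j _ hj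
      simp [hj]
    · simp
    · intro i _ hi
      simp [hi]
    · simp
  · rw [if_neg hn]
    refine Finset.sum_eq_zero fun i _ => Finset.sum_eq_zero fun j _ => if_neg ?_
    rintro ⟨hi, -⟩
    refine hn ⟨i, ?_⟩
    rw [Fin.ext_iff, Fin.val_rev] at hi
    have := i.2
    omega

/-- The projection averages an entry with its weighted reversed partner. Its trace gives 1/2 for
each allowed pair, and another 1/2 for a pair fixed by reversal; the only such pair is the central
diagonal one, present when n is even. -/
theorem finrank_rev_pattern {n : ℕ}
    {W : Submodule ℂ (Matrix (Fin (n + 1)) (Fin (n + 1)) ℂ)}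
    (s : Fin (n + 1) → Fin (n + 1) → Prop) [∀ i j, Decidable (s i j)]
    (hs : ∀ i j, s i j → s i.rev j.rev) (hsr : ∀ i, s i i)
    (w : Fin (n + 1) → Fin (n + 1) → ℂ) (hw : ∀ i j, w i j * w i.rev j.rev = 1)
    (hwr : ∀ i, w i i = 1)
    (hW : ∀ H, H ∈ W ↔ (∀ i j, ¬ s i j → H i j = 0) ∧ ∀ i j, H i j = w i j * H i.rev j.rev) :
    (Module.finrank ℂ W : ℂ) =
      ((∑ i, ∑ j, if s i j then (1 : ℂ) else 0) + if Even n then 1 else 0) / 2 := by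
  let P : Matrix (Fin (n + 1)) (Fin (n + 1)) ℂ →ₗ[ℂ] Matrix (Fin (n + 1)) (Fin (n + 1)) ℂ :=
    { toFun := fun H => Matrix.of fun i j =>
        if s i j then (H i j + w i j * H i.rev j.rev) / 2 else 0
      map_add' := fun H K => by
        ext i j
        by_cases h : s i j
        · simp [h]
          ring
        · simp [h]
      map_smul' := fun c H => by
        ext i j
        by_cases h : s i j
        · simp [h]
          ring
        · simp [h] }
  have hPa : ∀ H i j, P H i j = if s i j then (H i j + w i j * H i.rev j.rev) / 2 else 0 :=
    fun _ _ _ => rfl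
  have hP : LinearMap.IsProj W P := by
    refine ⟨fun H => (hW _).2 ⟨fun i j h => if_neg h, fun i j => ?_⟩, fun H hH => ?_⟩
    · rw [hPa, hPa]
      by_cases h : s i j
      · rw [if_pos h, if_pos (hs i j h), Fin.rev_rev, Fin.rev_rev]
        linear_combination (-H i j / 2) * hw i j
      · have h' : ¬ s i.rev j.rev := fun h' => h (by simpa using hs _ _ h')
        rw [if_neg h, if_neg h', mul_zero]
    · ext i j
      rw [hPa]
      by_cases h : s i j
      · rw [if_pos h, ← ((hW H).1 hH).2 i j, add_self_div_two]
      · rw [if_neg h, ((hW H).1 hH).1 i j h]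
  rw [finrank_eq_of_isProj hP, ← sum_rev_fixed n w hwr, ← Finset.sum_add_distrib,
    Finset.sum_div]
  refine Finset.sum_congr rfl fun i _ => ?_
  rw [← Finset.sum_add_distrib, Finset.sum_div]
  refine Finset.sum_congr rfl fun j _ => ?_
  rw [hPa, Matrix.single_apply_same, Matrix.single_apply]
  by_cases hij : i.rev = i ∧ j.rev = j
  · have hij' : i = j := by
      have h1 := hij.1
      have h2 := hij.2
      rw [Fin.ext_iff, Fin.val_rev] at h1 h2
      have := i.2
      have := j.2
      exact Fin.ext (by omega)
    subst hij'
    simp [hij.1, hsr, hwr]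
  · have hij' : ¬ (i = i.rev ∧ j = j.rev) := fun h => hij ⟨h.1.symm, h.2.symm⟩
    by_cases h : s i j <;> simp [h, hij, hij']

/-! ## Counting congruent pairs -/

/-- The number of pairs of indices congruent modulo `k`. -/
def pairCount (k n : ℕ) : ℤ :=
  ∑ i : Fin (n + 1), ∑ j : Fin (n + 1), if (k : ℤ) ∣ (i : ℤ) - (j : ℤ) then 1 else 0

theorem sum_dvd_sub (k m : ℕ) :
    (∑ i : Fin m, if (k : ℤ) ∣ (m : ℤ) - (i : ℤ) then (1 : ℤ) else 0) = ((m / k : ℕ) : ℤ) := by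
  rw [Fin.sum_univ_eq_sum_range (fun i => if (k : ℤ) ∣ (m : ℤ) - (i : ℤ) then (1 : ℤ) else 0),
    ← Finset.sum_range_reflect, ← Nat.card_multiples, Finset.card_filter]
  push_cast
  refine Finset.sum_congr rfl fun j hj => ?_
  have hj' := Finset.mem_range.1 hj
  have : (m : ℤ) - ((m - 1 - j : ℕ) : ℤ) = ((j + 1 : ℕ) : ℤ) := by omega
  simp only [this, Int.natCast_dvd_natCast]

/-- The new index n+1 pairs with itself and, in both orders, with the smaller indices congruent to
it, of which there are ⌊(n+1)/k⌋. -/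
theorem pairCount_succ (k n : ℕ) :
    pairCount k (n + 1) = pairCount k n + 2 * ((n + 1) / k : ℕ) + 1 := by
  have h1 := sum_dvd_sub k (n + 1)
  have h2 : (∑ i : Fin (n + 1), if (k : ℤ) ∣ (i : ℤ) - ((n + 1 : ℕ) : ℤ) then (1 : ℤ) else 0) =
      (((n + 1) / k : ℕ) : ℤ) := by
    rw [← h1]
    refine Finset.sum_congr rfl fun i _ => ?_
    simp only [← neg_sub ((n + 1 : ℕ) : ℤ) (i : ℤ), dvd_neg]
  rw [pairCount, Fin.sum_univ_castSucc]
  simp only [Fin.sum_univ_castSucc (n := n + 1), Fin.val_castSucc, Fin.val_last, sub_self,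
    dvd_zero, if_true]
  rw [Finset.sum_add_distrib, h1, h2, pairCount]
  ring

theorem pairCount_eq (k n : ℕ) :
    pairCount k n = -(k : ℤ) * ((n / k : ℕ) : ℤ) ^ 2 + (2 * n + 2 - k) * ((n / k : ℕ) : ℤ) +
      n + 1 := by
  induction n with
  | zero => simp [pairCount]
  | succ n ih =>
    rw [pairCount_succ, ih, Nat.succ_div]
    by_cases h : k ∣ n + 1
    · rw [if_pos h]
      -- When the quotient jumps, n+1 is exactly k times its new value; this relation makes the
      -- quadratic formula consistent with the recursion.
      have h1 : ((n : ℤ) + 1) = k * ((n / k : ℕ) + 1) := by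
        have h2 := Nat.div_mul_cancel h
        rw [Nat.succ_div, if_pos h] at h2
        have : (((n / k + 1) * k : ℕ) : ℤ) = ((n + 1 : ℕ) : ℤ) := by rw [h2]
        push_cast at this ⊢
        linarith
      push_cast at h1 ⊢
      linear_combination (-2 : ℤ) * h1
    · rw [if_neg h]
      push_cast
      ring

theorem pairCount_eq_sum (k n : ℕ) :
    ((pairCount k n : ℤ) : ℂ) = ∑ i : Fin (n + 1), ∑ j : Fin (n + 1),
      if (k : ℤ) ∣ (i : ℤ) - (j : ℤ) then (1 : ℂ) else 0 := by
  simp [pairCount]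

theorem floor_natCast_div {k n : ℕ} : (⌊(n : ℝ) / k⌋ : ℝ) = ((n / k : ℕ) : ℝ) := by
  rw [Int.floor_div_natCast, Int.floor_natCast]
  norm_cast

/-! ## Commutants of the subgroups of `O(2)` -/

theorem symPow_diagSU (n : ℕ) (z : Circle) :
    symPow n (diagSU z).1 =
      Matrix.diagonal fun i : Fin (n + 1) => (z : ℂ) ^ (n : ℤ) * (z : ℂ) ^ (-(2 * (i : ℤ))) := by
  change symPow n !![(z : ℂ), 0; 0, conj (z : ℂ)] = _
  rw [symPow_diag]
  congr 1
  ext i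
  have hi : (i : ℕ) ≤ n := Nat.lt_succ_iff.1 i.2
  have hz : (z : ℂ) ≠ 0 := Circle.coe_ne_zero z
  have hc : conj (z : ℂ) = (z : ℂ)⁻¹ := by
    rw [← Circle.coe_inv_eq_conj, Circle.coe_inv]
  rw [hc, ← zpow_natCast (z : ℂ), ← zpow_natCast (z : ℂ)⁻¹, _root_.inv_zpow', ← zpow_add₀ hz,
    ← zpow_add₀ hz]
  congr 1
  omega

/-- Conjugation by the diagonal symmetric power multiplies each entry by a power of z; the weights
of neighbouring indices differ by a factor z², hence the exponent 2(i - j). -/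
theorem commute_symPow_diagSU_iff {n : ℕ} {H : Matrix (Fin (n + 1)) (Fin (n + 1)) ℂ} {z : Circle} :
    Commute H (symPow n (diagSU z).1) ↔
      ∀ i j : Fin (n + 1), (z : ℂ) ^ (2 * ((i : ℤ) - j)) ≠ 1 → H i j = 0 := by
  have hz : (z : ℂ) ≠ 0 := Circle.coe_ne_zero z
  rw [symPow_diagSU]
  have h1 : Commute H (Matrix.diagonal fun i : Fin (n + 1) =>
      (z : ℂ) ^ (n : ℤ) * (z : ℂ) ^ (-(2 * (i : ℤ)))) ↔ ∀ i j : Fin (n + 1),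
      H i j * ((z : ℂ) ^ (n : ℤ) * (z : ℂ) ^ (-(2 * (j : ℤ)))) =
        ((z : ℂ) ^ (n : ℤ) * (z : ℂ) ^ (-(2 * (i : ℤ)))) * H i j := by
    rw [Commute, SemiconjBy, ← Matrix.ext_iff]
    simp only [Matrix.mul_diagonal, Matrix.diagonal_mul]
  rw [h1]
  refine forall_congr' fun i => forall_congr' fun j => ?_
  have h2 : (z : ℂ) ^ (n : ℤ) * (z : ℂ) ^ (-(2 * (j : ℤ))) =
      (z : ℂ) ^ (n : ℤ) * (z : ℂ) ^ (-(2 * (i : ℤ))) * (z : ℂ) ^ (2 * ((i : ℤ) - j)) := by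
    rw [mul_assoc]
    congr 1
    rw [← zpow_add₀ hz]
    congr 1
    ring
  have h3 : (z : ℂ) ^ (n : ℤ) * (z : ℂ) ^ (-(2 * (i : ℤ))) ≠ 0 :=
    mul_ne_zero (zpow_ne_zero _ hz) (zpow_ne_zero _ hz)
  rw [h2]
  constructor
  · intro h hne
    by_contra h0
    refine hne (mul_left_cancel₀ (mul_ne_zero h3 h0) ?_)
    linear_combination h
  · intro h
    by_cases hne : (z : ℂ) ^ (2 * ((i : ℤ) - j)) = 1
    · rw [hne]
      ring
    · rw [h hne]
      ring

/-- This is the source of k / gcd(k, 2): a primitive m-th root of unity enters only through its even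
powers. -/
theorem dvd_two_mul_iff {m : ℕ} (hm : 1 ≤ m) (x : ℤ) :
    (m : ℤ) ∣ 2 * x ↔ ((m / Nat.gcd m 2 : ℕ) : ℤ) ∣ x := by
  have hg : 0 < Nat.gcd m 2 := Nat.gcd_pos_of_pos_left _ hm
  obtain ⟨a, ha⟩ := Nat.gcd_dvd_left m 2
  obtain ⟨b, hb⟩ := Nat.gcd_dvd_right m 2
  have hma : m / Nat.gcd m 2 = a := Nat.div_eq_of_eq_mul_right hg ha
  have h2b : 2 / Nat.gcd m 2 = b := Nat.div_eq_of_eq_mul_right hg hb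
  have hcop : Nat.Coprime a b := by
    have := Nat.coprime_div_gcd_div_gcd hg
    rwa [hma, h2b] at this
  rw [hma]
  have hm' : (m : ℤ) = (Nat.gcd m 2 : ℤ) * a := by exact_mod_cast ha
  have hb' : (2 : ℤ) = (Nat.gcd m 2 : ℤ) * b := by exact_mod_cast hb
  rw [hm', hb', mul_assoc, mul_dvd_mul_iff_left (by exact_mod_cast hg.ne')]
  have hcop' : IsCoprime (a : ℤ) (b : ℤ) := Nat.isCoprime_iff_coprime.2 hcop
  exact ⟨fun h => hcop'.dvd_of_dvd_mul_left h, fun h => h.mul_left _⟩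

theorem exp_zpow_eq_one_iff {m : ℕ} (hm : 1 ≤ m) (x : ℤ) :
    ((Circle.exp (2 * Real.pi / m) : Circle) : ℂ) ^ (2 * x) = 1 ↔
      ((m / Nat.gcd m 2 : ℕ) : ℤ) ∣ x := by
  have h := Complex.isPrimitiveRoot_exp m (by omega)
  have he : ((Circle.exp (2 * Real.pi / m) : Circle) : ℂ) =
      Complex.exp (2 * Real.pi * Complex.I / m) := by
    rw [Circle.coe_exp]
    congr 1
    push_cast
    ring
  rw [he, h.zpow_eq_one_iff_dvd, dvd_two_mul_iff hm]

theorem mem_commutant_cyclicC {n m : ℕ} (hm : 1 ≤ m)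
    {H : Matrix (Fin (n + 1)) (Fin (n + 1)) ℂ} :
    H ∈ commutant n (cyclicC m : Set (SU 2)) ↔ ∀ i j : Fin (n + 1),
      ¬ ((m / Nat.gcd m 2 : ℕ) : ℤ) ∣ (i : ℤ) - (j : ℤ) → H i j = 0 := by
  rw [cyclicC, Subgroup.zpowers_eq_closure, commutant_closure, mem_commutant]
  simp only [Set.mem_singleton_iff, forall_eq, commute_symPow_diagSU_iff, ne_eq,
    exp_zpow_eq_one_iff hm]

theorem mem_commutant_U1 {n : ℕ} {H : Matrix (Fin (n + 1)) (Fin (n + 1)) ℂ} :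
    H ∈ commutant n (U1 : Set (SU 2)) ↔ ∀ i j, i ≠ j → H i j = 0 := by
  constructor
  · intro h
    -- A finite subgroup of U(1) suffices: modulo n+1, distinct indices between 0 and n are never
    -- congruent.
    have h1 : H ∈ commutant n (cyclicC (2 * (n + 1)) : Set (SU 2)) := by
      intro γ hγ
      refine h γ ?_
      rw [cyclicC, SetLike.mem_coe, ← MonoidHom.map_zpowers] at hγ
      obtain ⟨z, -, rfl⟩ := hγ
      exact ⟨z, rfl⟩
    rw [mem_commutant_cyclicC (by omega)] at h1
    intro i j hij
    refine h1 i j fun hd => hij ?_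
    rw [Nat.gcd_mul_right_left, Nat.mul_div_cancel_left _ two_pos] at hd
    have h2 := Int.eq_zero_of_abs_lt_dvd hd (by
      have := i.2
      have := j.2
      rw [abs_lt]
      push_cast
      omega)
    exact Fin.ext (by omega)
  · rintro h _ ⟨z, rfl⟩
    rw [commute_symPow_diagSU_iff]
    intro i j hne
    refine h i j ?_
    rintro rfl
    simp at hne

/-- The symmetric power of an antidiagonal matrix reverses the indices with weights β. The identity
c = (-c̄)(-c²) shows that the ratio of β i to β j is (-c²)^(i-j). -/
theorem commute_symPow_antidiagSU_iff {n : ℕ} {H : Matrix (Fin (n + 1)) (Fin (n + 1)) ℂ}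
    {c : Circle} : Commute H (symPow n (antidiagSU c).1) ↔ ∀ i j : Fin (n + 1),
      H i j = (-(c : ℂ) ^ 2) ^ ((i : ℤ) - (j : ℤ)) * H i.rev j.rev := by
  have hc0 : (c : ℂ) ≠ 0 := Circle.coe_ne_zero c
  have hcc : conj (c : ℂ) * c = 1 := by rw [mul_comm, Circle_mul_conj]
  set β : Fin (n + 1) → ℂ := fun i => (-conj (c : ℂ)) ^ (n - (i : ℕ)) * (c : ℂ) ^ (i : ℕ) with hβ
  have hsym : symPow n (antidiagSU c).1 =
      Matrix.of fun i j : Fin (n + 1) => if j = i.rev then β i else 0 :=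
    symPow_antidiag n (-conj (c : ℂ)) c
  have hβ' : ∀ i, β i = (-conj (c : ℂ)) ^ n * (-(c : ℂ) ^ 2) ^ (i : ℕ) := by
    intro i
    have hi : (i : ℕ) ≤ n := Nat.lt_succ_iff.1 i.2
    have h1 : (c : ℂ) = -conj (c : ℂ) * -(c : ℂ) ^ 2 := by linear_combination (-(c : ℂ)) * hcc
    have h2 : (-conj (c : ℂ)) ^ n = (-conj (c : ℂ)) ^ (n - (i : ℕ)) * (-conj (c : ℂ)) ^ (i : ℕ) := by
      rw [← pow_add, Nat.sub_add_cancel hi]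
    rw [hβ, h2, mul_assoc, ← mul_pow, ← h1]
  have hq : (-(c : ℂ) ^ 2) ≠ 0 := neg_ne_zero.2 (pow_ne_zero _ hc0)
  have hβ0 : ∀ i, β i ≠ 0 := fun i => by
    rw [hβ']
    exact mul_ne_zero (pow_ne_zero _ (neg_ne_zero.2 (left_ne_zero_of_mul_eq_one hcc)))
      (pow_ne_zero _ hq)
  have hrat : ∀ i j : Fin (n + 1), β i = (-(c : ℂ) ^ 2) ^ ((i : ℤ) - (j : ℤ)) * β j := by
    intro i j
    rw [hβ', hβ', zpow_sub₀ hq, zpow_natCast, zpow_natCast]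
    field_simp
  have hL : ∀ i j : Fin (n + 1), (H * symPow n (antidiagSU c).1) i j.rev = H i j * β j := by
    intro i j
    rw [hsym, Matrix.mul_apply, Finset.sum_eq_single j]
    · simp
    · intro l _ hl
      rw [Matrix.of_apply, if_neg fun h => hl (Fin.rev_injective h).symm, mul_zero]
    · simp
  have hR : ∀ i j : Fin (n + 1), (symPow n (antidiagSU c).1 * H) i j.rev = β i * H i.rev j.rev := by
    intro i j
    rw [hsym, Matrix.mul_apply, Finset.sum_eq_single i.rev]
    · simp
    · intro l _ hl
      rw [Matrix.of_apply, if_neg hl, zero_mul]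
    · simp
  constructor
  · intro h i j
    have h1 := congrFun (congrFun (show H * symPow n (antidiagSU c).1 = _ from h) i) j.rev
    rw [hL, hR, hrat i j] at h1
    refine mul_right_cancel₀ (hβ0 j) ?_
    rw [h1]
    ring
  · intro h
    change H * symPow n (antidiagSU c).1 = _
    ext i j
    rw [← Fin.rev_rev j, hL, hR, h i j.rev, hrat i j.rev]
    ring

theorem commutant_union (n : ℕ) (s t : Set (SU 2)) {H : Matrix (Fin (n + 1)) (Fin (n + 1)) ℂ} :
    H ∈ commutant n (s ∪ t) ↔ H ∈ commutant n s ∧ H ∈ commutant n t := by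
  simp only [mem_commutant, Set.mem_union, or_imp, forall_and]

theorem mem_commutant_singleton {n : ℕ} {γ : SU 2} {H : Matrix (Fin (n + 1)) (Fin (n + 1)) ℂ} :
    H ∈ commutant n {γ} ↔ Commute H (symPow n γ.1) := by
  simp [mem_commutant]

theorem mem_commutant_dihedralD {n k : ℕ} (hk : 1 ≤ k) {c : Circle}
    {H : Matrix (Fin (n + 1)) (Fin (n + 1)) ℂ} :
    H ∈ commutant n (dihedralD k c : Set (SU 2)) ↔
      (∀ i j : Fin (n + 1), ¬ (k : ℤ) ∣ (i : ℤ) - (j : ℤ) → H i j = 0) ∧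
      ∀ i j : Fin (n + 1), H i j = (-(c : ℂ) ^ 2) ^ ((i : ℤ) - (j : ℤ)) * H i.rev j.rev := by
  rw [dihedralD, commutant_closure, commutant_union, mem_commutant_singleton,
    mem_commutant_cyclicC (by omega), commute_symPow_antidiagSU_iff, Nat.gcd_mul_right_left,
    Nat.mul_div_cancel_left _ two_pos]

theorem mem_commutant_O2 {n : ℕ} {H : Matrix (Fin (n + 1)) (Fin (n + 1)) ℂ} :
    H ∈ commutant n (O2 : Set (SU 2)) ↔ (∀ i j, i ≠ j → H i j = 0) ∧
      ∀ i, H i i = H i.rev i.rev := by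
  rw [O2, commutant_closure, commutant_union, mem_commutant_singleton, mem_commutant_U1,
    commute_symPow_antidiagSU_iff]
  refine and_congr_right fun h => ⟨fun h1 i => by simpa using h1 i i, fun h1 i j => ?_⟩
  by_cases hij : i = j
  · subst hij
    simpa using h1 i
  · rw [h i j hij, h _ _ (Fin.rev_injective.ne hij), mul_zero]

theorem finrank_commutant_cyclicC (n : ℕ) {m : ℕ} (hm : 1 ≤ m) :
    (Module.finrank ℂ (commutant n (cyclicC m : Set (SU 2))) : ℤ) =
      pairCount (m / Nat.gcd m 2) n := by
  have h := finrank_pattern (W := commutant n (cyclicC m : Set (SU 2))) _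
    fun H => mem_commutant_cyclicC hm
  have h2 := pairCount_eq_sum (m / Nat.gcd m 2) n
  have h3 : ((Module.finrank ℂ (commutant n (cyclicC m : Set (SU 2))) : ℤ) : ℂ) =
      ((pairCount (m / Nat.gcd m 2) n : ℤ) : ℂ) := by
    rw [h2, Int.cast_natCast, h]
  exact_mod_cast h3

theorem neg_sq_zpow_mul_rev (c : Circle) {n : ℕ} (i j : Fin (n + 1)) :
    (-(c : ℂ) ^ 2) ^ ((i : ℤ) - (j : ℤ)) *
      (-(c : ℂ) ^ 2) ^ ((i.rev : ℤ) - (j.rev : ℤ)) = 1 := by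
  have hq : (-(c : ℂ) ^ 2) ≠ 0 := neg_ne_zero.2 (pow_ne_zero _ (Circle.coe_ne_zero c))
  rw [← zpow_add₀ hq]
  have : ((i : ℤ) - (j : ℤ)) + ((i.rev : ℤ) - (j.rev : ℤ)) = 0 := by
    rw [Fin.val_rev, Fin.val_rev]
    omega
  rw [this, zpow_zero]

theorem finrank_commutant_dihedralD (n : ℕ) {k : ℕ} (hk : 1 ≤ k) (c : Circle) :
    2 * (Module.finrank ℂ (commutant n (dihedralD k c : Set (SU 2))) : ℤ) =
      pairCount k n + if Even n then 1 else 0 := by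
  have h := finrank_rev_pattern (W := commutant n (dihedralD k c : Set (SU 2)))
    (fun i j => (k : ℤ) ∣ (i : ℤ) - (j : ℤ)) (fun i j hij => by
      have : ((i.rev : ℕ) : ℤ) - (j.rev : ℕ) = -((i : ℤ) - j) := by
        rw [Fin.val_rev, Fin.val_rev]
        omega
      rwa [this, dvd_neg]) (fun i => by simp)
    (fun i j => (-(c : ℂ) ^ 2) ^ ((i : ℤ) - (j : ℤ))) (neg_sq_zpow_mul_rev c) (fun i => by simp)
    fun H => mem_commutant_dihedralD hk
  have h2 := pairCount_eq_sum k n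
  have h3 : ((2 * (Module.finrank ℂ (commutant n (dihedralD k c : Set (SU 2))) : ℤ) : ℤ) : ℂ) =
      ((pairCount k n + if Even n then 1 else 0 : ℤ) : ℂ) := by
    push_cast
    rw [h2, h, mul_div_cancel₀ _ two_ne_zero]
  exact_mod_cast h3

theorem finrank_commutant_U1 (n : ℕ) :
    Module.finrank ℂ (commutant n (U1 : Set (SU 2))) = n + 1 := by
  have h := finrank_pattern (W := commutant n (U1 : Set (SU 2))) (fun i j => i = j)
    fun H => mem_commutant_U1
  simp only [Finset.sum_ite_eq, Finset.mem_univ, if_true, Finset.sum_const, Finset.card_univ,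
    Fintype.card_fin, nsmul_eq_mul, mul_one] at h
  exact_mod_cast h

theorem finrank_commutant_O2 (n : ℕ) :
    Module.finrank ℂ (commutant n (O2 : Set (SU 2))) = n / 2 + 1 := by
  have h := finrank_rev_pattern (W := commutant n (O2 : Set (SU 2))) (fun i j => i = j)
    (fun i j h => by rw [h]) (fun _ => rfl) (fun _ _ => 1) (fun _ _ => one_mul 1) (fun _ => rfl)
    fun H => by
      rw [mem_commutant_O2]
      refine and_congr_right fun h => ⟨fun h1 i j => ?_, fun h1 i => by simpa using h1 i i⟩
      by_cases hij : i = j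
      · subst hij
        simpa using h1 i
      · rw [h i j hij, h _ _ (Fin.rev_injective.ne hij), mul_zero]
  simp only [Finset.sum_ite_eq, Finset.mem_univ, if_true, Finset.sum_const, Finset.card_univ,
    Fintype.card_fin, nsmul_eq_mul, mul_one] at h
  have h2 : 2 * Module.finrank ℂ (commutant n (O2 : Set (SU 2))) =
      n + 1 + if Even n then 1 else 0 := by
    have h3 : ((2 * Module.finrank ℂ (commutant n (O2 : Set (SU 2))) : ℕ) : ℂ) =
        ((n + 1 + if Even n then 1 else 0 : ℕ) : ℂ) := by
      push_cast
      rw [h]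
      push_cast
      ring
    exact_mod_cast h3
  rcases Nat.even_or_odd n with he | ho
  · rw [if_pos he] at h2
    obtain ⟨m, hm⟩ := he
    omega
  · rw [if_neg (Nat.not_even_iff_odd.2 ho)] at h2
    obtain ⟨m, hm⟩ := ho
    omega

/-! ## Triangular matrices whose Gram matrix lies in a commutant -/

/-- Conjugation by a diagonal unitary matrix preserves triangularity and the positive diagonal. If
it fixes the Gram matrix, uniqueness of the Cholesky factor makes it fix A. This is special to
diagonal elements, which is why the dihedral conditions stay quadratic in A. -/
theorem commute_gram_diagSU_iff {n : ℕ} {A : Matrix (Fin (n + 1)) (Fin (n + 1)) ℂ}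
    (hA : IsUpperPos A) (z : Circle) :
    Commute (Aᴴ * A) (symPow n (diagSU z).1) ↔ Commute A (symPow n (diagSU z).1) := by
  have hρ := symPow_SU_conjTranspose_mul_self n (diagSU z)
  have hρ' : symPow n (diagSU z).1 * (symPow n (diagSU z).1)ᴴ = 1 := mul_eq_one_comm.1 hρ
  constructor
  · intro h
    rw [← conj_unitary_iff_commute hρ] at h ⊢
    refine (IsUpperPos.eq_of_gram_eq hA ?_ ?_).symm
    · rw [symPow_diagSU] at hρ ⊢
      rw [Matrix.diagonal_conjTranspose, Matrix.diagonal_mul_diagonal] at hρ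
      rw [Matrix.diagonal_conjTranspose]
      refine ⟨fun i j hij => ?_, fun i => ?_⟩
      · rw [Matrix.mul_diagonal, Matrix.diagonal_mul, hA.1 i j hij, mul_zero, zero_mul]
      · obtain ⟨r, hr, e⟩ := hA.2 i
        refine ⟨r, hr, ?_⟩
        have h1 := congrFun (congrFun hρ i) i
        rw [Matrix.diagonal_apply_eq, Matrix.one_apply_eq] at h1
        rw [Matrix.mul_diagonal, Matrix.diagonal_mul, e, mul_right_comm, h1, one_mul]
    · calc Aᴴ * A = (symPow n (diagSU z).1)ᴴ * (Aᴴ * A) * symPow n (diagSU z).1 := h.symm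
        _ = (symPow n (diagSU z).1)ᴴ * Aᴴ * (symPow n (diagSU z).1 * (symPow n (diagSU z).1)ᴴ) *
            A * symPow n (diagSU z).1 := by
          rw [hρ', Matrix.mul_one]
          simp only [Matrix.mul_assoc]
        _ = _ := by
          rw [Matrix.conjTranspose_mul, Matrix.conjTranspose_mul,
            Matrix.conjTranspose_conjTranspose]
          simp only [Matrix.mul_assoc]
  · intro h
    have h1 : A ∈ commutant n {diagSU z} := mem_commutant_singleton.2 h
    have h2 := mem_commutant_singleton.1 (conjTranspose_mem_commutant h1)
    exact h2.mul_left h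

theorem gram_mem_commutant_iff {n : ℕ} {A : Matrix (Fin (n + 1)) (Fin (n + 1)) ℂ}
    (hA : IsUpperPos A) {G : Subgroup (SU 2)} (hG : G ≤ U1) :
    Aᴴ * A ∈ commutant n (G : Set (SU 2)) ↔ A ∈ commutant n (G : Set (SU 2)) := by
  refine forall_congr' fun γ => forall_congr' fun hγ => ?_
  obtain ⟨z, rfl⟩ := hG hγ
  exact commute_gram_diagSU_iff hA z

theorem cyclicC_le_U1 (m : ℕ) : cyclicC m ≤ U1 := by
  rw [cyclicC, Subgroup.zpowers_le]
  exact ⟨_, rfl⟩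

theorem gram_mem_commutant_O2_iff {n : ℕ} {A : Matrix (Fin (n + 1)) (Fin (n + 1)) ℂ}
    (hA : IsUpperPos A) : Aᴴ * A ∈ commutant n (O2 : Set (SU 2)) ↔
      (∀ i j, i ≠ j → A i j = 0) ∧ ∀ i : Fin (n + 1), A i i = A i.rev i.rev := by
  rw [mem_commutant_O2, ← mem_commutant_U1, gram_mem_commutant_iff hA le_rfl, mem_commutant_U1]
  refine and_congr_right fun hd => forall_congr' fun i => ?_
  have hg : ∀ i, (Aᴴ * A) i i = (((A i i).re ^ 2 : ℝ) : ℂ) := by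
    intro i
    rw [Matrix.mul_apply, Finset.sum_eq_single i, Matrix.conjTranspose_apply, hA.diag_eq i]
    · simp [sq]
    · intro l _ hl
      rw [hd l i hl, mul_zero]
    · simp
  rw [hg, hg, Complex.ofReal_inj, hA.diag_eq i, hA.diag_eq i.rev, Complex.ofReal_inj]
  exact pow_left_inj₀ (hA.diag_re_pos i).le (hA.diag_re_pos _).le two_ne_zero

/-- The symmetric powers of `SU(2)` are irreducible. -/
theorem exists_scalar_of_mem_commutant_univ {n : ℕ} {H : Matrix (Fin (n + 1)) (Fin (n + 1)) ℂ}
    (hH : H ∈ commutant n Set.univ) : H = H 0 0 • 1 := by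
  have hd : ∀ i j, i ≠ j → H i j = 0 := mem_commutant_U1.1 fun γ _ => hH γ (Set.mem_univ γ)
  -- The top row of `genT` has two nonzero entries, so the top row of its symmetric power has no
  -- zero. Comparing entries (0, j) in the commutation relation equates the diagonal entries of H.
  have hj : ∀ j, H j j = H 0 0 := by
    intro j
    have h1 := congrFun (congrFun (show H * symPow n genT.1 = _ from hH genT (Set.mem_univ _)) 0) j
    rw [Matrix.mul_apply, Matrix.mul_apply, Finset.sum_eq_single 0, Finset.sum_eq_single j] at h1
    · have hI : (1 + Complex.I) / 2 ≠ 0 := by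
        intro h
        have := congrArg Complex.re h
        norm_num at this
      have hne : symPow n genT.1 0 j ≠ 0 := by
        rw [symPow_zero_apply]
        refine mul_ne_zero (div_ne_zero (rnCoeff_ne_zero _ _) (rnCoeff_ne_zero _ _)) ?_
        refine mul_ne_zero (mul_ne_zero (pow_ne_zero _ hI) (pow_ne_zero _ hI)) ?_
        exact_mod_cast (Nat.choose_pos (Nat.lt_succ_iff.1 j.2)).ne'
      exact mul_left_cancel₀ hne (by rw [← h1, mul_comm])
    · intro l _ hl
      rw [hd l j hl, mul_zero]
    · simp
    · intro l _ hl
      rw [hd 0 l hl.symm, zero_mul]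
    · simp
  ext i j
  by_cases hij : i = j
  · subst hij
    simp [hj i]
  · rw [hd i j hij, Matrix.smul_apply, Matrix.one_apply_ne hij, smul_zero]

open scoped ComplexOrder in
theorem eq_one_of_gram_mem_commutant_univ {n : ℕ} {A : SLC (n + 1)} (hA : A ∈ upperPos n)
    (h : A.1ᴴ * A.1 ∈ commutant n Set.univ) : A = 1 := by
  have h1 := exists_scalar_of_mem_commutant_univ h
  have hp := Complex.pos_iff.1 ((posDef_gram A).diag_pos (i := 0))
  have hone : IsUpperPos (1 : SLC (n + 1)).1 :=
    ⟨fun i j hij => Matrix.one_apply_ne hij.ne', fun i => ⟨1, one_pos, by simp⟩⟩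
  refine eq_of_gram_eq_smul (Nat.succ_ne_zero n) hA hone hp.1 ?_
  have : (((A.1ᴴ * A.1) 0 0).re : ℂ) = (A.1ᴴ * A.1) 0 0 :=
    Complex.ext rfl (by simpa using hp.2)
  rw [this]
  simpa using h1

/-! ## Averaging over a finite group, given by representatives modulo sign -/

/-- Conjugation `H ↦ ρ H ρᴴ`. -/
def conjLin {N : ℕ} (ρ : Matrix (Fin N) (Fin N) ℂ) :
    Matrix (Fin N) (Fin N) ℂ →ₗ[ℂ] Matrix (Fin N) (Fin N) ℂ where
  toFun H := ρ * H * ρᴴ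
  map_add' H K := by rw [Matrix.mul_add, Matrix.add_mul]
  map_smul' c H := by rw [Matrix.mul_smul, Matrix.smul_mul, RingHom.id_apply]

theorem conjLin_apply {N : ℕ} (ρ H : Matrix (Fin N) (Fin N) ℂ) : conjLin ρ H = ρ * H * ρᴴ := rfl

/-- The trace of conjugation by ρ is the squared modulus of the character. -/
theorem sum_conjLin_single {N : ℕ} (ρ : Matrix (Fin N) (Fin N) ℂ) :
    ∑ i, ∑ j, conjLin ρ (Matrix.single i j 1) i j = ρ.trace * conj ρ.trace := by
  have h : ∀ i j, conjLin ρ (Matrix.single i j 1) i j = ρ i i * conj (ρ j j) := by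
    intro i j
    rw [conjLin_apply, Matrix.mul_apply, Finset.sum_eq_single j]
    · rw [Matrix.mul_single_apply_same, mul_one, Matrix.conjTranspose_apply]
      rfl
    · intro l _ hl
      rw [Matrix.mul_single_apply_of_ne _ _ _ _ _ hl, zero_mul]
    · simp
  simp only [h, Matrix.trace, Matrix.diag_apply, map_sum, Finset.sum_mul_sum]

theorem conjLin_smul_of_sign {N : ℕ} {ρ : Matrix (Fin N) (Fin N) ℂ} {c : ℂ} (hc : c * conj c = 1) :
    conjLin (c • ρ) = conjLin ρ := by
  ext1 H
  rw [conjLin_apply, conjLin_apply, Matrix.conjTranspose_smul, Matrix.smul_mul, Matrix.smul_mul,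
    Matrix.mul_smul, smul_smul, Complex.star_def, hc, one_smul]

theorem conjLin_mul {N : ℕ} (ρ τ H : Matrix (Fin N) (Fin N) ℂ) :
    conjLin (ρ * τ) H = conjLin ρ (conjLin τ H) := by
  simp only [conjLin_apply, Matrix.conjTranspose_mul, Matrix.mul_assoc]

theorem conjLin_eq_self_iff {N : ℕ} {ρ H : Matrix (Fin N) (Fin N) ℂ} (hρ : ρᴴ * ρ = 1) :
    conjLin ρ H = H ↔ Commute H ρ := by
  have hρ' : ρ * ρᴴ = 1 := mul_eq_one_comm.1 hρ
  constructor
  · intro h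
    change H * ρ = ρ * H
    nth_rw 1 [← h]
    rw [conjLin_apply, Matrix.mul_assoc, hρ, Matrix.mul_one]
  · intro h
    rw [conjLin_apply, ← show H * ρ = ρ * H from h, Matrix.mul_assoc, hρ', Matrix.mul_one]

/-- The dimension of the commutant of a finite group is the mean square of the character. The
group is given by representatives `L i` modulo sign, obtained from `1` through left multiplication
by the generators, which permute these representatives up to sign. -/
theorem finrank_commutant_of_representatives {m n : ℕ} [NeZero m] {s : Set (SU 2)}
    (L : Fin m → Matrix (Fin 2) (Fin 2) ℂ) (h0 : L 0 = 1)
    (hperm : ∀ g ∈ s, ∃ σ : Fin m → Fin m, Function.Injective σ ∧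
      ∀ i, g.1 * L i = L (σ i) ∨ g.1 * L i = -L (σ i))
    (hgen : ∀ i, i ≠ 0 → ∃ j < i, ∃ g ∈ s, g.1 * L j = L i ∨ g.1 * L j = -L i) :
    (Module.finrank ℂ (commutant n s) : ℂ) * m =
      ∑ i, (symPow n (L i)).trace * conj (symPow n (L i)).trace := by
  have hm : (m : ℂ) ≠ 0 := by exact_mod_cast NeZero.ne m
  have hsign : ∀ M : Matrix (Fin 2) (Fin 2) ℂ, conjLin (symPow n (-M)) = conjLin (symPow n M) := by
    intro M
    rw [← neg_one_smul ℂ M, symPow_smul]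
    refine conjLin_smul_of_sign ?_
    rw [map_pow, ← mul_pow]
    simp
  -- Each representative is a generator times an earlier one up to sign, and conjugation does not
  -- see the sign, so fixedness propagates by induction from 1.
  have hLfix : ∀ H ∈ commutant n s, ∀ i, conjLin (symPow n (L i)) H = H := by
    intro H hH i
    induction i using WellFoundedLT.induction with
    | _ i ih =>
    by_cases hi : i = 0
    · rw [hi, h0, symPow_one, conjLin_apply]
      simp
    · obtain ⟨j, hj, g, hg, hgL⟩ := hgen i hi
      have h1 : conjLin (symPow n (g.1 * L j)) H = H := by
        rw [symPow_mul, conjLin_mul, ih j hj,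
          conjLin_eq_self_iff (symPow_SU_conjTranspose_mul_self n g)]
        exact hH g hg
      rcases hgL with h | h
      · rwa [h] at h1
      · rwa [h, hsign] at h1
  let P : Matrix (Fin (n + 1)) (Fin (n + 1)) ℂ →ₗ[ℂ] Matrix (Fin (n + 1)) (Fin (n + 1)) ℂ :=
    (m : ℂ)⁻¹ • ∑ i, conjLin (symPow n (L i))
  have hPa : ∀ H, P H = (m : ℂ)⁻¹ • ∑ i, conjLin (symPow n (L i)) H := by
    intro H
    rw [LinearMap.smul_apply, LinearMap.sum_apply]
  -- A generator permutes the representatives up to sign, so the average is invariant; on the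
  -- commutant every summand is the identity.
  have hP : LinearMap.IsProj (commutant n s) P := by
    refine ⟨fun H g hg => ?_, fun H hH => ?_⟩
    · obtain ⟨σ, hσ, hσL⟩ := hperm g hg
      have h1 : ∀ i, conjLin (symPow n g.1) (conjLin (symPow n (L i)) H) =
          conjLin (symPow n (L (σ i))) H := by
        intro i
        rw [← conjLin_mul, ← symPow_mul]
        rcases hσL i with h | h
        · rw [h]
        · rw [h, hsign]
      have h2 : ∑ i, conjLin (symPow n (L (σ i))) H = ∑ i, conjLin (symPow n (L i)) H :=
        (Equiv.ofBijective σ (Finite.injective_iff_bijective.1 hσ)).sum_comp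
          fun i => conjLin (symPow n (L i)) H
      refine (conjLin_eq_self_iff (symPow_SU_conjTranspose_mul_self n g)).1 ?_
      rw [hPa, LinearMap.map_smul, map_sum, Finset.sum_congr rfl fun i _ => h1 i, h2]
    · rw [hPa, Finset.sum_congr rfl fun i _ => hLfix H hH i, Finset.sum_const, Finset.card_univ,
        Fintype.card_fin, ← Nat.cast_smul_eq_nsmul ℂ, smul_smul, inv_mul_cancel₀ hm, one_smul]
  rw [finrank_eq_of_isProj hP]
  simp only [hPa, Matrix.smul_apply, Matrix.sum_apply, smul_eq_mul, ← Finset.mul_sum]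
  rw [mul_comm, mul_inv_cancel_left₀ hm, Finset.sum_congr rfl fun i _ => Finset.sum_comm,
    Finset.sum_comm]
  exact Finset.sum_congr rfl fun i _ => sum_conjLin_single _

/-! ## Values of the characters -/

/-- The character of the `n`-th symmetric power, as a function of the trace. -/
def symTrace (n : ℕ) (t : ℂ) : ℂ := (symPow n !![t, -1; 1, 0]).trace

theorem symTrace_eq_sum (n : ℕ) {t a d : ℂ} (ht : t = a + d) (had : a * d = 1) :
    symTrace n t = ∑ i : Fin (n + 1), a ^ (n - (i : ℕ)) * d ^ (i : ℕ) :=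
  trace_symPow n _ a d (by simp [Matrix.trace_fin_two, ht]) (by simp [Matrix.det_fin_two, had])

theorem trace_symPow_eq_symTrace (n : ℕ) {g : Matrix (Fin 2) (Fin 2) ℂ} (hg : g.det = 1) :
    (symPow n g).trace = symTrace n g.trace := by
  obtain ⟨w, hw⟩ := IsAlgClosed.exists_pow_nat_eq (g.trace ^ 2 - 4) two_pos
  have h1 : g.trace = (g.trace + w) / 2 + (g.trace - w) / 2 := by ring
  have h2 : (g.trace + w) / 2 * ((g.trace - w) / 2) = 1 := by linear_combination (-1 / 4 : ℂ) * hw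
  rw [trace_symPow n g _ _ h1 (hg.trans h2.symm), symTrace_eq_sum n h1 h2]

theorem symTrace_two (n : ℕ) : symTrace n 2 = n + 1 := by
  rw [symTrace_eq_sum n (a := 1) (d := 1) (by norm_num) (by norm_num)]
  simp

/-- With eigenvalues exp(±ix) the geometric sum is sin((n+1)x) / sin x, and the addition formula
puts it in the form of the constants c₁, b, c₂, c₃ of the theorem. -/
theorem symTrace_two_cos (n : ℕ) {x : ℝ} (hx : Real.sin x ≠ 0) :
    symTrace n (2 * Real.cos x : ℝ) =
      ((Real.cos (n * x) + Real.cos x / Real.sin x * Real.sin (n * x) : ℝ) : ℂ) := by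
  have hs : Complex.sin x ≠ 0 := by
    rw [← Complex.ofReal_sin]
    exact_mod_cast hx
  set a := Complex.exp (x * Complex.I) with ha
  set d := Complex.exp (-x * Complex.I) with hd
  have had : a * d = 1 := by
    rw [ha, hd, ← Complex.exp_add]
    simp
  have hsum : ((2 * Real.cos x : ℝ) : ℂ) = a + d := by
    push_cast
    rw [Complex.two_cos]
  have hdiff : a - d = 2 * Complex.I * Complex.sin x := by
    rw [Complex.sin]
    linear_combination (-(d - a)) * Complex.I_sq
  have hpow : a ^ (n + 1) - d ^ (n + 1) = 2 * Complex.I * Complex.sin ((n + 1) * x) := by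
    rw [ha, hd, ← Complex.exp_nat_mul, ← Complex.exp_nat_mul, Complex.sin]
    have e1 : ((n + 1 : ℕ) : ℂ) * (x * Complex.I) = (n + 1) * x * Complex.I := by push_cast; ring
    have e2 : ((n + 1 : ℕ) : ℂ) * (-x * Complex.I) = -((n + 1) * x) * Complex.I := by
      push_cast; ring
    rw [e1, e2]
    linear_combination (-(Complex.exp (-((n + 1) * x) * Complex.I) -
      Complex.exp ((n + 1) * x * Complex.I))) * Complex.I_sq
  have hgeom : symTrace n (2 * Real.cos x : ℝ) * (a - d) = a ^ (n + 1) - d ^ (n + 1) := by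
    rw [symTrace_eq_sum n hsum had, Fin.sum_univ_eq_sum_range (fun i => a ^ (n - i) * d ^ i),
      ← Finset.sum_range_reflect, ← (Commute.all a d).geom_sum₂_mul]
    congr 1
    refine Finset.sum_congr rfl fun i hi => ?_
    have := Finset.mem_range.1 hi
    congr 2
    omega
  rw [hpow, hdiff, add_mul, one_mul, Complex.sin_add] at hgeom
  push_cast at hgeom ⊢
  refine mul_right_cancel₀ (mul_ne_zero (mul_ne_zero two_ne_zero Complex.I_ne_zero) hs) ?_
  rw [hgeom]
  field_simp
  ring

/-! ## Integral quaternions -/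

/-- Quaternions `(a + b i + c j + d k) / 2` whose coordinates `a, b, c, d` are integral combinations
of `1` and of a quadratic integer. -/
abbrev IntQuat := (ℤ × ℤ) × (ℤ × ℤ) × (ℤ × ℤ) × (ℤ × ℤ)

/-- Multiplication in `ℤ[θ]`, for `θ ^ 2 = p + q θ`. -/
def quadMul (p q : ℤ) (a b : ℤ × ℤ) : ℤ × ℤ :=
  (a.1 * b.1 + p * (a.2 * b.2), a.1 * b.2 + a.2 * b.1 + q * (a.2 * b.2))

/-- Twice the product of two quaternions with coordinates in `ℤ[θ] / 2`. -/
def quatMul (p q : ℤ) (x y : IntQuat) : IntQuat :=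
  (quadMul p q x.1 y.1 - quadMul p q x.2.1 y.2.1 - quadMul p q x.2.2.1 y.2.2.1 -
      quadMul p q x.2.2.2 y.2.2.2,
    quadMul p q x.1 y.2.1 + quadMul p q x.2.1 y.1 + quadMul p q x.2.2.1 y.2.2.2 -
      quadMul p q x.2.2.2 y.2.2.1,
    quadMul p q x.1 y.2.2.1 - quadMul p q x.2.1 y.2.2.2 + quadMul p q x.2.2.1 y.1 +
      quadMul p q x.2.2.2 y.2.1,
    quadMul p q x.1 y.2.2.2 + quadMul p q x.2.1 y.2.2.1 - quadMul p q x.2.2.1 y.2.1 +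
      quadMul p q x.2.2.2 y.1)

/-- The value of an element of `ℤ[θ]`. -/
def quadVal (θ : ℝ) (a : ℤ × ℤ) : ℝ := a.1 + a.2 * θ

theorem quadVal_add (θ : ℝ) (a b : ℤ × ℤ) : quadVal θ (a + b) = quadVal θ a + quadVal θ b := by
  simp only [quadVal, Prod.fst_add, Prod.snd_add]
  push_cast
  ring

theorem quadVal_sub (θ : ℝ) (a b : ℤ × ℤ) : quadVal θ (a - b) = quadVal θ a - quadVal θ b := by
  simp only [quadVal, Prod.fst_sub, Prod.snd_sub]
  push_cast
  ring

theorem quadVal_neg (θ : ℝ) (a : ℤ × ℤ) : quadVal θ (-a) = -quadVal θ a := by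
  simp only [quadVal, Prod.fst_neg, Prod.snd_neg]
  push_cast
  ring

theorem quadVal_mul {θ : ℝ} {p q : ℤ} (hθ : θ ^ 2 = p + q * θ) (a b : ℤ × ℤ) :
    quadVal θ (quadMul p q a b) = quadVal θ a * quadVal θ b := by
  simp only [quadVal, quadMul]
  push_cast
  linear_combination (-(a.2 : ℝ) * b.2) * hθ

/-- The complex matrix of a quaternion. -/
def quatMat (θ : ℝ) (x : IntQuat) : Matrix (Fin 2) (Fin 2) ℂ :=
  !![((quadVal θ x.1 : ℂ) + quadVal θ x.2.1 * Complex.I) / 2,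
      ((quadVal θ x.2.2.1 : ℂ) + quadVal θ x.2.2.2 * Complex.I) / 2;
    (-(quadVal θ x.2.2.1 : ℂ) + quadVal θ x.2.2.2 * Complex.I) / 2,
      ((quadVal θ x.1 : ℂ) - quadVal θ x.2.1 * Complex.I) / 2]

/-- The stored coordinates are twice the true ones, so the integral product is twice the coordinates
of the true product. This is why the table relations involve x + x. -/
theorem quatMat_mul {θ : ℝ} {p q : ℤ} (hθ : θ ^ 2 = p + q * θ) (x y : IntQuat) :
    quatMat θ x * quatMat θ y = (1 / 2 : ℂ) • quatMat θ (quatMul p q x y) := by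
  simp only [quatMat, quatMul, quadVal_add, quadVal_sub, quadVal_mul hθ]
  ext i j
  fin_cases i <;> fin_cases j <;>
    simp [Matrix.mul_apply, Fin.sum_univ_two] <;> ring_nf <;> simp only [Complex.I_sq] <;> ring

theorem quatMat_neg (θ : ℝ) (x : IntQuat) : quatMat θ (-x) = -quatMat θ x := by
  obtain ⟨a, b, c, d⟩ := x
  simp only [quatMat, Prod.fst_neg, Prod.snd_neg, quadVal_neg]
  ext i j
  fin_cases i <;> fin_cases j <;> simp <;> ring

theorem quatMat_add_self (θ : ℝ) (x : IntQuat) :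
    quatMat θ (x + x) = (2 : ℂ) • quatMat θ x := by
  obtain ⟨a, b, c, d⟩ := x
  simp only [quatMat, Prod.fst_add, Prod.snd_add, quadVal_add]
  ext i j
  fin_cases i <;> fin_cases j <;> simp <;> ring

theorem trace_quatMat (θ : ℝ) (x : IntQuat) : (quatMat θ x).trace = quadVal θ x.1 := by
  rw [quatMat, Matrix.trace_fin_two_of]
  ring

theorem quatMat_one (θ : ℝ) : quatMat θ ((2, 0), (0, 0), (0, 0), (0, 0)) = 1 := by
  ext i j
  fin_cases i <;> fin_cases j <;> simp [quatMat, quadVal]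

/-- The commutant of a group generated by two integral quaternions, from a list `x` of its elements
modulo sign. -/
theorem finrank_commutant_of_table {m : ℕ} [NeZero m] (n : ℕ) {θ : ℝ} {p q : ℤ}
    (hθ : θ ^ 2 = p + q * θ) {g₁ g₂ : SU 2} {r₁ r₂ : IntQuat} (hr₁ : g₁.1 = quatMat θ r₁)
    (hr₂ : g₂.1 = quatMat θ r₂) (x : Fin m → IntQuat) (σ₁ σ₂ : Fin m → Fin m)
    (h0 : x 0 = ((2, 0), (0, 0), (0, 0), (0, 0)))
    (h₁ : ∀ i, quatMul p q r₁ (x i) = x (σ₁ i) + x (σ₁ i) ∨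
      quatMul p q r₁ (x i) = -(x (σ₁ i) + x (σ₁ i)))
    (h₂ : ∀ i, quatMul p q r₂ (x i) = x (σ₂ i) + x (σ₂ i) ∨
      quatMul p q r₂ (x i) = -(x (σ₂ i) + x (σ₂ i)))
    (hσ₁ : Function.Injective σ₁) (hσ₂ : Function.Injective σ₂)
    (hgen : ∀ i, i ≠ 0 → ∃ j < i, σ₁ j = i ∨ σ₂ j = i) :
    (Module.finrank ℂ (commutant n (Subgroup.closure {g₁, g₂} : Set (SU 2))) : ℂ) * m =
      ∑ i, symTrace n (quadVal θ (x i).1) * conj (symTrace n (quadVal θ (x i).1)) := by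
  have hrel : ∀ {g : SU 2} {r y z : IntQuat}, g.1 = quatMat θ r →
      (quatMul p q r y = z + z ∨ quatMul p q r y = -(z + z)) →
      g.1 * quatMat θ y = quatMat θ z ∨ g.1 * quatMat θ y = -quatMat θ z := by
    intro g r y z hg h
    rw [hg, quatMat_mul hθ]
    refine h.imp (fun h => ?_) fun h => ?_
    · rw [h, quatMat_add_self, smul_smul]
      norm_num
    · rw [h, quatMat_neg, quatMat_add_self, smul_neg, smul_smul]
      norm_num
  have hL0 : quatMat θ (x 0) = 1 := by rw [h0, quatMat_one]
  have hLgen : ∀ i, i ≠ 0 → ∃ j < i, ∃ g ∈ ({g₁, g₂} : Set (SU 2)),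
      g.1 * quatMat θ (x j) = quatMat θ (x i) ∨ g.1 * quatMat θ (x j) = -quatMat θ (x i) := by
    intro i hi
    obtain ⟨j, hj, h | h⟩ := hgen i hi
    · exact ⟨j, hj, g₁, by simp, hrel hr₁ (h ▸ h₁ j)⟩
    · exact ⟨j, hj, g₂, by simp, hrel hr₂ (h ▸ h₂ j)⟩
  have hdet : ∀ i, (quatMat θ (x i)).det = 1 := by
    intro i
    induction i using WellFoundedLT.induction with
    | _ i ih =>
    by_cases hi : i = 0
    · rw [hi, hL0, Matrix.det_one]
    · obtain ⟨j, hj, g, -, h⟩ := hLgen i hi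
      have h3 : (g.1 * quatMat θ (x j)).det = 1 := by
        rw [Matrix.det_mul, ih j hj, (Matrix.mem_specialUnitaryGroup_iff.1 g.2).2, one_mul]
      rcases h with h | h
      · rwa [h] at h3
      · rw [h, Matrix.det_neg] at h3
        simpa using h3
  rw [commutant_closure, finrank_commutant_of_representatives (fun i => quatMat θ (x i)) hL0 ?_ hLgen]
  · refine Finset.sum_congr rfl fun i _ => ?_
    rw [trace_symPow_eq_symTrace n (hdet i), trace_quatMat]
  · rintro g (rfl | rfl)
    · exact ⟨σ₁, hσ₁, fun i => hrel hr₁ (h₁ i)⟩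
    · exact ⟨σ₂, hσ₂, fun i => hrel hr₂ (h₂ i)⟩

/-! ## The binary polyhedral groups -/

/-- The elements of the binary tetrahedral group modulo sign, for `θ = 0`. -/
def tetraElems : List IntQuat :=
  [((2, 0), (0, 0), (0, 0), (0, 0)), ((1, 0), (1, 0), (1, 0), (1, 0)), ((0, 0), (0, 0), (0, 0),
   (-2, 0)), ((1, 0), (-1, 0), (-1, 0), (-1, 0)), ((1, 0), (1, 0), (-1, 0), (-1, 0)), ((1, 0),
   (-1, 0), (1, 0), (-1, 0)), ((1, 0), (1, 0), (-1, 0), (1, 0)), ((1, 0), (1, 0), (1, 0), (-1,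
   0)), ((1, 0), (-1, 0), (1, 0), (1, 0)), ((1, 0), (-1, 0), (-1, 0), (1, 0)), ((0, 0), (2, 0),
   (0, 0), (0, 0)), ((0, 0), (0, 0), (2, 0), (0, 0))]

/-- The permutation of `tetraElems` through left multiplication by the first generator. -/
def tetraPerm₁ : List ℕ :=
  [1, 3, 5, 0, 7, 8, 10, 11, 2, 6, 9, 4]

/-- The permutation of `tetraElems` through left multiplication by the second generator. -/
def tetraPerm₂ : List ℕ :=
  [2, 4, 0, 6, 1, 9, 3, 8, 7, 5, 11, 10]

/-- The elements of the binary octahedral group modulo sign, for `θ = √2`. -/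
def octaElems : List IntQuat :=
  [((2, 0), (0, 0), (0, 0), (0, 0)), ((1, 0), (1, 0), (1, 0), (1, 0)), ((0, 0), (0, 0), (0, 1),
   (0, 1)), ((1, 0), (-1, 0), (-1, 0), (-1, 0)), ((0, 1), (0, 0), (0, -1), (0, 0)), ((0, 1), (0,
   0), (0, 0), (0, -1)), ((0, 1), (0, 0), (0, 0), (0, 1)), ((0, 1), (0, 1), (0, 0), (0, 0)),
   ((0, 1), (0, 0), (0, 1), (0, 0)), ((1, 0), (-1, 0), (1, 0), (1, 0)), ((0, 0), (0, 1), (0, 0),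
   (0, 1)), ((0, 0), (0, 1), (0, 1), (0, 0)), ((0, 0), (0, 0), (2, 0), (0, 0)), ((1, 0), (1, 0),
   (-1, 0), (-1, 0)), ((0, 0), (0, 0), (0, 0), (2, 0)), ((0, 1), (0, -1), (0, 0), (0, 0)), ((1,
   0), (-1, 0), (-1, 0), (1, 0)), ((1, 0), (1, 0), (-1, 0), (1, 0)), ((1, 0), (1, 0), (1, 0),
   (-1, 0)), ((1, 0), (-1, 0), (1, 0), (-1, 0)), ((0, 0), (2, 0), (0, 0), (0, 0)), ((0, 0), (0,
   -1), (0, 1), (0, 0)), ((0, 0), (0, -1), (0, 0), (0, 1)), ((0, 0), (0, 0), (0, 1), (0, -1))]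

/-- The permutation of `octaElems` through left multiplication by the first generator. -/
def octaPerm₁ : List ℕ :=
  [1, 3, 5, 0, 7, 8, 10, 11, 2, 14, 15, 4, 13, 18, 19, 6, 17, 20, 12, 9, 16, 22, 23, 21]

/-- The permutation of `octaElems` through left multiplication by the second generator. -/
def octaPerm₂ : List ℕ :=
  [2, 4, 0, 6, 1, 9, 3, 12, 13, 5, 16, 17, 7, 8, 15, 14, 10, 11, 21, 22, 23, 18, 19, 20]

/-- The elements of the binary icosahedral group modulo sign, for `θ` the golden ratio. -/
def icosaElems : List IntQuat :=
  [((2, 0), (0, 0), (0, 0), (0, 0)), ((1, 0), (0, 0), (1, -1), (0, 1)), ((0, 0), (0, 0), (0, 0),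
   (-2, 0)), ((1, 0), (0, 0), (-1, 1), (0, -1)), ((0, 1), (1, -1), (0, 0), (-1, 0)), ((0, 1),
   (-1, 1), (0, 0), (-1, 0)), ((0, 1), (1, -1), (0, 0), (1, 0)), ((0, 1), (0, 0), (-1, 0), (-1,
   1)), ((0, 1), (-1, 1), (0, 0), (1, 0)), ((1, 0), (0, 0), (-1, 1), (0, 1)), ((0, 0), (1, -1),
   (-1, 0), (0, 1)), ((0, 0), (-1, 1), (-1, 0), (0, 1)), ((-1, 1), (-1, 0), (0, 0), (0, -1)),
   ((1, 0), (0, 0), (1, -1), (0, -1)), ((-1, 1), (1, 0), (0, 0), (0, -1)), ((0, 1), (0, 0), (1,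
   0), (1, -1)), ((0, 1), (-1, 0), (-1, 1), (0, 0)), ((0, 1), (-1, 0), (1, -1), (0, 0)), ((0,
   1), (0, 0), (-1, 0), (1, -1)), ((0, 1), (1, 0), (1, -1), (0, 0)), ((0, 1), (1, 0), (-1, 1),
   (0, 0)), ((0, 1), (0, 0), (1, 0), (-1, 1)), ((-1, 1), (-1, 0), (0, 0), (0, 1)), ((1, 0), (-1,
   0), (-1, 0), (1, 0)), ((-1, 1), (0, 0), (0, -1), (1, 0)), ((1, 0), (1, 0), (-1, 0), (1, 0)),
   ((-1, 1), (1, 0), (0, 0), (0, 1)), ((0, 0), (1, -1), (-1, 0), (0, -1)), ((0, 0), (-1, 1),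
   (-1, 0), (0, -1)), ((1, 0), (1, 0), (1, 0), (-1, 0)), ((-1, 1), (0, 0), (0, 1), (-1, 0)),
   ((1, 0), (-1, 0), (1, 0), (-1, 0)), ((1, 0), (0, -1), (0, 0), (1, -1)), ((1, 0), (-1, 0),
   (-1, 0), (-1, 0)), ((1, 0), (1, 0), (-1, 0), (-1, 0)), ((1, 0), (0, 1), (0, 0), (1, -1)),
   ((1, 0), (-1, 0), (1, 0), (1, 0)), ((1, 0), (0, -1), (0, 0), (-1, 1)), ((1, 0), (1, -1), (0,
   -1), (0, 0)), ((1, 0), (-1, 1), (0, -1), (0, 0)), ((1, 0), (0, 1), (0, 0), (-1, 1)), ((1, 0),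
   (1, 0), (1, 0), (1, 0)), ((-1, 1), (0, 0), (0, 1), (1, 0)), ((0, 0), (0, -1), (1, -1), (1,
   0)), ((0, 0), (-1, 0), (0, -1), (-1, 1)), ((0, 0), (1, 0), (0, -1), (-1, 1)), ((0, 0), (0,
   -1), (-1, 1), (-1, 0)), ((0, 0), (0, -1), (1, -1), (-1, 0)), ((-1, 1), (0, 0), (0, -1), (-1,
   0)), ((0, 0), (0, -1), (-1, 1), (1, 0)), ((1, 0), (-1, 1), (0, 1), (0, 0)), ((1, 0), (1, -1),
   (0, 1), (0, 0)), ((-1, 1), (0, -1), (1, 0), (0, 0)), ((-1, 1), (0, -1), (-1, 0), (0, 0)),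
   ((-1, 1), (0, 1), (-1, 0), (0, 0)), ((-1, 1), (0, 1), (1, 0), (0, 0)), ((0, 0), (0, 0), (-2,
   0), (0, 0)), ((0, 0), (-1, 0), (0, -1), (1, -1)), ((0, 0), (1, 0), (0, -1), (1, -1)), ((0,
   0), (-2, 0), (0, 0), (0, 0))]

/-- The permutation of `icosaElems` through left multiplication by the first generator. -/
def icosaPerm₁ : List ℕ :=
  [1, 3, 5, 0, 7, 8, 10, 11, 2, 14, 15, 4, 18, 19, 20, 6, 23, 24, 25, 26, 9, 22, 29, 30, 31, 12,
   13, 34, 35, 21, 16, 17, 38, 39, 40, 41, 43, 44, 45, 46, 27, 28, 49, 50, 51, 32, 33, 48, 54,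
   55, 36, 37, 53, 56, 47, 42, 52, 58, 59, 57]

/-- The permutation of `icosaElems` through left multiplication by the second generator. -/
def icosaPerm₂ : List ℕ :=
  [2, 4, 0, 6, 1, 9, 3, 12, 13, 5, 16, 17, 7, 8, 21, 22, 10, 11, 26, 27, 28, 14, 15, 31, 32, 33,
   18, 19, 20, 36, 37, 23, 24, 25, 41, 42, 29, 30, 46, 47, 48, 34, 35, 51, 52, 53, 38, 39, 40,
   50, 49, 43, 44, 45, 57, 58, 59, 54, 55, 56]

/-- The function on `Fin m` given by a list of quaternions. -/
def tableElem (l : List IntQuat) {m : ℕ} (i : Fin m) : IntQuat := l.getD i 0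

/-- A self-map of `Fin m` given by the list of its values. -/
def tablePerm (m : ℕ) [NeZero m] (l : List ℕ) (i : Fin m) : Fin m := Fin.ofNat m (l.getD i 0)

/-- The character depends only on the real coordinate, so a sum over the table reduces to the
multiplicities of the traces. -/
theorem sum_tableElem {m : ℕ} (x : Fin m → IntQuat) (F : ℤ × ℤ → ℂ) (M : Multiset (ℤ × ℤ))
    (hM : (Finset.univ : Finset (Fin m)).val.map (fun i => (x i).1) = M) :
    ∑ i, F (x i).1 = (M.map F).sum := by
  rw [← hM, Multiset.map_map]
  rfl

theorem finrank_commutant_groupE6_aux (n : ℕ) :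
    (Module.finrank ℂ (commutant n (groupE6 : Set (SU 2))) : ℂ) * 12 =
      symTrace n (2 : ℝ) * conj (symTrace n (2 : ℝ)) +
      3 * (symTrace n (0 : ℝ) * conj (symTrace n (0 : ℝ))) +
      8 * (symTrace n (1 : ℝ) * conj (symTrace n (1 : ℝ))) := by
  have hT : genT.1 = quatMat 0 ((1, 0), (1, 0), (1, 0), (1, 0)) := by
    ext i j
    fin_cases i <;> fin_cases j <;> simp [genT, quatMat, quadVal] <;> ring
  have hI : genI.1 = quatMat 0 ((0, 0), (0, 0), (0, 0), (-2, 0)) := by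
    ext i j
    fin_cases i <;> fin_cases j <;> simp [genI, quatMat, quadVal] <;> ring
  -- All coordinates are integral here, so θ = 0 with p = q = 0 makes the second component of each
  -- coordinate inert.
  have h := finrank_commutant_of_table (m := 12) n (θ := 0) (p := 0) (q := 0) (by norm_num) hT hI
    (tableElem tetraElems) (tablePerm 12 tetraPerm₁) (tablePerm 12 tetraPerm₂)
    (by decide +kernel) (by decide +kernel) (by decide +kernel) (by decide +kernel)
    (by decide +kernel) (by decide +kernel)
  rw [groupE6, show (12 : ℂ) = ((12 : ℕ) : ℂ) by norm_num, h,
    sum_tableElem (tableElem tetraElems) (fun a => symTrace n (quadVal 0 a) *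
      conj (symTrace n (quadVal 0 a))) (Multiset.replicate 1 (2, 0) + Multiset.replicate 3 (0, 0) +
      Multiset.replicate 8 (1, 0)) (by decide +kernel)]
  simp only [Multiset.map_add, Multiset.map_replicate, Multiset.sum_add, Multiset.sum_replicate,
    nsmul_eq_mul, quadVal]
  norm_num

theorem finrank_commutant_groupE7_aux (n : ℕ) :
    (Module.finrank ℂ (commutant n (groupE7 : Set (SU 2))) : ℂ) * 24 =
      symTrace n (2 : ℝ) * conj (symTrace n (2 : ℝ)) +
      9 * (symTrace n (0 : ℝ) * conj (symTrace n (0 : ℝ))) +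
      8 * (symTrace n (1 : ℝ) * conj (symTrace n (1 : ℝ))) +
      6 * (symTrace n (√2 : ℝ) * conj (symTrace n (√2 : ℝ))) := by
  have hT : genT.1 = quatMat (√2) ((1, 0), (1, 0), (1, 0), (1, 0)) := by
    ext i j
    fin_cases i <;> fin_cases j <;> simp [genT, quatMat, quadVal] <;> ring
  have hO : genO.1 = quatMat (√2) ((0, 0), (0, 0), (0, 1), (0, 1)) := by
    ext i j
    fin_cases i <;> fin_cases j <;> simp [genO, quatMat, quadVal] <;> ring
  have h := finrank_commutant_of_table (m := 24) n (θ := √2) (p := 2) (q := 0) (by norm_num) hT hO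
    (tableElem octaElems) (tablePerm 24 octaPerm₁) (tablePerm 24 octaPerm₂)
    (by decide +kernel) (by decide +kernel) (by decide +kernel) (by decide +kernel)
    (by decide +kernel) (by decide +kernel)
  rw [groupE7, show (24 : ℂ) = ((24 : ℕ) : ℂ) by norm_num, h,
    -- The multiplicities count rotations of the cube by angle: the identity, nine half turns (trace
    -- 0), eight of order three (trace 1) and six of order four (trace √2).
    sum_tableElem (tableElem octaElems) (fun a => symTrace n (quadVal (√2) a) *
      conj (symTrace n (quadVal (√2) a))) (Multiset.replicate 1 (2, 0) +
      Multiset.replicate 9 (0, 0) + Multiset.replicate 8 (1, 0) + Multiset.replicate 6 (0, 1))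
      (by decide +kernel)]
  simp only [Multiset.map_add, Multiset.map_replicate, Multiset.sum_add, Multiset.sum_replicate,
    nsmul_eq_mul, quadVal]
  norm_num

theorem finrank_commutant_groupE8_aux (n : ℕ) :
    (Module.finrank ℂ (commutant n (groupE8 : Set (SU 2))) : ℂ) * 60 =
      symTrace n (2 : ℝ) * conj (symTrace n (2 : ℝ)) +
      15 * (symTrace n (0 : ℝ) * conj (symTrace n (0 : ℝ))) +
      20 * (symTrace n (1 : ℝ) * conj (symTrace n (1 : ℝ))) +
      12 * (symTrace n (((1 + √5) / 2 : ℝ)) * conj (symTrace n (((1 + √5) / 2 : ℝ)))) +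
      12 * (symTrace n ((-1 + (1 + √5) / 2 : ℝ)) *
        conj (symTrace n ((-1 + (1 + √5) / 2 : ℝ)))) := by
  have h5 : √5 ^ 2 = 5 := Real.sq_sqrt (by norm_num)
  have hE : genE.1 = quatMat ((1 + √5) / 2) ((1, 0), (0, 0), (1, -1), (0, 1)) := by
    ext i j
    fin_cases i <;> fin_cases j <;> simp [genE, quatMat, quadVal] <;> ring
  have hI : genI.1 = quatMat ((1 + √5) / 2) ((0, 0), (0, 0), (0, 0), (-2, 0)) := by
    ext i j
    fin_cases i <;> fin_cases j <;> simp [genI, quatMat, quadVal] <;> ring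
  have h := finrank_commutant_of_table (m := 60) n (θ := (1 + √5) / 2) (p := 1) (q := 1)
    (by push_cast; linear_combination (1 / 4 : ℝ) * h5) hE hI
    (tableElem icosaElems) (tablePerm 60 icosaPerm₁) (tablePerm 60 icosaPerm₂)
    (by decide +kernel) (by decide +kernel) (by decide +kernel) (by decide +kernel)
    (by decide +kernel) (by decide +kernel)
  rw [groupE8, show (60 : ℂ) = ((60 : ℕ) : ℂ) by norm_num, h,
    -- For the icosahedron: the identity, fifteen half turns, twenty rotations of order three, and
    -- twelve for each of the two angles of order five, with traces 2 cos(π/5) and 2 cos(2π/5).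
    sum_tableElem (tableElem icosaElems) (fun a => symTrace n (quadVal ((1 + √5) / 2) a) *
      conj (symTrace n (quadVal ((1 + √5) / 2) a))) (Multiset.replicate 1 (2, 0) +
      Multiset.replicate 15 (0, 0) + Multiset.replicate 20 (1, 0) +
      Multiset.replicate 12 (0, 1) + Multiset.replicate 12 (-1, 1))
      (by decide +kernel)]
  simp only [Multiset.map_add, Multiset.map_replicate, Multiset.sum_add, Multiset.sum_replicate,
    nsmul_eq_mul, quadVal]
  norm_num

/-! ## Evaluation of the characters -/

theorem symTrace_mul_conj {n : ℕ} {t x : ℝ} (hx : Real.sin x ≠ 0) (ht : t = 2 * Real.cos x) :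
    symTrace n t * conj (symTrace n t) =
      (((Real.cos (n * x) + Real.cos x / Real.sin x * Real.sin (n * x)) ^ 2 : ℝ) : ℂ) := by
  rw [ht, symTrace_two_cos n hx, Complex.conj_ofReal, ← Complex.ofReal_mul, sq]

theorem symTrace_two_mul_conj (n : ℕ) :
    symTrace n (2 : ℝ) * conj (symTrace n (2 : ℝ)) = (((n + 1) ^ 2 : ℝ) : ℂ) := by
  rw [Complex.ofReal_ofNat, symTrace_two]
  simp [sq]

theorem symTrace_zero_mul_conj (n : ℕ) :
    symTrace n (0 : ℝ) * conj (symTrace n (0 : ℝ)) =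
      (((if Even n then 1 else 0 : ℝ)) : ℂ) := by
  rw [symTrace_mul_conj (x := Real.pi / 2) (by simp) (by simp), Real.cos_pi_div_two, zero_div,
    zero_mul, add_zero]
  congr 1
  rcases Nat.even_or_odd' n with ⟨m, rfl | rfl⟩
  · rw [if_pos (even_two_mul m)]
    have : ((2 * m : ℕ) : ℝ) * (Real.pi / 2) = m * Real.pi := by push_cast; ring
    rw [this, Real.cos_nat_mul_pi, ← pow_mul, mul_comm, pow_mul]
    simp
  · rw [if_neg (by simp)]
    have : ((2 * m + 1 : ℕ) : ℝ) * (Real.pi / 2) = m * Real.pi + Real.pi / 2 := by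
      push_cast; ring
    rw [this, Real.cos_add_pi_div_two, Real.sin_nat_mul_pi]
    simp

theorem symTrace_one_mul_conj (n : ℕ) :
    symTrace n (1 : ℝ) * conj (symTrace n (1 : ℝ)) =
      (((Real.cos (n * Real.pi / 3) + √3 / 3 * Real.sin (n * Real.pi / 3)) ^ 2 : ℝ) : ℂ) := by
  have h3 : √3 ^ 2 = 3 := Real.sq_sqrt (by norm_num)
  have h0 : √3 ≠ 0 := by positivity
  rw [symTrace_mul_conj (x := Real.pi / 3) (by rw [Real.sin_pi_div_three]; positivity)
    (by rw [Real.cos_pi_div_three]; norm_num), Real.cos_pi_div_three, Real.sin_pi_div_three]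
  have : (1 / 2 : ℝ) / (√3 / 2) = √3 / 3 := by
    field_simp
    linarith
  rw [this, mul_div_assoc]

theorem symTrace_sqrt_two_mul_conj (n : ℕ) :
    symTrace n (√2 : ℝ) * conj (symTrace n (√2 : ℝ)) =
      (((Real.cos (n * Real.pi / 4) + Real.sin (n * Real.pi / 4)) ^ 2 : ℝ) : ℂ) := by
  have h0 : √2 / 2 ≠ 0 := by positivity
  rw [symTrace_mul_conj (x := Real.pi / 4) (by rwa [Real.sin_pi_div_four])
    (by rw [Real.cos_pi_div_four]; ring), Real.cos_pi_div_four, Real.sin_pi_div_four, div_self h0,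
    one_mul, mul_div_assoc]

/-- The hypothesis on y says that y is the squared cotangent; positivity selects the square root.
This produces the radicals √(1 ± 2/√5). -/
theorem cos_div_sin_eq_sqrt {x y : ℝ} (hc : 0 < Real.cos x) (hs : 0 < Real.sin x)
    (hy : y * (1 - Real.cos x ^ 2) = Real.cos x ^ 2) : Real.cos x / Real.sin x = √y := by
  have h : y = (Real.cos x / Real.sin x) ^ 2 := by
    rw [div_pow, eq_div_iff (by positivity), Real.sin_sq, hy]
  rw [h, Real.sqrt_sq (div_pos hc hs).le]

theorem sin_pi_div_five_pos : 0 < Real.sin (Real.pi / 5) :=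
  Real.sin_pos_of_pos_of_lt_pi (by positivity) (by linarith [Real.pi_pos])

theorem sin_two_pi_div_five_pos : 0 < Real.sin (2 * Real.pi / 5) :=
  Real.sin_pos_of_pos_of_lt_pi (by positivity) (by linarith [Real.pi_pos])

theorem cos_two_pi_div_five : Real.cos (2 * Real.pi / 5) = (√5 - 1) / 4 := by
  have h5 : √5 ^ 2 = 5 := Real.sq_sqrt (by norm_num)
  rw [mul_div_assoc, Real.cos_two_mul, Real.cos_pi_div_five]
  linear_combination (1 / 8 : ℝ) * h5

theorem symTrace_golden_mul_conj (n : ℕ) :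
    symTrace n (((1 + √5) / 2 : ℝ)) * conj (symTrace n (((1 + √5) / 2 : ℝ))) =
      (((√(1 + 2 / √5) * Real.sin (n * Real.pi / 5) + Real.cos (n * Real.pi / 5)) ^ 2 : ℝ) : ℂ) := by
  have h5 : √5 ^ 2 = 5 := Real.sq_sqrt (by norm_num)
  have h0 : √5 ≠ 0 := by positivity
  rw [symTrace_mul_conj sin_pi_div_five_pos.ne' (by rw [Real.cos_pi_div_five]; ring),
    cos_div_sin_eq_sqrt (y := 1 + 2 / √5) (by rw [Real.cos_pi_div_five]; positivity)
      sin_pi_div_five_pos (by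
        rw [Real.cos_pi_div_five]
        field_simp
        linear_combination (-2 * √5 - 6 : ℝ) * h5), mul_div_assoc, add_comm]

theorem symTrace_golden_conj_mul_conj (n : ℕ) :
    symTrace n ((-1 + (1 + √5) / 2 : ℝ)) * conj (symTrace n ((-1 + (1 + √5) / 2 : ℝ))) =
      (((√(1 - 2 / √5) * Real.sin (2 * n * Real.pi / 5) + Real.cos (2 * n * Real.pi / 5)) ^ 2 : ℝ) :
        ℂ) := by
  have h5 : √5 ^ 2 = 5 := Real.sq_sqrt (by norm_num)
  have h0 : √5 ≠ 0 := by positivity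
  have h1 : 1 < √5 := by
    rw [Real.lt_sqrt] <;> norm_num
  rw [symTrace_mul_conj sin_two_pi_div_five_pos.ne' (by rw [cos_two_pi_div_five]; ring),
    cos_div_sin_eq_sqrt (y := 1 - 2 / √5) (by rw [cos_two_pi_div_five]; linarith)
      sin_two_pi_div_five_pos (by
        rw [cos_two_pi_div_five]
        field_simp
        linear_combination (-2 * √5 + 6 : ℝ) * h5)]
  have h2 : (n : ℝ) * (2 * Real.pi / 5) = 2 * n * Real.pi / 5 := by ring
  rw [h2, add_comm]

/-! ### Closed formulas for the dimensions of the commutants -/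

theorem finrank_commutant_groupE6 (n : ℕ) :
    (Module.finrank ℂ (commutant n (groupE6 : Set (SU 2))) : ℝ) * 12 = ((n : ℝ) + 1) ^ 2 +
      3 * (if Even n then 1 else 0) +
      8 * (Real.cos (n * Real.pi / 3) + √3 / 3 * Real.sin (n * Real.pi / 3)) ^ 2 := by
  have h := finrank_commutant_groupE6_aux n
  rw [symTrace_two_mul_conj, symTrace_zero_mul_conj, symTrace_one_mul_conj] at h
  exact_mod_cast h

theorem finrank_commutant_groupE7 (n : ℕ) :
    (Module.finrank ℂ (commutant n (groupE7 : Set (SU 2))) : ℝ) * 24 = ((n : ℝ) + 1) ^ 2 +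
      9 * (if Even n then 1 else 0) +
      8 * (Real.cos (n * Real.pi / 3) + √3 / 3 * Real.sin (n * Real.pi / 3)) ^ 2 +
      6 * (Real.cos (n * Real.pi / 4) + Real.sin (n * Real.pi / 4)) ^ 2 := by
  have h := finrank_commutant_groupE7_aux n
  rw [symTrace_two_mul_conj, symTrace_zero_mul_conj, symTrace_one_mul_conj,
    symTrace_sqrt_two_mul_conj] at h
  exact_mod_cast h

theorem finrank_commutant_groupE8 (n : ℕ) :
    (Module.finrank ℂ (commutant n (groupE8 : Set (SU 2))) : ℝ) * 60 = ((n : ℝ) + 1) ^ 2 +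
      15 * (if Even n then 1 else 0) +
      20 * (Real.cos (n * Real.pi / 3) + √3 / 3 * Real.sin (n * Real.pi / 3)) ^ 2 +
      12 * (√(1 + 2 / √5) * Real.sin (n * Real.pi / 5) + Real.cos (n * Real.pi / 5)) ^ 2 +
      12 * (√(1 - 2 / √5) * Real.sin (2 * n * Real.pi / 5) +
        Real.cos (2 * n * Real.pi / 5)) ^ 2 := by
  have h := finrank_commutant_groupE8_aux n
  rw [symTrace_two_mul_conj, symTrace_zero_mul_conj, symTrace_one_mul_conj,
    symTrace_golden_mul_conj, symTrace_golden_conj_mul_conj] at h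
  exact_mod_cast h

theorem finrank_commutant_cyclicC_real (n : ℕ) {k : ℕ} (hk : 1 ≤ k) :
    (Module.finrank ℂ (commutant n (cyclicC k : Set (SU 2))) : ℝ) =
      (-((k : ℝ) / Nat.gcd k 2) * (⌊(n * Nat.gcd k 2 : ℝ) / k⌋ : ℝ) ^ 2 +
        (2 * n + 2 - (k : ℝ) / Nat.gcd k 2) * (⌊(n * Nat.gcd k 2 : ℝ) / k⌋ : ℝ) + n) + 1 := by
  have hg : 0 < Nat.gcd k 2 := Nat.gcd_pos_of_pos_left _ hk
  have hg' : (Nat.gcd k 2 : ℝ) ≠ 0 := by exact_mod_cast hg.ne'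
  have hq : (k : ℝ) / Nat.gcd k 2 = ((k / Nat.gcd k 2 : ℕ) : ℝ) :=
    (Nat.cast_div (Nat.gcd_dvd_left k 2) hg').symm
  have h := finrank_commutant_cyclicC n hk
  rw [pairCount_eq] at h
  rw [← div_div_eq_mul_div, hq, floor_natCast_div]
  generalize k / Nat.gcd k 2 = q at h ⊢
  generalize n / q = a at h ⊢
  have h' := congrArg (Int.cast : ℤ → ℝ) h
  push_cast at h'
  exact h'

theorem finrank_commutant_dihedralD_real (n : ℕ) {k : ℕ} (hk : 1 ≤ k) (c : Circle) :
    (Module.finrank ℂ (commutant n (dihedralD k c : Set (SU 2))) : ℝ) =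
      (-((k : ℝ) / 2) * (⌊(n : ℝ) / k⌋ : ℝ) ^ 2 +
        (n + 1 - (k : ℝ) / 2) * (⌊(n : ℝ) / k⌋ : ℝ) + ⌊(n : ℝ) / 2⌋) + 1 := by
  have h := finrank_commutant_dihedralD n hk c
  rw [pairCount_eq] at h
  have h2 : (⌊(n : ℝ) / 2⌋ : ℝ) = ((n / 2 : ℕ) : ℝ) := by
    simpa using floor_natCast_div (k := 2) (n := n)
  -- The contribution of the central index in the even case is exactly what turns n/2 into ⌊n/2⌋.
  have h3 : (n : ℤ) + (if Even n then 1 else 0) = 2 * ((n / 2 : ℕ) : ℤ) + 1 := by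
    split_ifs with he
    · obtain ⟨m, rfl⟩ := he
      omega
    · obtain ⟨m, rfl⟩ := Nat.not_even_iff_odd.1 he
      omega
  have h4 : 2 * (Module.finrank ℂ (commutant n (dihedralD k c : Set (SU 2))) : ℤ) =
      -(k : ℤ) * ((n / k : ℕ) : ℤ) ^ 2 + (2 * n + 2 - k) * ((n / k : ℕ) : ℤ) +
        2 * ((n / 2 : ℕ) : ℤ) + 2 := by
    linear_combination h + h3
  rw [floor_natCast_div, h2]
  generalize n / k = a at h4 ⊢
  generalize n / 2 = b at h4 ⊢
  have h5 := congrArg (Int.cast : ℤ → ℝ) h4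
  push_cast at h5
  linear_combination h5 / 2

/-! ### Explicit descriptions of Δ_v for the infinite, cyclic and dihedral groups -/

theorem one_mem_upperPos (n : ℕ) : (1 : SLC (n + 1)) ∈ upperPos n :=
  ⟨fun _ _ hij => Matrix.one_apply_ne hij.ne', fun _ => ⟨1, one_pos, by simp⟩⟩

section Closure

variable {S E : Type*} [TopologicalSpace S] [ChartedSpace ℂ S] [TopologicalSpace E]

theorem deltaSet_eq_singleton_one {pr : E → S} {v : E → CP 2} (hv : IsUnitaryCurve pr v)
    (hinf : (Set.range v).Infinite)
    (hG : closedMonodromy pr v = Set.univ) (n : ℕ) : deltaSet n pr v = {1} := by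
  ext A
  rw [mem_deltaSet_iff hv hinf, hG, Set.mem_singleton_iff]
  constructor
  · rintro ⟨hA, h⟩
    exact eq_one_of_gram_mem_commutant_univ hA fun γ _ => h γ (Set.mem_univ _)
  · rintro rfl
    refine ⟨one_mem_upperPos n, fun γ _ => ?_⟩
    simp

theorem deltaSet_of_U1 {pr : E → S} {v : E → CP 2} (hv : IsUnitaryCurve pr v)
    (hinf : (Set.range v).Infinite)
    (hG : closedMonodromy pr v = psuImage U1) (n : ℕ) :
    deltaSet n pr v = {A | A ∈ upperPos n ∧ ∀ i j, i ≠ j → A.1 i j = 0} := by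
  ext A
  rw [mem_deltaSet_iff_commutant hv hinf hG]
  exact and_congr_right fun hA => (gram_mem_commutant_iff hA le_rfl).trans mem_commutant_U1

theorem deltaSet_of_O2 {pr : E → S} {v : E → CP 2} (hv : IsUnitaryCurve pr v)
    (hinf : (Set.range v).Infinite)
    (hG : closedMonodromy pr v = psuImage O2) (n : ℕ) :
    deltaSet n pr v = {A | A ∈ upperPos n ∧ (∀ i j, i ≠ j → A.1 i j = 0) ∧
      ∀ i : Fin (n + 1), A.1 i i = A.1 i.rev i.rev} := by
  ext A
  rw [mem_deltaSet_iff_commutant hv hinf hG]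
  exact and_congr_right fun hA => gram_mem_commutant_O2_iff hA

theorem deltaSet_of_cyclicC {pr : E → S} {v : E → CP 2} (hv : IsUnitaryCurve pr v)
    (hinf : (Set.range v).Infinite)
    {k : ℕ} (hk : 1 ≤ k) (hG : closedMonodromy pr v = psuImage (cyclicC k)) (n : ℕ) :
    deltaSet n pr v = {A | A ∈ upperPos n ∧ ∀ i j : Fin (n + 1),
      ¬ ((k / Nat.gcd k 2 : ℕ) : ℤ) ∣ (i : ℤ) - (j : ℤ) → A.1 i j = 0} := by
  ext A
  rw [mem_deltaSet_iff_commutant hv hinf hG]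
  exact and_congr_right fun hA =>
    (gram_mem_commutant_iff hA (cyclicC_le_U1 k)).trans (mem_commutant_cyclicC hk)

theorem deltaSet_of_dihedralD {pr : E → S} {v : E → CP 2} (hv : IsUnitaryCurve pr v)
    (hinf : (Set.range v).Infinite)
    {k : ℕ} (hk : 1 ≤ k) {c : Circle} (hG : closedMonodromy pr v = psuImage (dihedralD k c))
    (n : ℕ) :
    deltaSet n pr v = {A | A ∈ upperPos n ∧
      (∀ i j : Fin (n + 1), ¬ (k : ℤ) ∣ (i : ℤ) - (j : ℤ) →
        ∑ l, conj (A.1 l i) * A.1 l j = 0) ∧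
      ∀ i j : Fin (n + 1), ∑ l, conj (A.1 l i) * A.1 l j =
        (-(c : ℂ) ^ 2) ^ ((i : ℤ) - (j : ℤ)) *
          ∑ l, conj (A.1 l i.rev) * A.1 l j.rev} := by
  ext A
  rw [mem_deltaSet_iff_commutant hv hinf hG, mem_commutant_dihedralD hk]
  exact Iff.rfl

end Closure

end TodaCurve

end

/-! ### The theorem -/

open TodaCurve in
theorem theorem1p3
    -- a Riemann surface `S` with its universal covering `pr : E → S`
    {S : Type*} [TopologicalSpace S] [T2Space S] [ConnectedSpace S] [ChartedSpace ℂ S]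
    [IsManifold 𝓘(ℂ, ℂ) ω S]
    {E : Type*} [TopologicalSpace E] [SimplyConnectedSpace E]
    (pr : E → S) (hpr : IsCoveringMap pr)
    -- a totally unramified unitary curve `v` from `S` to the projective line
    (v : E → CP 2) (hv : IsUnitaryCurve pr v) (hvu : IsTotallyUnramified pr v)
    (n : ℕ) (hn : 1 ≤ n) :
    -- the decomposition of `M_v`, with the only possible `Δ_v`
    (deltaSet n pr v ⊆ upperPos n ∧
      unitarySet n pr v = psuMul n (deltaSet n pr v) ∧
      ∀ D : Set (SLC (n + 1)), D ⊆ upperPos n → unitarySet n pr v = psuMul n D →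
        D = deltaSet n pr v) ∧
    -- `Δ_v` is determined by the closure of the monodromy group
    (∀ {S' : Type*} [TopologicalSpace S'] [T2Space S'] [ConnectedSpace S'] [ChartedSpace ℂ S']
        [IsManifold 𝓘(ℂ, ℂ) ω S'] {E' : Type*} [TopologicalSpace E'] [SimplyConnectedSpace E']
        (pr' : E' → S') (_ : IsCoveringMap pr') (v' : E' → CP 2)
        (_ : IsUnitaryCurve pr' v') (_ : IsTotallyUnramified pr' v'),
        closedMonodromy pr' v' = closedMonodromy pr v →
          deltaSet n pr' v' = deltaSet n pr v) ∧
    -- (1)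
    (closedMonodromy pr v = Set.univ → deltaSet n pr v = {1}) ∧
    -- (2)
    (closedMonodromy pr v = psuImage U1 →
      deltaSet n pr v = {A | A ∈ upperPos n ∧ ∀ i j, i ≠ j → A.1 i j = 0} ∧
      HasRealDim (deltaSet n pr v) n) ∧
    -- (3)
    (closedMonodromy pr v = psuImage O2 →
      deltaSet n pr v = {A | A ∈ upperPos n ∧ (∀ i j, i ≠ j → A.1 i j = 0) ∧
        ∀ i : Fin (n + 1), A.1 i i = A.1 i.rev i.rev} ∧
      HasRealDim (deltaSet n pr v) (n / 2 : ℕ)) ∧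
    -- (4)
    (∀ k : ℕ, 1 ≤ k → closedMonodromy pr v = psuImage (cyclicC k) →
      deltaSet n pr v = {A | A ∈ upperPos n ∧ ∀ i j : Fin (n + 1),
        ¬ ((k / Nat.gcd k 2 : ℕ) : ℤ) ∣ (i : ℤ) - (j : ℤ) → A.1 i j = 0} ∧
      HasRealDim (deltaSet n pr v)
        (-((k : ℝ) / Nat.gcd k 2) * (⌊(n * Nat.gcd k 2 : ℝ) / k⌋ : ℝ) ^ 2
          + (2 * n + 2 - (k : ℝ) / Nat.gcd k 2) * (⌊(n * Nat.gcd k 2 : ℝ) / k⌋ : ℝ) + n)) ∧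
    -- (5)
    (∀ (k : ℕ) (c : Circle), 1 ≤ k → closedMonodromy pr v = psuImage (dihedralD k c) →
      deltaSet n pr v = {A | A ∈ upperPos n ∧
        (∀ i j : Fin (n + 1), ¬ (k : ℤ) ∣ (i : ℤ) - (j : ℤ) →
          ∑ l, conj (A.1 l i) * A.1 l j = 0) ∧
        ∀ i j : Fin (n + 1), ∑ l, conj (A.1 l i) * A.1 l j =
          (-(c : ℂ) ^ 2) ^ ((i : ℤ) - (j : ℤ)) *
            ∑ l, conj (A.1 l i.rev) * A.1 l j.rev} ∧
      HasRealDim (deltaSet n pr v)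
        (-((k : ℝ) / 2) * (⌊(n : ℝ) / k⌋ : ℝ) ^ 2
          + (n + 1 - (k : ℝ) / 2) * (⌊(n : ℝ) / k⌋ : ℝ) + ⌊(n : ℝ) / 2⌋)) ∧
    -- (6)
    (closedMonodromy pr v = psuImage groupE6 →
      ∀ c : ℝ, c = Real.cos (n * Real.pi / 3) + Real.sqrt 3 / 3 * Real.sin (n * Real.pi / 3) →
      (Odd n → HasRealDim (deltaSet n pr v)
        ((n : ℝ) ^ 2 / 12 + 2 * c ^ 2 / 3 + n / 6 - 11 / 12)) ∧
      (Even n → HasRealDim (deltaSet n pr v)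
        ((n : ℝ) ^ 2 / 12 + 2 * c ^ 2 / 3 + n / 6 - 2 / 3))) ∧
    -- (7)
    (closedMonodromy pr v = psuImage groupE7 →
      ∀ c₁ c₂ : ℝ,
      c₁ = Real.cos (n * Real.pi / 3) + Real.sqrt 3 / 3 * Real.sin (n * Real.pi / 3) →
      c₂ = Real.cos (n * Real.pi / 4) + Real.sin (n * Real.pi / 4) →
      (Odd n → HasRealDim (deltaSet n pr v)
        ((n : ℝ) ^ 2 / 24 + n / 12 + c₁ ^ 2 / 3 + c₂ ^ 2 / 4 - 23 / 24)) ∧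
      (Even n → HasRealDim (deltaSet n pr v)
        ((n : ℝ) ^ 2 / 24 + n / 12 + c₁ ^ 2 / 3 + c₂ ^ 2 / 4 - 7 / 12))) ∧
    -- (8)
    (closedMonodromy pr v = psuImage groupE8 →
      ∀ c₁ c₂ c₃ : ℝ,
      c₁ = Real.cos (n * Real.pi / 3) + Real.sqrt 3 / 3 * Real.sin (n * Real.pi / 3) →
      c₂ = Real.sqrt (1 + 2 / Real.sqrt 5) * Real.sin (n * Real.pi / 5)
        + Real.cos (n * Real.pi / 5) →
      c₃ = Real.sqrt (1 - 2 / Real.sqrt 5) * Real.sin (2 * n * Real.pi / 5)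
        + Real.cos (2 * n * Real.pi / 5) →
      (Odd n → HasRealDim (deltaSet n pr v)
        ((n : ℝ) ^ 2 / 60 + n / 30 + c₁ ^ 2 / 3 + c₂ ^ 2 / 5 + c₃ ^ 2 / 5 - 59 / 60)) ∧
      (Even n → HasRealDim (deltaSet n pr v)
        ((n : ℝ) ^ 2 / 60 + n / 30 + c₁ ^ 2 / 3 + c₂ ^ 2 / 5 + c₃ ^ 2 / 5 - 11 / 15))) := by
  have : Nonempty E := inferInstance
  have hinf := hvu.infinite_range hpr
  have hodd : Odd n → (if Even n then (1 : ℝ) else 0) = 0 :=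
    fun h => if_neg (Nat.not_even_iff_odd.2 h)
  refine ⟨⟨fun A hA => hA.1, unitarySet_eq_psuMul hv hinf n, fun D hD h => ?_⟩, ?_,
    fun hG => deltaSet_eq_singleton_one hv hinf hG n,
    fun hG => ⟨deltaSet_of_U1 hv hinf hG n, hasRealDim_deltaSet hv hinf hG ?_⟩,
    fun hG => ⟨deltaSet_of_O2 hv hinf hG n, hasRealDim_deltaSet hv hinf hG ?_⟩,
    fun k hk hG => ⟨deltaSet_of_cyclicC hv hinf hk hG n,
      hasRealDim_deltaSet hv hinf hG (finrank_commutant_cyclicC_real n hk)⟩,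
    fun k c hk hG => ⟨deltaSet_of_dihedralD hv hinf hk hG n,
      hasRealDim_deltaSet hv hinf hG (finrank_commutant_dihedralD_real n hk c)⟩, ?_, ?_, ?_⟩
  · have h' := (unitarySet_eq_psuMul hv hinf n).symm.trans h
    exact (eq_of_psuMul_eq hD (fun A hA => hA.1) h'.ge).antisymm
      (eq_of_psuMul_eq (fun A hA => hA.1) hD h'.le)
  · intro S' _ _ _ _ _ E' _ _ pr' hpr' v' hv' hvu' hG
    have hinf' := hvu'.infinite_range hpr'
    ext A
    -- The criterion for membership mentions the curve only through its closed monodromy group.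
    rw [mem_deltaSet_iff hv' hinf', mem_deltaSet_iff hv hinf, hG]
  · exact_mod_cast finrank_commutant_U1 n
  · exact_mod_cast finrank_commutant_O2 n
  · rintro hG c rfl
    -- The constant ε gathers the 1 of (n+1)², the parity term and the dimension lost to the
    -- determinant: 1/12 - 1 = -11/12 for n odd and (1 + 3)/12 - 1 = -2/3 for n even. The other two
    -- polyhedral groups are handled in the same way.
    have h := finrank_commutant_groupE6 n
    refine ⟨fun ho => hasRealDim_deltaSet hv hinf hG ?_,
      fun he => hasRealDim_deltaSet hv hinf hG ?_⟩
    · rw [hodd ho] at h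
      linear_combination h / 12
    · rw [if_pos he] at h
      linear_combination h / 12
  · rintro hG c₁ c₂ rfl rfl
    have h := finrank_commutant_groupE7 n
    refine ⟨fun ho => hasRealDim_deltaSet hv hinf hG ?_,
      fun he => hasRealDim_deltaSet hv hinf hG ?_⟩
    · rw [hodd ho] at h
      linear_combination h / 24
    · rw [if_pos he] at h
      linear_combination h / 24
  · rintro hG c₁ c₂ c₃ rfl rfl rfl
    have h := finrank_commutant_groupE8 n
    refine ⟨fun ho => hasRealDim_deltaSet hv hinf hG ?_,
      fun he => hasRealDim_deltaSet hv hinf hG ?_⟩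
    · rw [hodd ho] at h
      linear_combination h / 60
    · rw [if_pos he] at h
      linear_combination h / 60
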